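/- A Steiner triple system of order $v$, or STS$(v)$, is a pair $(V,\mathcal B)$ of a set $V$ of $v\ge 1$ points and a set $\mathcal B$ of $3$-subsets of $V$ (blocks) such that every $2$-subset of $V$ lies in exactly one block. An $n$-line configuration is (up to isomorphism) a set $\mathcal B'$ of $n$ blocks of some finite Steiner triple system, with point set $\bigcup_{B\in\mathcal B'}B$; an isomorphism is a bijection of the point sets mapping lines onto lines. The number of occurrences of a configuration in an STS$(v)$ is the number of sets of blocks of the system isomorphic to it. A configuration is variable if its number of occurrences in an STS$(v)$ is not determined by $v$ alone, and full if each of its points is on at least two of its lines. A set $V_0$ of points of a configuration generates it if one obtains all its points from $V_0$ by repeatedly adding the third point of a line two of whose points are already present. (a) For every variable configuration $C$ with $6$ or $7$ lines, the number of occurrences of $C$ in an STS$(v)$ can be computed in time $O(v^4)$: there is a program for a random access machine with words of $O(\log v)$ bits and unit-cost operations that, given $v$ and any list of the blocks of any STS$(v)$ on $\{0,\dots,v-1\}$, outputs the number of occurrences of $C$ in it after $O(v^4)$ steps. The program and the constants depend only on $C$. (b) Up to isomorphism there are exactly $5$ full $6$-line configurations and exactly $19$ full $7$-line configurations, and each of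 them has a generating set of at most $4$ points. -/

import Mathlib

/-! ### Steiner triple systems and configurations -/

/-- `B` is the block set of a Steiner triple system on the (non-empty) point set `V`:
all blocks are 3-subsets, and any two distinct points lie in exactly one block. -/
def IsSTS {V : Type*} (B : Finset (Finset V)) : Prop :=
  Nonempty V ∧ (∀ b ∈ B, b.card = 3) ∧
    ∀ x y : V, x ≠ y → ∃! b : Finset V, b ∈ B ∧ x ∈ b ∧ y ∈ b

/-- The point set of a set of lines: the union of its lines. -/
def points {α : Type*} [DecidableEq α] (C : Finset (Finset α)) : Finset α :=
  C.biUnion id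

/-- Isomorphism of line sets: a map that is injective on the points and maps the set of
lines of `C` onto the set of lines of `D`. -/
def Isomorphic {α β : Type*} [DecidableEq α] [DecidableEq β]
    (C : Finset (Finset α)) (D : Finset (Finset β)) : Prop :=
  ∃ f : α → β, Set.InjOn f (points C : Set α) ∧ C.image (Finset.image f) = D

/-- The number of occurrences of `C` in the system with block set `B`: the number of sets
of blocks that are isomorphic to `C`. -/
noncomputable def occurrences {α V : Type*} [DecidableEq α] [DecidableEq V]
    (C : Finset (Finset α)) (B : Finset (Finset V)) : ℕ :=
  {D : Finset (Finset V) | D ⊆ B ∧ Isomorphic C D}.ncard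

/-- `C` is (up to isomorphism) a configuration: a set of lines of some finite Steiner triple
system. -/
def IsConfiguration (C : Finset (Finset ℕ)) : Prop :=
  ∃ (v : ℕ) (B D : Finset (Finset (Fin v))), IsSTS B ∧ D ⊆ B ∧ Isomorphic C D

/-- `C` is constant: its number of occurrences in a Steiner triple system of order `v`
depends only on `v`. -/
def IsConstant (C : Finset (Finset ℕ)) : Prop :=
  ∀ (v : ℕ) (B B' : Finset (Finset (Fin v))), IsSTS B → IsSTS B' →
    occurrences C B = occurrences C B'

/-- `C` is variable: it is not constant. -/
def IsVariable (C : Finset (Finset ℕ)) : Prop := ¬ IsConstant C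

/-- `C` is full: each of its points is on at least two of its lines. -/
def IsFull (C : Finset (Finset ℕ)) : Prop :=
  ∀ x ∈ points C, 2 ≤ (C.filter (fun b => x ∈ b)).card

/-- A full configuration with `n` lines. -/
def IsFullConfiguration (n : ℕ) (C : Finset (Finset ℕ)) : Prop :=
  IsConfiguration C ∧ IsFull C ∧ C.card = n

/-- One step of generation: add all points `z` for which there are `x`, `y` in the current
set such that `{x, y, z}` is a line. -/
def extendOnce (C : Finset (Finset ℕ)) (S : Finset ℕ) : Finset ℕ :=
  S ∪ (points C).filter (fun z => ∃ x ∈ S, ∃ y ∈ S, ({x, y, z} : Finset ℕ) ∈ C)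

/-- `S` is a generating set of `C`: its closure is the whole point set of `C`. -/
def Generates (C : Finset (Finset ℕ)) (S : Finset ℕ) : Prop :=
  S ⊆ points C ∧ ∃ j : ℕ, (extendOnce C)^[j] S = points C

/-- There are, up to isomorphism, exactly `N` line sets with property `P`: there is a
complete system of `N` pairwise non-isomorphic representatives. -/
def HasExactlyUpToIso (N : ℕ) (P : Finset (Finset ℕ) → Prop) : Prop :=
  ∃ F : Finset (Finset (Finset ℕ)), F.card = N ∧ (∀ C ∈ F, P C) ∧
    (∀ C ∈ F, ∀ D ∈ F, Isomorphic C D → C = D) ∧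
    ∀ C, P C → ∃ D ∈ F, Isomorphic C D

/-! ### Word random access machines -/

namespace RAM

/-- Instructions. The arguments `i`, `j`, `k` are register numbers; `l` is a position in the
program. -/
inductive Instr where
  /-- `reg i := n` -/
  | const (i n : ℕ)
  /-- `reg i := reg j` -/
  | copy (i j : ℕ)
  /-- `reg i := reg j + reg k` -/
  | add (i j k : ℕ)
  /-- `reg i := reg j - reg k`, or `0` if this is negative -/
  | sub (i j k : ℕ)
  /-- `reg i := reg j * reg k` -/
  | mul (i j k : ℕ)
  /-- `reg i := ⌊reg j / reg k⌋`, or `0` if `reg k = 0` -/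
  | div (i j k : ℕ)
  /-- `reg i := mem (reg j)` -/
  | load (i j : ℕ)
  /-- `mem (reg i) := reg j` -/
  | store (i j : ℕ)
  /-- continue at `l` -/
  | jump (l : ℕ)
  /-- continue at `l` if `reg i = 0` -/
  | jumpZero (i l : ℕ)

/-- A program is a finite list of instructions. -/
abbrev Program := List Instr

/-- A state: program counter, registers, and random access memory. -/
structure State where
  pc : ℕ
  reg : ℕ → ℕ
  mem : ℕ → ℕ

/-- Put `x` in register `i` and go on to the next instruction. -/
def State.put (s : State) (i x : ℕ) : State :=
  { s with pc := s.pc + 1, reg := Function.update s.reg i x }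

/-- The effect of one instruction. -/
def Instr.exec (s : State) : Instr → State
  | .const i n => s.put i n
  | .copy i j => s.put i (s.reg j)
  | .add i j k => s.put i (s.reg j + s.reg k)
  | .sub i j k => s.put i (s.reg j - s.reg k)
  | .mul i j k => s.put i (s.reg j * s.reg k)
  | .div i j k => s.put i (s.reg j / s.reg k)
  | .load i j => s.put i (s.mem (s.reg j))
  | .store i j => { s with pc := s.pc + 1, mem := Function.update s.mem (s.reg i) (s.reg j) }
  | .jump l => { s with pc := l }
  | .jumpZero i l => { s with pc := if s.reg i = 0 then l else s.pc + 1 }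

/-- One step: execute the instruction at the program counter; a halted machine stays put. -/
def step (P : Program) (s : State) : State :=
  match P[s.pc]? with
  | some I => I.exec s
  | none => s

/-- The machine has halted: the program counter has left the program. -/
def Halted (P : Program) (s : State) : Prop := P.length ≤ s.pc

/-- All registers and memory cells hold words of at most `W` bits. -/
def State.Fits (s : State) (W : ℕ) : Prop :=
  (∀ i, s.reg i < 2 ^ W) ∧ ∀ a, s.mem a < 2 ^ W

/-- Started in state `s`, the program halts after at most `T` steps with `out` in register `0`,
using only words of at most `W` bits. -/
def HaltsWithin (P : Program) (s : State) (T W out : ℕ) : Prop :=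
  ∃ t ≤ T, Halted P ((step P)^[t] s) ∧ ((step P)^[t] s).reg 0 = out ∧
    ∀ u ≤ t, ((step P)^[u] s).Fits W

end RAM

/-- `l` lists the blocks in `B`, each exactly once, in any order and with the points of a block
in any order. -/
def IsListing {v : ℕ} (l : List (Fin v × Fin v × Fin v)) (B : Finset (Finset (Fin v))) : Prop :=
  (l.map (fun t => ({t.1, t.2.1, t.2.2} : Finset (Fin v)))).Nodup ∧
    (l.map (fun t => ({t.1, t.2.1, t.2.2} : Finset (Fin v)))).toFinset = B

/-- The initial state for a listing of the blocks: the order `v` in register `0`, the number of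
blocks in register `1`, the listed triples one after the other in memory from address `0` on,
and `0` everywhere else. -/
def inputState {v : ℕ} (l : List (Fin v × Fin v × Fin v)) : RAM.State where
  pc := 0
  reg := fun i => [v, l.length].getD i 0
  mem := fun a => (l.flatMap (fun t => [(t.1 : ℕ), (t.2.1 : ℕ), (t.2.2 : ℕ)])).getD a 0

/-- The number of occurrences of `C` in Steiner triple systems of order `v` can be computed in
time `O(v ^ k)` on a random access machine with words of `O(log v)` bits: one program handles
all systems of all orders. -/
def CountableInTime (k : ℕ) (C : Finset (Finset ℕ)) : Prop :=
  ∃ (P : RAM.Program) (c w : ℕ), ∀ (v : ℕ) (B : Finset (Finset (Fin v))), IsSTS B →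
    ∀ l : List (Fin v × Fin v × Fin v), IsListing l B →
      RAM.HaltsWithin P (inputState l) (c * v ^ k) (w * (Nat.log 2 v + 1)) (occurrences C B)

/-! Counting. Occurrences of $C$ are the embeddings of its points that send lines to blocks, divided
by the number of automorphisms (`occurrences_eq_div`), so embeddings are counted. They are reduced
one point at a time, on a point set $P$ that may contain points on no line. A point on no line can
go anywhere outside the other images, which gives a factor $v-(|P|-1)$
(`card_embeddings_of_notMem_points`). If $p$ lies on the single line $\{p,q,s\}$, embed the rest:
the third point of the block through the images of $q$ and $s$ is either new, and then the only
possible image of $p$, or it is the image of some $t$, and then the rest together with $\{q,s,t\}$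
is embedded. So the count is the one without the line, minus the sum over $t$ of the counts with
$\{p,q,s\}$ replaced by $\{q,s,t\}$ (`card_embeddings_of_mem_line`). Points disappear and lines
never become more numerous, so at most seven lines lead to full systems with at most seven lines,
the empty one included, with coefficients polynomial in $v$ (`representable_card_embeddings`).

Full systems. Each point is encoded by the set of lines through it, which is injective by fullness.
The kernel enumerates all resulting dual structures (`IsDual`) and finds each one isomorphic to an
entry of a table (`exists_isomorphic_fullReps`). The entries with six or seven lines embed into one
system of order 15 and are separated by `degreeInvariant`; in every entry the first four points
generate the others (`exists_generators`).

Time. The images of four generators are the four base-$v$ digits of an index below $v^4$. The other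
images follow by looking up third points of blocks in a table, and a fixed arithmetic expression
tests whether an embedding results (`representable_of_isFull`). Hence every count is a sum over
$i<v^4$ of a difference of two fixed expressions (`Representable`). A machine builds the table from
the list of blocks, adds up both expressions, subtracts and divides
(`Representable.countableInTime`). Each index takes constant time, and all values are polynomial in
$v$, hence have $O(\log v)$ bits. -/

/-! ### Kernel-friendly list functions

They are written with recursors, so that the kernel evaluates them quickly. -/

namespace LineSearch

/-- All members of `l` satisfy `p`. -/
noncomputable def allOf {α : Type} (p : α → Bool) (l : List α) : Bool :=
  List.rec true (fun m _ ih => Bool.rec false ih (p m)) l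

/-- Some member of `l` satisfies `p`. -/
noncomputable def anyOf {α : Type} (p : α → Bool) (l : List α) : Bool :=
  List.rec false (fun m _ ih => Bool.rec ih true (p m)) l

/-- The members of `l` that satisfy `p`. -/
noncomputable def keep (p : ℕ → Bool) (l : List ℕ) : List ℕ :=
  List.rec [] (fun m _ ih => Bool.rec ih (m :: ih) (p m)) l

/-- The concatenation of `l` and `M`. -/
noncomputable def join (l M : List ℕ) : List ℕ :=
  List.rec M (fun m _ ih => m :: ih) l

theorem bool_rec_false (a b : Bool) :
    (Bool.rec false a b : Bool) = true ↔ b = true ∧ a = true := by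
  cases b <;> simp

theorem bool_rec_true (a b : Bool) :
    (Bool.rec a true b : Bool) = true ↔ b = true ∨ a = true := by
  cases b <;> simp

theorem bool_rec_imp (a b : Bool) :
    (Bool.rec true a b : Bool) = true ↔ (b = true → a = true) := by
  cases b <;> simp

theorem allOf_iff {α : Type} {p : α → Bool} {l : List α} :
    allOf p l = true ↔ ∀ x ∈ l, p x = true := by
  induction l with
  | nil => simp [allOf]
  | cons m l ih =>
    have : allOf p (m :: l) = (Bool.rec false (allOf p l) (p m) : Bool) := rfl
    rw [this, bool_rec_false, ih]
    simp

theorem anyOf_iff {α : Type} {p : α → Bool} {l : List α} :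
    anyOf p l = true ↔ ∃ x ∈ l, p x = true := by
  induction l with
  | nil => simp [anyOf]
  | cons m l ih =>
    have : anyOf p (m :: l) = (Bool.rec (anyOf p l) true (p m) : Bool) := rfl
    rw [this, bool_rec_true, ih]
    simp

theorem keep_eq (p : ℕ → Bool) (l : List ℕ) : keep p l = l.filter p := by
  induction l with
  | nil => rfl
  | cons m l ih =>
    have : keep p (m :: l) = (Bool.rec (keep p l) (m :: keep p l) (p m) : List ℕ) := rfl
    rw [this, ih, List.filter_cons]
    cases p m <;> simp

theorem join_eq (l M : List ℕ) : join l M = l ++ M := by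
  induction l with
  | nil => rfl
  | cons m l ih =>
    have : join (m :: l) M = m :: join l M := rfl
    rw [this, ih, List.cons_append]

/-! ### Exhaustive search for dual structures

A point of a configuration with lines `0, …, n - 1` is encoded by the binary number whose
digits tell which lines pass through it. -/

/-- The encodings `a` and `b` have at most one line in common. -/
def meetOnce (a b : ℕ) : Bool :=
  Nat.beq (Nat.land (Nat.land a b) (Nat.sub (Nat.land a b) 1)) 0

/-- `p` holds for all lists obtained from `N` by adding `k` members of `cs` that pairwise
meet at most once and meet the members of `N` at most once. -/
noncomputable def pickAll (p : List ℕ → Bool) (cs : List ℕ) : ℕ → List ℕ → Bool :=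
  List.rec (fun k N => Nat.rec (p N) (fun _ _ => true) k)
    (fun m _ ih k N => Nat.rec (p N) (fun k' _ =>
      Bool.rec false (ih k N)
       (Bool.rec true (ih k' (m :: N)) (allOf (meetOnce m) N))) k) cs

/-- The lines through at least one of the points in `M`. -/
noncomputable def coverOnce (M : List ℕ) : ℕ := List.rec 0 (fun m _ t => Nat.lor m t) M

/-- The lines through at least two of the points in `M`. -/
noncomputable def coverTwice (M : List ℕ) : ℕ :=
  List.rec 0 (fun m M t => Nat.lor (Nat.land m (coverOnce M)) t) M

/-- The lines through at least three of the points in `M`. -/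
noncomputable def coverThrice (M : List ℕ) : ℕ :=
  List.rec 0 (fun m M t => Nat.lor (Nat.land m (coverTwice M)) t) M

/-- The points on at least two lines whose first line is `i`. -/
def candidates (n i : ℕ) : List ℕ :=
  (List.range (2 ^ (n - 1 - i) - 1)).map fun q => 2 ^ i * (2 * q + 3)

/-- The number of points on line `i` not yet in `M`. -/
noncomputable def missing (i : ℕ) (M : List ℕ) : ℕ :=
  Nat.sub 3
    (List.rec 0 (fun m _ t => Nat.add t (Nat.mod (Nat.div m (Nat.pow 2 i)) 2)) M)

/-- `p` holds for all ways to complete line `i`. -/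
noncomputable def stageAll (p : List ℕ → Bool) (n i : ℕ) (M : List ℕ) : Bool :=
  pickAll (fun N => p (join N M))
    (keep (fun q => Bool.rec false (allOf (meetOnce q) M)
      (Nat.beq (Nat.land q (coverThrice M)) 0)) (candidates n i))
    (missing i M) []

/-- `p` holds for all ways to complete the `k` lines from line `i` on. -/
noncomputable def completeAll (p : List ℕ → Bool) (n k : ℕ) : ℕ → List ℕ → Bool :=
  Nat.rec (fun _ M => p M) (fun _ ih i M => stageAll (ih (Nat.succ i)) n i M) k

/-- The encodings of the points on line `0`, if the other lines through the first, second and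
third of these points are the next `a`, `b` and `c` lines. -/
def firstLine (a b c : ℕ) : List ℕ :=
  [1 + 2 * (2 ^ a - 1), 1 + 2 ^ (1 + a) * (2 ^ b - 1), 1 + 2 ^ (1 + a + b) * (2 ^ c - 1)]

/-- All possibilities for the points on the first of `n` lines, up to order. -/
def starts (n : ℕ) : List (List ℕ) :=
  (List.range n).flatMap fun a => (List.range (a + 1)).flatMap fun b =>
    ((List.range (b + 1)).filter fun c => 1 ≤ c && a + b + c + 1 ≤ n).map fun c =>
      firstLine a b c

/-- The set of encodings of the points of a full configuration with `n` lines. -/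
structure IsDual (n : ℕ) (S : Finset ℕ) : Prop where
  lt : ∀ m ∈ S, m < 2 ^ n
  two : ∀ m ∈ S, ∃ i j, i ≠ j ∧ m.testBit i ∧ m.testBit j
  inter : ∀ m ∈ S, ∀ m' ∈ S, ∀ i j, i ≠ j → m.testBit i → m.testBit j →
    m'.testBit i → m'.testBit j → m = m'
  three : ∀ i < n, (S.filter (·.testBit i)).card = 3

/-- The operation `x &&& (x - 1)` clears the lowest binary digit of `x`, so a number with at most
one digit becomes `0`. Only this direction is needed: the search must not lose a genuine structure.
-/
theorem meetOnce_of {a b : ℕ} (h : ∀ i j, i ≠ j → a.testBit i → a.testBit j →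
    b.testBit i → b.testBit j → False) : meetOnce a b = true := by
  have key : ∀ x : ℕ, (∀ i j, x.testBit i → x.testBit j → i = j) →
      x &&& (x - 1) = 0 := by
    intro x hx
    by_cases h0 : x = 0
    · simp [h0]
    · obtain ⟨k, hk⟩ := Nat.exists_testBit_of_ne_zero h0
      have : x = 2 ^ k := by
        refine Nat.eq_of_testBit_eq fun j => ?_
        rw [Nat.testBit_two_pow]
        by_cases hj : k = j
        · subst hj; simpa using hk
        · simp only [hj, decide_false]
          by_contra hne
          exact hj (hx k j hk (by simpa using hne))
      rw [this, Nat.and_two_pow_sub_one_eq_mod]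
      simp
  have := key (a &&& b) (by
    intro i j hi hj
    simp only [Nat.testBit_and, Bool.and_eq_true] at hi hj
    by_contra hne
    exact h i j hne hi.1 hj.1 hi.2 hj.2)
  change Nat.beq ((a &&& b) &&& ((a &&& b) - 1)) 0 = true
  rw [this]
  rfl

/-- The search is a conjunction over all branches, so one may follow the branch that takes a
candidate exactly when it lies in `T`. The length is recorded in order to show later that nothing
was picked twice. -/
theorem exists_of_pickAll {p : List ℕ → Bool} (cs : List ℕ) : ∀ {k : ℕ} {N : List ℕ},
    pickAll p cs k N = true → cs.Nodup → ∀ T : Finset ℕ, T.card = k → T ⊆ cs.toFinset →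
    (∀ a ∈ T, ∀ b ∈ T, a ≠ b → meetOnce a b = true) →
    (∀ a ∈ T, ∀ b ∈ N, meetOnce a b = true) →
    ∃ N', p N' = true ∧ N'.toFinset = N.toFinset ∪ T ∧ N'.length = N.length + k := by
  induction cs with
  | nil =>
    intro k N h _ T hk hT _ _
    have hT0 : T = ∅ := by simpa using hT
    subst hT0
    simp only [Finset.card_empty] at hk
    subst hk
    exact ⟨N, h, by simp, rfl⟩
  | cons m cs ih =>
    intro k N h hnd T hk hT hTT hTN
    cases k with
    | zero =>
      have hT0 : T = ∅ := by simpa using hk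
      subst hT0
      exact ⟨N, h, by simp, rfl⟩
    | succ k =>
      change (Bool.rec false (pickAll p cs (k + 1) N)
        (Bool.rec true (pickAll p cs k (m :: N)) (allOf (meetOnce m) N)) : Bool) = true at h
      rw [bool_rec_false, bool_rec_imp] at h
      rw [List.nodup_cons] at hnd
      by_cases hm : m ∈ T
      · have h1 := h.1 (allOf_iff.2 fun x hx => hTN m hm x hx)
        obtain ⟨N', hN', hs, hl⟩ := ih h1 hnd.2 (T.erase m)
          (by rw [Finset.card_erase_of_mem hm, hk]; rfl)
          (by
            intro x hx
            have := hT (Finset.mem_of_mem_erase hx)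
            simpa [Finset.ne_of_mem_erase hx] using this)
          (fun a ha b hb => hTT a (Finset.mem_of_mem_erase ha) b (Finset.mem_of_mem_erase hb))
          (by
            intro a ha b hb
            rcases List.mem_cons.1 hb with rfl | hb
            · exact hTT a (Finset.mem_of_mem_erase ha) b hm (Finset.ne_of_mem_erase ha)
            · exact hTN a (Finset.mem_of_mem_erase ha) b hb)
        refine ⟨N', hN', ?_, by rw [hl, List.length_cons]; ring⟩
        rw [hs]
        ext x
        by_cases hx : x = m <;> simp [hx, hm]
      · exact ih h.2 hnd.2 T hk (by
          intro x hx
          have hxm : x ≠ m := fun e => hm (e ▸ hx)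
          simpa [hxm] using hT hx) hTT hTN

theorem countP_of_coverOnce {j : ℕ} {M : List ℕ} (h : (coverOnce M).testBit j) :
    1 ≤ M.countP (·.testBit j) := by
  induction M with
  | nil => simp [coverOnce] at h
  | cons m M ih =>
    change (m ||| coverOnce M).testBit j = true at h
    rw [Nat.testBit_or, Bool.or_eq_true] at h
    rw [List.countP_cons]
    rcases h with h | h
    · simp [h]
    · have := ih h; omega

theorem countP_of_coverTwice {j : ℕ} {M : List ℕ} (h : (coverTwice M).testBit j) :
    2 ≤ M.countP (·.testBit j) := by
  induction M with
  | nil => simp [coverTwice] at h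
  | cons m M ih =>
    change ((m &&& coverOnce M) ||| coverTwice M).testBit j = true at h
    rw [Nat.testBit_or, Bool.or_eq_true, Nat.testBit_and, Bool.and_eq_true] at h
    rw [List.countP_cons]
    rcases h with h | h
    · have := countP_of_coverOnce h.2
      simp only [h.1, if_true]; omega
    · have := ih h; omega

/-- Justifies discarding candidates on a line that already has its three points. -/
theorem countP_of_coverThrice {j : ℕ} {M : List ℕ} (h : (coverThrice M).testBit j) :
    3 ≤ M.countP (·.testBit j) := by
  induction M with
  | nil => simp [coverThrice] at h
  | cons m M ih =>
    change ((m &&& coverTwice M) ||| coverThrice M).testBit j = true at h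
    rw [Nat.testBit_or, Bool.or_eq_true, Nat.testBit_and, Bool.and_eq_true] at h
    rw [List.countP_cons]
    rcases h with h | h
    · have := countP_of_coverTwice h.2
      simp only [h.1, if_true]; omega
    · have := ih h; omega

theorem missing_eq (i : ℕ) (M : List ℕ) : missing i M = 3 - M.countP (·.testBit i) := by
  have : ∀ M : List ℕ,
      (List.rec 0 (fun m _ t => Nat.add t (Nat.mod (Nat.div m (Nat.pow 2 i)) 2)) M : ℕ) =
        M.countP (·.testBit i) := by
    intro M
    induction M with
    | nil => rfl
    | cons m M ih =>
      rw [List.countP_cons, ← ih]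
      change _ + m / 2 ^ i % 2 = _
      rw [Nat.testBit_eq_decide_div_mod_eq]
      congr 1
      rcases Nat.mod_two_eq_zero_or_one (m / 2 ^ i) with h | h <;> simp [h]
  rw [missing, this]
  rfl

theorem candidates_nodup (n i : ℕ) : (candidates n i).Nodup := by
  refine List.Nodup.map (fun a b h => ?_) List.nodup_range
  have := Nat.eq_of_mul_eq_mul_left (by positivity) h
  omega

/-- With lowest digit `i`, `m` is `2 ^ i * r` with `r` odd; a second digit excludes `r = 1`, which
leaves `r = 2 * q + 3`. -/
theorem mem_candidates {n i m : ℕ} (hi : i < n) (hm : m < 2 ^ n) (hbit : m.testBit i)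
    (hlow : ∀ j < i, m.testBit j = false) (hother : ∃ j, j ≠ i ∧ m.testBit j) :
    m ∈ candidates n i := by
  have h0 : m % 2 ^ i = 0 := by
    refine Nat.eq_of_testBit_eq fun j => ?_
    rw [Nat.testBit_mod_two_pow]
    by_cases hj : j < i <;> simp [hj, hlow]
  have hdiv : 2 ^ i * (m / 2 ^ i) = m := Nat.mul_div_cancel' (Nat.dvd_of_mod_eq_zero h0)
  have hodd : m / 2 ^ i % 2 = 1 := by
    simpa [Nat.testBit_eq_decide_div_mod_eq] using hbit
  have hne : m / 2 ^ i ≠ 1 := by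
    intro h
    rw [h, mul_one] at hdiv
    obtain ⟨j, hj, hb⟩ := hother
    rw [← hdiv, Nat.testBit_two_pow] at hb
    exact hj (of_decide_eq_true hb).symm
  have hlt : m / 2 ^ i < 2 * 2 ^ (n - 1 - i) := by
    rw [Nat.div_lt_iff_lt_mul (by positivity), mul_right_comm, mul_assoc, ← pow_add, ← pow_succ']
    convert hm using 2
    omega
  generalize m / 2 ^ i = r at hdiv hodd hne hlt
  refine List.mem_map.2 ⟨(r - 3) / 2, List.mem_range.2 ?_, ?_⟩
  · clear hdiv
    omega
  · rw [← hdiv]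
    congr 1
    clear hdiv
    omega

/-- Invariant: before line `i` is treated, the list consists of the points of `S` on an earlier
line. At the end this is all of `S`, since every point is on a line below `n`. -/
theorem exists_of_completeAll {p : List ℕ → Bool} {n : ℕ} {S : Finset ℕ} (hS : IsDual n S)
    (k : ℕ) : ∀ {i : ℕ} {M : List ℕ}, completeAll p n k i M = true → i + k = n → M.Nodup →
    M.toFinset = S.filter (fun m => ∃ j < i, m.testBit j) →
    ∃ M', p M' = true ∧ M'.toFinset = S := by
  induction k with
  | zero =>
    intro i M h hi _ hM
    refine ⟨M, h, ?_⟩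
    rw [hM]
    refine Finset.filter_true_of_mem fun m hm => ?_
    obtain ⟨a, _, _, ha, _⟩ := hS.two m hm
    refine ⟨a, ?_, ha⟩
    by_contra hle
    have hlt : m < 2 ^ a := (hS.lt m hm).trans_le (Nat.pow_le_pow_right (by norm_num) (by omega))
    rw [Nat.testBit_lt_two_pow hlt] at ha
    cases ha
  | succ k ih =>
    intro i M h hi hnd hM
    change stageAll (completeAll p n k (i + 1)) n i M = true at h
    rw [stageAll, keep_eq, missing_eq] at h
    have memM : ∀ m, m ∈ M ↔ m ∈ S ∧ ∃ j < i, m.testBit j := fun m => by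
      rw [← List.mem_toFinset, hM, Finset.mem_filter]
    -- The points whose first line is `i`. The remaining points of line `i` are already in `M`, so
    -- the size of `T` is the number of points the search adds.
    set T := S.filter (fun m => m.testBit i ∧ ¬ ∃ j < i, m.testBit j) with hT
    have countM : ∀ j, M.countP (·.testBit j) = (M.toFinset.filter (·.testBit j)).card := by
      intro j
      rw [List.countP_eq_length_filter, ← List.toFinset_card_of_nodup (hnd.filter _),
        List.toFinset_filter]
    have hcard : T.card = 3 - M.countP (·.testBit i) := by
      have h3 := hS.three i (by omega)
      have hu : S.filter (·.testBit i) = T ∪ M.toFinset.filter (·.testBit i) := by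
        ext m
        simp only [hT, hM, Finset.mem_filter, Finset.mem_union]
        tauto
      have hd : Disjoint T (M.toFinset.filter (·.testBit i)) := by
        rw [Finset.disjoint_left]
        intro m hm hm'
        simp only [hT, hM, Finset.mem_filter] at hm hm'
        exact hm.2.2 hm'.1.2
      rw [hu, Finset.card_union_of_disjoint hd, ← countM] at h3
      omega
    have hmeet : ∀ a ∈ S, ∀ b ∈ S, a ≠ b → meetOnce a b = true := fun a ha b hb hab =>
      meetOnce_of fun i j hij h1 h2 h3 h4 => hab (hS.inter a ha b hb i j hij h1 h2 h3 h4)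
    have hTS : ∀ a ∈ T, a ∈ S := fun a ha => (Finset.mem_filter.1 ha).1
    have hTM : ∀ a ∈ T, a ∉ M := fun a ha hm =>
      (Finset.mem_filter.1 ha).2.2 ((memM a).1 hm).2
    obtain ⟨N, hN, hNT, hNl⟩ := exists_of_pickAll _ h ((candidates_nodup n i).filter _) T hcard
      (by
        intro m hm
        have hmS := hTS m hm
        have hm2 := (Finset.mem_filter.1 hm).2
        rw [List.mem_toFinset, List.mem_filter]
        refine ⟨mem_candidates (by omega) (hS.lt m hmS) hm2.1
          (fun j hj => by
            by_contra hne
            exact hm2.2 ⟨j, hj, by simpa using hne⟩) ?_, ?_⟩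
        · obtain ⟨a, b, hab, ha, hb⟩ := hS.two m hmS
          by_cases hai : a = i
          · exact ⟨b, by rw [← hai]; exact hab.symm, hb⟩
          · exact ⟨a, hai, ha⟩
        · rw [bool_rec_false]
          refine ⟨?_, allOf_iff.2 fun x hx =>
            hmeet m hmS x ((memM x).1 hx).1 fun e => hTM m hm (e ▸ hx)⟩
          rw [Nat.beq_eq]
          by_contra hne
          -- If `m` were on a line with three points in `M`, this line would have `m` as a fourth
          -- point.
          obtain ⟨j, hj⟩ := Nat.exists_testBit_of_ne_zero hne
          change (m &&& coverThrice M).testBit j = true at hj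
          rw [Nat.testBit_and, Bool.and_eq_true] at hj
          have h3 := countP_of_coverThrice hj.2
          rw [countM] at h3
          have hjn : j < n := by
            by_contra hle
            have hlt : m < 2 ^ j :=
              (hS.lt m hmS).trans_le (Nat.pow_le_pow_right (by norm_num) (by omega))
            rw [Nat.testBit_lt_two_pow hlt] at hj
            cases hj.1
          have hlt : (M.toFinset.filter (·.testBit j)).card <
              (S.filter (·.testBit j)).card := by
            refine Finset.card_lt_card ⟨?_, fun hsub => ?_⟩
            · intro x hx
              rw [Finset.mem_filter, List.mem_toFinset, memM] at hx
              exact Finset.mem_filter.2 ⟨hx.1.1, hx.2⟩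
            · have := hsub (Finset.mem_filter.2 ⟨hmS, hj.1⟩)
              rw [Finset.mem_filter, List.mem_toFinset] at this
              exact hTM m hm this.1
          rw [hS.three j hjn] at hlt
          omega)
      (fun a ha b hb hab => hmeet a (hTS a ha) b (hTS b hb) hab)
      (fun a _ b hb => by cases hb)
    simp only [List.toFinset_nil, Finset.empty_union, List.length_nil, Nat.zero_add] at hNT hNl
    -- The length of `N` equals the size of its set of members `T`.
    have hNnd : N.Nodup := by
      refine Multiset.coe_nodup.1 (Multiset.toFinset_card_eq_card_iff_nodup.1 ?_)
      rw [Multiset.coe_card, hNl, ← hcard, ← hNT]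
      rfl
    rw [join_eq] at hN
    refine ih hN (by omega) (List.nodup_append.2 ⟨hNnd, hnd, ?_⟩) ?_
    · intro a ha b hb hab
      exact hTM a (by rw [← hNT]; simpa using ha) (hab ▸ hb)
    · rw [List.toFinset_append, hNT, hM]
      ext m
      simp only [hT, Finset.mem_union, Finset.mem_filter, Nat.lt_succ_iff_lt_or_eq]
      constructor
      · rintro (⟨h1, h2, _⟩ | ⟨h1, j, hj, h2⟩)
        · exact ⟨h1, i, Or.inr rfl, h2⟩
        · exact ⟨h1, j, Or.inl hj, h2⟩
      · rintro ⟨h1, j, hj | rfl, h2⟩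
        · exact Or.inr ⟨h1, j, hj, h2⟩
        · by_cases hlow : ∃ i < j, m.testBit i
          · exact Or.inr ⟨h1, hlow⟩
          · exact Or.inl ⟨h1, h2, hlow⟩

end LineSearch

/-- All lines have three points, and distinct lines share at most one point. -/
structure IsPartialTripleSystem (C : Finset (Finset ℕ)) : Prop where
  card_eq : ∀ b ∈ C, b.card = 3
  eq_of_mem : ∀ b ∈ C, ∀ b' ∈ C, ∀ x y, x ≠ y → x ∈ b → y ∈ b → x ∈ b' → y ∈ b' → b = b'

theorem mem_points {α : Type*} [DecidableEq α] {C : Finset (Finset α)} {x : α} :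
    x ∈ points C ↔ ∃ b ∈ C, x ∈ b := by
  simp [points]

theorem subset_points {α : Type*} [DecidableEq α] {C : Finset (Finset α)} {b : Finset α}
    (hb : b ∈ C) : b ⊆ points C := fun _ hx => mem_points.2 ⟨b, hb, hx⟩

/-! ### Encoding of points by the lines through them -/

/-- The number whose binary digits tell which of the lines contain `x`. -/
def lineMask : List (Finset ℕ) → ℕ → ℕ
  | [], _ => 0
  | b :: L, x => (if x ∈ b then 1 else 0) + 2 * lineMask L x

theorem testBit_lineMask {L : List (Finset ℕ)} {x : ℕ} {i : ℕ} :
    (lineMask L x).testBit i = true ↔ ∃ b, L[i]? = some b ∧ x ∈ b := by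
  induction L generalizing i with
  | nil => simp [lineMask]
  | cons b L ih =>
    cases i with
    | zero =>
      rw [Nat.testBit_zero, lineMask]
      by_cases h : x ∈ b <;> simp [h, Nat.add_mod]
    | succ i =>
      rw [Nat.testBit_succ, lineMask, List.getElem?_cons_succ, ← ih]
      congr! 2
      split <;> omega

theorem lineMask_lt (L : List (Finset ℕ)) (x : ℕ) : lineMask L x < 2 ^ L.length := by
  induction L with
  | nil => simp [lineMask]
  | cons b L ih =>
    rw [lineMask, List.length_cons, pow_succ]
    split <;> omega

theorem lineMask_append (L L' : List (Finset ℕ)) (x : ℕ) :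
    lineMask (L ++ L') x = lineMask L x + 2 ^ L.length * lineMask L' x := by
  induction L with
  | nil => simp [lineMask]
  | cons b L ih =>
    rw [List.cons_append, lineMask, lineMask, ih, List.length_cons, pow_succ]
    ring

theorem lineMask_of_forall_mem {L : List (Finset ℕ)} {x : ℕ} (h : ∀ b ∈ L, x ∈ b) :
    lineMask L x = 2 ^ L.length - 1 := by
  induction L with
  | nil => simp [lineMask]
  | cons b L ih =>
    rw [lineMask, ih fun c hc => h c (List.mem_cons_of_mem _ hc), if_pos (h b (by simp)),
      List.length_cons, pow_succ]
    have := Nat.one_le_two_pow (n := L.length)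
    omega

theorem lineMask_of_forall_notMem {L : List (Finset ℕ)} {x : ℕ} (h : ∀ b ∈ L, x ∉ b) :
    lineMask L x = 0 := by
  induction L with
  | nil => simp [lineMask]
  | cons b L ih =>
    rw [lineMask, ih fun c hc => h c (List.mem_cons_of_mem _ hc), if_neg (h b (by simp))]

theorem IsFull.exists_ne {C : Finset (Finset ℕ)} (hF : IsFull C) {x : ℕ} (hx : x ∈ points C) :
    ∃ b ∈ C, ∃ b' ∈ C, b ≠ b' ∧ x ∈ b ∧ x ∈ b' := by
  obtain ⟨b, hb, b', hb', hne⟩ := Finset.one_lt_card.1 (hF x hx)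
  rw [Finset.mem_filter] at hb hb'
  exact ⟨b, hb.1, b', hb'.1, hne, hb.2, hb'.2⟩

section Encoding

variable {C : Finset (Finset ℕ)} {L : List (Finset ℕ)}

/-- Two points with the same lines would share at least two lines, by fullness. -/
theorem lineMask_injOn (hC : IsPartialTripleSystem C) (hF : IsFull C) (hL : L.toFinset = C) :
    Set.InjOn (lineMask L) (points C : Set ℕ) := by
  intro x hx y _ hxy
  by_contra hne
  obtain ⟨b, hb, b', hb', hbb', hxb, hxb'⟩ := hF.exists_ne hx
  have key : ∀ b ∈ C, x ∈ b → y ∈ b := by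
    intro b hb hxb
    rw [← hL, List.mem_toFinset] at hb
    obtain ⟨i, hi⟩ := List.mem_iff_getElem?.1 hb
    have h1 := testBit_lineMask.2 ⟨b, hi, hxb⟩
    rw [hxy] at h1
    obtain ⟨b'', h2, h3⟩ := testBit_lineMask.1 h1
    rw [hi] at h2
    cases h2
    exact h3
  exact hbb' (hC.eq_of_mem b hb b' hb' x y hne hxb (key b hb hxb) hxb' (key b' hb' hxb'))

theorem isDual_image_lineMask (hC : IsPartialTripleSystem C) (hF : IsFull C) (hnd : L.Nodup)
    (hL : L.toFinset = C) : LineSearch.IsDual L.length ((points C).image (lineMask L)) where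
  lt := by
    intro m hm
    obtain ⟨x, _, rfl⟩ := Finset.mem_image.1 hm
    exact lineMask_lt L x
  two := by
    intro m hm
    obtain ⟨x, hx, rfl⟩ := Finset.mem_image.1 hm
    obtain ⟨b, hb, b', hb', hne, hxb, hxb'⟩ := hF.exists_ne hx
    rw [← hL, List.mem_toFinset] at hb hb'
    obtain ⟨i, hi⟩ := List.mem_iff_getElem?.1 hb
    obtain ⟨j, hj⟩ := List.mem_iff_getElem?.1 hb'
    refine ⟨i, j, ?_, testBit_lineMask.2 ⟨b, hi, hxb⟩, testBit_lineMask.2 ⟨b', hj, hxb'⟩⟩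
    rintro rfl
    rw [hi] at hj
    exact hne (Option.some.inj hj)
  inter := by
    intro m hm m' hm' i j hij h1 h2 h3 h4
    obtain ⟨x, hx, rfl⟩ := Finset.mem_image.1 hm
    obtain ⟨y, hy, rfl⟩ := Finset.mem_image.1 hm'
    obtain ⟨b, hb, hxb⟩ := testBit_lineMask.1 h1
    obtain ⟨b', hb', hxb'⟩ := testBit_lineMask.1 h2
    obtain ⟨c, hc, hyb⟩ := testBit_lineMask.1 h3
    obtain ⟨c', hc', hyb'⟩ := testBit_lineMask.1 h4
    rw [hb] at hc
    rw [hb'] at hc'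
    cases hc
    cases hc'
    by_contra hne
    have hxy : x ≠ y := fun e => hne (by rw [e])
    have hbC : b ∈ C := by rw [← hL, List.mem_toFinset]; exact List.mem_of_getElem? hb
    have hbC' : b' ∈ C := by rw [← hL, List.mem_toFinset]; exact List.mem_of_getElem? hb'
    have := hC.eq_of_mem b hbC b' hbC' x y hxy hxb hyb hxb' hyb'
    subst this
    obtain ⟨hi, hi'⟩ := List.getElem?_eq_some_iff.1 hb
    obtain ⟨hj, hj'⟩ := List.getElem?_eq_some_iff.1 hb'
    exact hij ((hnd.getElem_inj_iff).1 (hi'.trans hj'.symm))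
  three := by
    intro i hi
    have hbC : L[i] ∈ C := by rw [← hL, List.mem_toFinset]; exact List.getElem_mem hi
    have : ((points C).image (lineMask L)).filter (·.testBit i) = L[i].image (lineMask L) := by
      ext m
      simp only [Finset.mem_filter, Finset.mem_image]
      constructor
      · rintro ⟨⟨x, hx, rfl⟩, h⟩
        obtain ⟨b, hb, hxb⟩ := testBit_lineMask.1 h
        rw [List.getElem?_eq_getElem hi] at hb
        cases hb
        exact ⟨x, hxb, rfl⟩
      · rintro ⟨x, hx, rfl⟩
        exact ⟨⟨x, subset_points hbC hx, rfl⟩,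
          testBit_lineMask.2 ⟨L[i], List.getElem?_eq_getElem hi, hx⟩⟩
    rw [this, Finset.card_image_of_injOn, hC.card_eq _ hbC]
    exact (lineMask_injOn hC hF hL).mono (by exact_mod_cast subset_points hbC)

end Encoding

/-! ### Normal form for the order of the lines -/

theorem exists_sorted_triple {b : Finset ℕ} (hb : b.card = 3) (d : ℕ → ℕ) :
    ∃ x y z, x ≠ y ∧ x ≠ z ∧ y ≠ z ∧ b = {x, y, z} ∧ d y ≤ d x ∧ d z ≤ d y := by
  obtain ⟨x, y, z, hxy, hxz, hyz, rfl⟩ := Finset.card_eq_three.1 hb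
  rcases le_total (d x) (d y) with h1 | h1 <;> rcases le_total (d y) (d z) with h2 | h2 <;>
    rcases le_total (d x) (d z) with h3 | h3
  · exact ⟨z, y, x, hyz.symm, hxz.symm, hxy.symm, by ext; simp; tauto, h2, h1⟩
  · exact ⟨z, y, x, hyz.symm, hxz.symm, hxy.symm, by ext; simp; tauto, h2, h1⟩
  · exact ⟨y, z, x, hyz, hxy.symm, hxz.symm, by ext; simp; tauto, h2, h3⟩
  · exact ⟨y, x, z, hxy.symm, hyz, hxz, by ext; simp; tauto, h1, h3⟩
  · exact ⟨z, x, y, hxz.symm, hyz.symm, hxy, by ext; simp; tauto, h3, h1⟩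
  · exact ⟨x, z, y, hxz, hxy, hyz.symm, by ext; simp; tauto, h3, h2⟩
  · exact ⟨x, y, z, hxy, hxz, hyz, rfl, h1, h2⟩
  · exact ⟨x, y, z, hxy, hxz, hyz, rfl, h1, h2⟩

/-- The lines of a full configuration can be listed so that the points on the first line have
the encodings of one of the starts of the search. -/
theorem exists_list_start {C : Finset (Finset ℕ)} (hC : IsPartialTripleSystem C)
    (hF : IsFull C) (hne : C.Nonempty) :
    ∃ L : List (Finset ℕ), L.Nodup ∧ L.toFinset = C ∧ ∃ M ∈ LineSearch.starts C.card, M.Nodup ∧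
      ∀ m, m ∈ M ↔ m ∈ (points C).image (lineMask L) ∧ m.testBit 0 := by
  obtain ⟨b, hb⟩ := hne
  -- Any line `b` can come first. Sorting its points by their numbers of further lines gives the
  -- order of the parameters in `starts`.
  obtain ⟨x, y, z, hxy, hxz, hyz, hbe, hd1, hd2⟩ := exists_sorted_triple (hC.card_eq b hb)
    fun x => ((C.erase b).filter (x ∈ ·)).card
  have hxb : x ∈ b := by simp [hbe]
  have hyb : y ∈ b := by simp [hbe]
  have hzb : z ∈ b := by simp [hbe]
  set X := (C.erase b).filter (x ∈ ·) with hX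
  set Y := (C.erase b).filter (y ∈ ·) with hY
  set Z := (C.erase b).filter (z ∈ ·) with hZ
  set W := (C.erase b).filter (fun c => x ∉ c ∧ y ∉ c ∧ z ∉ c) with hW
  -- No further line meets `b` twice, so the other lines split into those through `x`, through `y`,
  -- through `z`, and the rest. Listed in this order, they give the three points blocks of
  -- consecutive digits.
  have only : ∀ p ∈ b, ∀ q ∈ b, p ≠ q → ∀ c ∈ C.erase b, p ∈ c → q ∉ c := by
    intro p hp q hq hpq c hc h1 h2
    rw [Finset.mem_erase] at hc
    exact hc.1 (hC.eq_of_mem c hc.2 b hb p q hpq h1 h2 hp hq)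
  have hYX : ∀ c ∈ Y, x ∉ c := fun c hc =>
    only y hyb x hxb hxy.symm c (Finset.mem_filter.1 hc).1 (Finset.mem_filter.1 hc).2
  have hZX : ∀ c ∈ Z, x ∉ c := fun c hc =>
    only z hzb x hxb hxz.symm c (Finset.mem_filter.1 hc).1 (Finset.mem_filter.1 hc).2
  have hXY : ∀ c ∈ X, y ∉ c := fun c hc =>
    only x hxb y hyb hxy c (Finset.mem_filter.1 hc).1 (Finset.mem_filter.1 hc).2
  have hZY : ∀ c ∈ Z, y ∉ c := fun c hc =>
    only z hzb y hyb hyz.symm c (Finset.mem_filter.1 hc).1 (Finset.mem_filter.1 hc).2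
  have hXZ : ∀ c ∈ X, z ∉ c := fun c hc =>
    only x hxb z hzb hxz c (Finset.mem_filter.1 hc).1 (Finset.mem_filter.1 hc).2
  have hYZ : ∀ c ∈ Y, z ∉ c := fun c hc =>
    only y hyb z hzb hyz c (Finset.mem_filter.1 hc).1 (Finset.mem_filter.1 hc).2
  have memX : ∀ c ∈ X, x ∈ c := fun c hc => (Finset.mem_filter.1 hc).2
  have memY : ∀ c ∈ Y, y ∈ c := fun c hc => (Finset.mem_filter.1 hc).2
  have memZ : ∀ c ∈ Z, z ∈ c := fun c hc => (Finset.mem_filter.1 hc).2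
  have hWn : ∀ c ∈ W, x ∉ c ∧ y ∉ c ∧ z ∉ c := fun c hc => (Finset.mem_filter.1 hc).2
  set L := [b] ++ (X.toList ++ (Y.toList ++ (Z.toList ++ W.toList))) with hLdef
  have hnb : ∀ c ∈ C.erase b, b ≠ c := fun c hc e => Finset.ne_of_mem_erase hc e.symm
  have hL : L.toFinset = C := by
    ext c
    simp only [hLdef, List.toFinset_append, Finset.mem_union, Finset.toList_toFinset, hX, hY, hZ,
      hW, Finset.mem_filter, List.mem_toFinset, List.mem_singleton, Finset.mem_erase]
    by_cases hcb : c = b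
    · simp [hcb, hb]
    · simp only [hcb, ne_eq, not_false_eq_true, true_and, false_or]
      tauto
  have hnd : L.Nodup := by
    refine (List.nodup_singleton b).append (X.nodup_toList.append (Y.nodup_toList.append
      (Z.nodup_toList.append W.nodup_toList ?_) ?_) ?_) ?_
    · intro c h1 h2
      rw [Finset.mem_toList] at h1 h2
      exact (hWn c h2).2.2 (memZ c h1)
    · intro c h1 h2
      simp only [List.mem_append, Finset.mem_toList] at h1 h2
      rcases h2 with h2 | h2
      · exact hYZ c h1 (memZ c h2)
      · exact (hWn c h2).2.1 (memY c h1)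
    · intro c h1 h2
      simp only [List.mem_append, Finset.mem_toList] at h1 h2
      rcases h2 with h2 | h2 | h2
      · exact hXY c h1 (memY c h2)
      · exact hXZ c h1 (memZ c h2)
      · exact (hWn c h2).1 (memX c h1)
    · intro c h1 h2
      simp only [List.mem_append, Finset.mem_toList, List.mem_singleton] at h1 h2
      subst h1
      rcases h2 with h2 | h2 | h2 | h2 <;>
        exact Finset.notMem_erase c C (Finset.mem_filter.1 h2).1
  have hlen : 1 + (X.card + (Y.card + (Z.card + W.card))) = C.card := by
    rw [← hL, List.toFinset_card_of_nodup hnd, hLdef]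
    simp only [List.length_append, Finset.length_toList, List.length_singleton]
  -- Fullness gives `z` a line other than `b`; this is the condition `1 ≤ c` in `starts`.
  have hZ1 : 1 ≤ Z.card := by
    have h2 := hF z (subset_points hb hzb)
    have : Z = (C.filter (z ∈ ·)).erase b := by
      rw [hZ, Finset.filter_erase]
    rw [this, Finset.card_erase_of_mem (Finset.mem_filter.2 ⟨hb, hzb⟩)]
    omega
  have maskb : ∀ p ∈ b, lineMask [b] p = 1 := fun p hp => by simp [lineMask, hp]
  have hmx : lineMask L x = 1 + 2 * (2 ^ X.card - 1) := by
    rw [hLdef, lineMask_append, lineMask_append, maskb x hxb, lineMask_of_forall_mem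
      (L := X.toList) (by simpa using memX), lineMask_of_forall_notMem, Finset.length_toList]
    · simp
    · intro c hc
      simp only [List.mem_append, Finset.mem_toList] at hc
      rcases hc with hc | hc | hc
      · exact hYX c hc
      · exact hZX c hc
      · exact (hWn c hc).1
  have hmy : lineMask L y = 1 + 2 ^ (1 + X.card) * (2 ^ Y.card - 1) := by
    rw [hLdef, lineMask_append, lineMask_append, lineMask_append, maskb y hyb,
      lineMask_of_forall_notMem (L := X.toList) (by simpa using hXY),
      lineMask_of_forall_mem (L := Y.toList) (by simpa using memY), lineMask_of_forall_notMem]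
    · simp only [Finset.length_toList, List.length_singleton, pow_add]
      ring
    · intro c hc
      simp only [List.mem_append, Finset.mem_toList] at hc
      rcases hc with hc | hc
      · exact hZY c hc
      · exact (hWn c hc).2.1
  have hmz : lineMask L z = 1 + 2 ^ (1 + X.card + Y.card) * (2 ^ Z.card - 1) := by
    rw [hLdef, lineMask_append, lineMask_append, lineMask_append, lineMask_append, maskb z hzb,
      lineMask_of_forall_notMem (L := X.toList) (by simpa using hXZ),
      lineMask_of_forall_notMem (L := Y.toList) (by simpa using hYZ),
      lineMask_of_forall_mem (L := Z.toList) (by simpa using memZ), lineMask_of_forall_notMem]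
    · simp only [Finset.length_toList, List.length_singleton, pow_add]
      ring
    · intro c hc
      rw [Finset.mem_toList] at hc
      exact (hWn c hc).2.2
  have hM : LineSearch.firstLine X.card Y.card Z.card =
      [lineMask L x, lineMask L y, lineMask L z] := by
    rw [hmx, hmy, hmz, LineSearch.firstLine]
  have hinj := lineMask_injOn hC hF hL
  have hpts : ∀ p ∈ b, p ∈ (points C : Set ℕ) := fun p hp => by
    exact_mod_cast subset_points hb hp
  refine ⟨L, hnd, hL, LineSearch.firstLine X.card Y.card Z.card, ?_, ?_, ?_⟩
  · simp only [LineSearch.starts, List.mem_flatMap, List.mem_map, List.mem_filter,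
      List.mem_range]
    refine ⟨X.card, by omega, Y.card, by omega, Z.card, ⟨by omega, ?_⟩, rfl⟩
    simp only [Bool.and_eq_true, decide_eq_true_eq]
    omega
  · rw [hM]
    simp only [List.nodup_cons, List.mem_cons, List.not_mem_nil, or_false, not_or,
      not_false_eq_true, List.nodup_nil, and_true]
    exact ⟨⟨fun e => hxy (hinj (hpts x hxb) (hpts y hyb) e),
      fun e => hxz (hinj (hpts x hxb) (hpts z hzb) e)⟩,
      fun e => hyz (hinj (hpts y hyb) (hpts z hzb) e)⟩
  · intro m
    have h0 : L[0]? = some b := rfl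
    have hbit : ∀ p ∈ b, (lineMask L p).testBit 0 = true := fun p hp =>
      testBit_lineMask.2 ⟨b, h0, hp⟩
    rw [hM]
    simp only [List.mem_cons, List.not_mem_nil, or_false, Finset.mem_image]
    constructor
    · rintro (rfl | rfl | rfl)
      · exact ⟨⟨x, subset_points hb hxb, rfl⟩, hbit x hxb⟩
      · exact ⟨⟨y, subset_points hb hyb, rfl⟩, hbit y hyb⟩
      · exact ⟨⟨z, subset_points hb hzb, rfl⟩, hbit z hzb⟩
    · rintro ⟨⟨p, _, rfl⟩, h⟩
      obtain ⟨c, hc, hpc⟩ := testBit_lineMask.1 h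
      rw [h0] at hc
      cases hc
      rw [hbe] at hpc
      simp only [Finset.mem_insert, Finset.mem_singleton] at hpc
      rcases hpc with rfl | rfl | rfl <;> simp

namespace LineSearch

/-! ### Search for isomorphisms of dual structures -/

/-- The number with digits `0` and `1` in base `b` that has the same digits as `m` in base `2`. -/
noncomputable def spread (m b n : ℕ) : ℕ :=
  Nat.rec 0 (fun i t =>
    Nat.add t (Nat.mul (Nat.pow b i) (Nat.mod (Nat.div m (Nat.pow 2 i)) 2))) n

/-- The matrix of the degrees of the intersection points of the lines, as a number in base 16. -/
noncomputable def weights (M : List ℕ) : ℕ :=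
  List.rec 0 (fun m _ t => Nat.add t (Nat.mul (Nat.mod (spread m 16 7) 15)
    (Nat.mul (spread m 16 7) (spread m (16 ^ 7) 7)))) M

/-- The entries of the matrix `W`. -/
def weight (W i j : ℕ) : ℕ :=
  Nat.mod (Nat.div W (Nat.pow 16 (Nat.add i (Nat.mul 7 j)))) 16

noncomputable def sumTo (f : ℕ → ℕ) (n : ℕ) : ℕ :=
  Nat.rec 0 (fun i t => Nat.add (f i) t) n

/-- An isomorphism invariant: the weighted number of triangles. -/
noncomputable def triangles (W n : ℕ) : ℕ :=
  sumTo (fun i => sumTo (fun j => Nat.mul (weight W i j)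
    (sumTo (fun k => Nat.mul (weight W i k) (weight W j k)) j)) i) n

/-- The encoding of the point with encoding `m`, if line `i` is renamed to `σ[i]`. -/
noncomputable def permute (σ : List ℕ) : ℕ → ℕ :=
  List.rec (fun _ => 0) (fun s _ ih m =>
    Nat.lor (Nat.mul (Nat.mod m 2) (Nat.pow 2 s)) (ih (Nat.div m 2))) σ

/-- Renaming line `i` to `v` and lines `j`, `j + 1`, … to the members of `σ` respects the
weights. -/
noncomputable def consistent (W V v i : ℕ) (σ : List ℕ) : ℕ → Bool :=
  List.rec (fun _ => true) (fun s _ ih j =>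
    Bool.rec false (ih (Nat.succ j)) (Nat.beq (weight W i j) (weight V v s))) σ

/-- `σ` is a permutation of `0, …, n - 1` that maps the points in `M` to points in `R`. -/
noncomputable def carries (n : ℕ) (M R σ : List ℕ) : Bool :=
  Bool.rec false (allOf (fun m => anyOf (Nat.beq (permute σ m)) R) M)
    (decide (σ.length = n ∧ σ.Nodup ∧ ∀ s ∈ σ, s < n))

/-- Search for an isomorphism from `M` to `R` extending `σ`, which renames the lines from
`k` on. -/
noncomputable def isoSearch (n : ℕ) (M R : List ℕ) (W V : ℕ) (k : ℕ) : List ℕ → Bool :=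
  Nat.rec (fun σ => carries n M R σ)
    (fun k ih σ => anyOf (fun v =>
      Bool.rec false
        (Bool.rec false (ih (v :: σ)) (allOf (fun s => Bool.rec true false (Nat.beq s v)) σ))
        (consistent W V v k (v :: σ) k)) (List.range n)) k

/-- `M` is isomorphic to a member of `Rs`. -/
noncomputable def isKnown (n : ℕ) (Rs : List (List ℕ)) (M : List ℕ) : Bool :=
  anyOf (fun R => Bool.rec false (isoSearch n M R (weights M) (weights R) n [])
    (Nat.beq (triangles (weights R) 7) (triangles (weights M) 7))) Rs

/-- The weights and the triangle count only shorten the search; an isomorphism found is certified by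
`carries` alone. -/
theorem exists_of_isoSearch {n : ℕ} {M R : List ℕ} {W V : ℕ} (k : ℕ) : ∀ {σ : List ℕ},
    isoSearch n M R W V k σ = true → ∃ σ, carries n M R σ = true := by
  induction k with
  | zero => exact fun h => ⟨_, h⟩
  | succ k ih =>
    intro σ h
    obtain ⟨v, _, hv⟩ := anyOf_iff.1 h
    rw [bool_rec_false, bool_rec_false] at hv
    exact ih hv.2.2

theorem testBit_permute {σ : List ℕ} (hσ : σ.Nodup) {m i s : ℕ} (hi : σ[i]? = some s) :
    (permute σ m).testBit s = m.testBit i := by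
  -- A place that `σ` does not name stays empty, so the digits moved by the rest of `σ` do not
  -- disturb the one already placed.
  have notMem : ∀ (σ : List ℕ) (m s : ℕ), s ∉ σ → (permute σ m).testBit s = false := by
    intro σ
    induction σ with
    | nil => intro m s _; exact Nat.zero_testBit s
    | cons t σ ih =>
      intro m s hs
      rw [List.mem_cons, not_or] at hs
      change (m % 2 * 2 ^ t ||| permute σ (m / 2)).testBit s = false
      rw [Nat.testBit_or, ih _ _ hs.2, Bool.or_false]
      rcases Nat.mod_two_eq_zero_or_one m with h | h
      · simp [h]
      · rw [h, one_mul, Nat.testBit_two_pow, decide_eq_false (Ne.symm hs.1)]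
  induction σ generalizing m i with
  | nil => simp at hi
  | cons t σ ih =>
    rw [List.nodup_cons] at hσ
    change (m % 2 * 2 ^ t ||| permute σ (m / 2)).testBit s = m.testBit i
    rw [Nat.testBit_or]
    cases i with
    | zero =>
      rw [List.getElem?_cons_zero] at hi
      cases hi
      rw [notMem σ _ s hσ.1, Bool.or_false, Nat.testBit_zero]
      rcases Nat.mod_two_eq_zero_or_one m with h | h <;> simp [h]
    | succ i =>
      rw [List.getElem?_cons_succ] at hi
      have hne : t ≠ s := fun e => hσ.1 (e ▸ List.mem_of_getElem? hi)
      rw [ih hσ.2 hi, Nat.testBit_succ]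
      rcases Nat.mod_two_eq_zero_or_one m with h | h
      · simp [h]
      · rw [h, one_mul, Nat.testBit_two_pow, decide_eq_false hne, Bool.false_or]

end LineSearch

/-! ### Representatives of the full configurations with at most seven lines -/

/-- The encoded points of representatives of the full configurations with `n ≤ 7` lines, together
with the points of an embedding into the system `system15`. -/
def fullTable : ℕ → List (List ℕ × List ℕ)
  | 0 => [([], [])]
  | 4 =>
    [([3, 5, 6, 9, 10, 12], [14, 2, 7, 13, 4, 9])]
  | 5 =>
    [([3, 5, 9, 14, 18, 20, 24], [4, 8, 11, 3, 0, 10, 13])]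
  | 6 =>
    [([3, 5, 6, 24, 9, 18, 36, 40, 48], [11, 7, 5, 1, 0, 9, 8, 2, 12]),
     ([3, 5, 18, 20, 9, 24, 34, 36, 40], [4, 0, 8, 5, 3, 7, 11, 6, 12]),
     ([3, 5, 9, 18, 38, 28, 40, 48], [1, 4, 6, 8, 13, 9, 10, 0]),
     ([7, 9, 10, 17, 34, 56, 20, 36], [14, 3, 13, 9, 2, 11, 5, 10]),
     ([7, 10, 20, 25, 33, 44, 50], [5, 6, 3, 4, 2, 1, 0])]
  | 7 =>
    [([3, 5, 6, 56, 9, 18, 36, 72, 80, 96], [13, 1, 4, 5, 8, 9, 6, 7, 11, 0]),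
     ([3, 5, 6, 48, 9, 18, 44, 72, 80, 96], [8, 12, 13, 10, 2, 1, 5, 4, 7, 14]),
     ([3, 5, 6, 40, 9, 18, 72, 100, 48, 80], [0, 11, 9, 3, 7, 8, 12, 5, 1, 13]),
     ([3, 5, 18, 20, 9, 34, 44, 72, 80, 96], [7, 3, 1, 6, 12, 10, 2, 8, 4, 11]),
     ([3, 5, 18, 20, 9, 34, 68, 112, 40, 72], [6, 10, 4, 0, 9, 1, 13, 3, 5, 11]),
     ([3, 5, 9, 18, 38, 76, 56, 80, 96], [11, 10, 2, 13, 3, 8, 12, 5, 7]),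
     ([3, 5, 9, 18, 38, 84, 56, 72, 96], [1, 10, 7, 12, 9, 6, 11, 0, 5]),
     ([3, 5, 9, 18, 46, 68, 88, 48, 96], [12, 2, 8, 5, 13, 14, 1, 3, 11]),
     ([3, 5, 18, 36, 9, 84, 56, 72, 98], [1, 4, 11, 9, 6, 13, 3, 2, 14]),
     ([3, 5, 22, 48, 9, 42, 76, 80, 96], [11, 2, 8, 13, 10, 4, 12, 1, 9]),
     ([7, 9, 10, 17, 34, 88, 52, 68, 96], [13, 1, 7, 8, 6, 10, 3, 11, 2]),
     ([7, 9, 10, 17, 34, 76, 52, 80, 96], [3, 5, 14, 1, 9, 10, 8, 13, 0]),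
     ([7, 9, 10, 36, 17, 50, 68, 88, 96], [3, 6, 1, 11, 2, 5, 13, 4, 9]),
     ([7, 9, 10, 17, 50, 80, 104, 36, 68], [2, 3, 12, 6, 8, 14, 7, 5, 4]),
     ([7, 9, 24, 34, 17, 44, 66, 84, 96], [1, 5, 0, 14, 3, 6, 11, 4, 8]),
     ([7, 9, 17, 44, 72, 84, 48, 34, 66], [8, 13, 1, 3, 11, 10, 7, 12, 2]),
     ([7, 9, 17, 42, 76, 52, 82, 96], [6, 0, 5, 7, 11, 12, 13, 3]),
     ([7, 10, 25, 33, 82, 52, 68, 104], [8, 11, 3, 10, 4, 0, 9, 13]),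
     ([7, 25, 42, 52, 76, 82, 97], [5, 3, 6, 4, 2, 0, 1])]
  | _ => []

/-- The encoded points of representatives of the full configurations with `n ≤ 7` lines. -/
def fullReps (n : ℕ) : List (List ℕ) := (fullTable n).map Prod.fst

/-- The set of `n` lines with encoded points `R`; the encodings serve as points. -/
def decodeLines (n : ℕ) (R : List ℕ) : Finset (Finset ℕ) :=
  (Finset.range n).image fun i => R.toFinset.filter (·.testBit i)

theorem card_line_of_mem_fullReps {n : ℕ} (hn : n ≤ 7) : ∀ R ∈ fullReps n, ∀ i < n,
    (R.toFinset.filter (·.testBit i)).card = 3 := by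
  interval_cases n <;> decide +kernel

/-- The exhaustive search, run by the kernel. For `n ≤ 3` there are no starts, since the three
points of the first line need three further lines. -/
theorem completeAll_isKnown_of_le_six {n : ℕ} (h1 : 1 ≤ n) (hn : n ≤ 6) :
    ∀ M ∈ LineSearch.starts n,
      LineSearch.completeAll (LineSearch.isKnown n (fullReps n)) n (n - 1) 1 M = true := by
  rw [← LineSearch.allOf_iff]
  interval_cases n <;> decide +kernel

theorem completeAll_isKnown_seven : ∀ M ∈ LineSearch.starts 7,
    LineSearch.completeAll (LineSearch.isKnown 7 (fullReps 7)) 7 6 1 M = true := by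
  rw [← LineSearch.allOf_iff]
  decide +kernel

/-- Every full partial triple system with at most seven lines is isomorphic to a
representative. -/
theorem exists_isomorphic_fullReps {C : Finset (Finset ℕ)} (hC : IsPartialTripleSystem C)
    (hF : IsFull C) (hcard : C.card ≤ 7) :
    ∃ R ∈ fullReps C.card, Isomorphic C (decodeLines C.card R) := by
  rcases C.eq_empty_or_nonempty with rfl | hne
  · exact ⟨[], by simp [fullReps, fullTable], id, by simp [points], by simp [decodeLines]⟩
  obtain ⟨L, hnd, hL, M, hM, hMnd, hMmem⟩ := exists_list_start hC hF hne
  have hlen : L.length = C.card := by rw [← hL, List.toFinset_card_of_nodup hnd]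
  have hLC : ∀ c ∈ L, c ∈ C := fun c hc => by
    rw [← hL]
    exact List.mem_toFinset.2 hc
  have h1 : 1 ≤ C.card := hne.card_pos
  have hsearch : LineSearch.completeAll (LineSearch.isKnown C.card (fullReps C.card)) C.card
      (C.card - 1) 1 M = true := by
    rcases Nat.lt_or_ge C.card 7 with h7 | h7
    · exact completeAll_isKnown_of_le_six h1 (by omega) M hM
    · have h7' : C.card = 7 := by omega
      rw [h7'] at hM ⊢
      exact completeAll_isKnown_seven M hM
  have hdual := isDual_image_lineMask hC hF hnd hL
  rw [hlen] at hdual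
  obtain ⟨M', hM', hM's⟩ := LineSearch.exists_of_completeAll hdual (C.card - 1) hsearch
    (by omega) hMnd (by
      ext m
      rw [List.mem_toFinset, hMmem, Finset.mem_filter]
      simp)
  obtain ⟨R, hR, hRM⟩ := LineSearch.anyOf_iff.1 hM'
  rw [LineSearch.bool_rec_false] at hRM
  obtain ⟨σ, hσ⟩ := LineSearch.exists_of_isoSearch _ hRM.2
  rw [LineSearch.carries, LineSearch.bool_rec_false, decide_eq_true_eq, LineSearch.allOf_iff]
    at hσ
  obtain ⟨⟨hσl, hσnd, hσlt⟩, hσR⟩ := hσ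
  -- The isomorphism: encode a point by its lines, then rename the lines by `σ`.
  set f : ℕ → ℕ := fun x => LineSearch.permute σ (lineMask L x) with hf
  have hfR : ∀ x ∈ points C, f x ∈ R := by
    intro x hx
    have : lineMask L x ∈ M' := by
      rw [← List.mem_toFinset, hM's]
      exact Finset.mem_image_of_mem _ hx
    obtain ⟨r, hr, hrx⟩ := LineSearch.anyOf_iff.1 (hσR _ this)
    rw [Nat.beq_eq] at hrx
    rw [hf]
    dsimp only
    rw [hrx]
    exact hr
  have hfinj : Set.InjOn f (points C : Set ℕ) := by
    intro x hx y hy hxy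
    refine lineMask_injOn hC hF hL hx hy (Nat.eq_of_testBit_eq fun i => ?_)
    by_cases hi : i < σ.length
    · have h2 := LineSearch.testBit_permute hσnd (m := lineMask L x)
        (List.getElem?_eq_getElem hi)
      have h3 := LineSearch.testBit_permute hσnd (m := lineMask L y)
        (List.getElem?_eq_getElem hi)
      rw [← h2, ← h3]
      exact congrArg (fun z => Nat.testBit z σ[i]) hxy
    · have hlt : ∀ x, lineMask L x < 2 ^ i := fun x =>
        (lineMask_lt L x).trans_le (Nat.pow_le_pow_right (by norm_num) (by omega))
      rw [Nat.testBit_lt_two_pow (hlt x), Nat.testBit_lt_two_pow (hlt y)]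
  -- Inclusion is the action of `σ` on digits; equality follows because both lines have three
  -- points.
  have himg : ∀ i (hi : i < L.length) (hi' : i < σ.length),
      L[i].image f = R.toFinset.filter (·.testBit σ[i]) := by
    intro i hi hi'
    have hb : L[i] ∈ C := by rw [← hL, List.mem_toFinset]; exact List.getElem_mem hi
    refine Finset.eq_of_subset_of_card_le ?_ ?_
    · intro y hy
      obtain ⟨x, hx, rfl⟩ := Finset.mem_image.1 hy
      rw [Finset.mem_filter, List.mem_toFinset]
      refine ⟨hfR x (subset_points hb hx), ?_⟩
      rw [hf]
      dsimp only
      rw [LineSearch.testBit_permute hσnd (List.getElem?_eq_getElem hi')]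
      exact testBit_lineMask.2 ⟨L[i], List.getElem?_eq_getElem hi, hx⟩
    · rw [card_line_of_mem_fullReps hcard R hR _ (hσlt _ (List.getElem_mem hi')),
        Finset.card_image_of_injOn (hfinj.mono (by exact_mod_cast subset_points hb)),
        hC.card_eq _ hb]
  refine ⟨R, hR, f, hfinj, ?_⟩
  ext c
  simp only [decodeLines, Finset.mem_image, Finset.mem_range]
  constructor
  · rintro ⟨b, hb, rfl⟩
    rw [← hL, List.mem_toFinset] at hb
    obtain ⟨i, hi, rfl⟩ := List.mem_iff_getElem.1 hb
    exact ⟨σ[i]'(by omega), hσlt _ (List.getElem_mem _), (himg i hi (by omega)).symm⟩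
  · rintro ⟨j, hj, rfl⟩
    -- Being injective with `n` values below `n`, `σ` takes every value.
    have hj' : j ∈ σ := by
      have : σ.toFinset = Finset.range C.card := by
        refine Finset.eq_of_subset_of_card_le (fun s hs => ?_) ?_
        · exact Finset.mem_range.2 (hσlt s (List.mem_toFinset.1 hs))
        · rw [Finset.card_range, List.toFinset_card_of_nodup hσnd, hσl]
      rw [← List.mem_toFinset, this]
      exact Finset.mem_range.2 hj
    obtain ⟨i, hi, rfl⟩ := List.mem_iff_getElem.1 hj'
    refine ⟨L[i]'(by omega), ?_, himg i (by omega) hi⟩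
    exact hLC _ (List.getElem_mem _)

/-! ### Isomorphisms -/

section Isomorphic

variable {α β γ : Type*} [DecidableEq α] [DecidableEq β] [DecidableEq γ]

theorem points_image (C : Finset (Finset α)) (f : α → β) :
    points (C.image (Finset.image f)) = (points C).image f := by
  ext y
  simp only [mem_points, Finset.mem_image]
  constructor
  · rintro ⟨_, ⟨b, hb, rfl⟩, hy⟩
    obtain ⟨x, hx, rfl⟩ := Finset.mem_image.1 hy
    exact ⟨x, ⟨b, hb, hx⟩, rfl⟩
  · rintro ⟨x, ⟨b, hb, hx⟩, rfl⟩
    exact ⟨_, ⟨b, hb, rfl⟩, Finset.mem_image_of_mem f hx⟩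

omit [DecidableEq α] in
theorem image_eq_of_eqOn {b : Finset α} {f g : α → β} (h : ∀ x ∈ b, f x = g x) :
    b.image f = b.image g := by
  ext y
  simp only [Finset.mem_image]
  constructor
  · rintro ⟨x, hx, rfl⟩
    exact ⟨x, hx, (h x hx).symm⟩
  · rintro ⟨x, hx, rfl⟩
    exact ⟨x, hx, h x hx⟩

theorem image_image_eq_of_eqOn {C : Finset (Finset α)} {f g : α → β}
    (h : ∀ x ∈ points C, f x = g x) : C.image (Finset.image f) = C.image (Finset.image g) :=
  image_eq_of_eqOn fun _ hb => image_eq_of_eqOn fun x hx => h x (subset_points hb hx)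

theorem image_injOn_lines {C : Finset (Finset α)} {f : α → β}
    (hf : Set.InjOn f (points C : Set α)) : Set.InjOn (Finset.image f) (C : Set (Finset α)) := by
  intro b hb c hc hbc
  have hb' : (b : Set α) ⊆ points C := by exact_mod_cast subset_points hb
  have hc' : (c : Set α) ⊆ points C := by exact_mod_cast subset_points hc
  have := congrArg (fun s : Finset β => (s : Set β)) hbc
  simp only [Finset.coe_image] at this
  exact_mod_cast (hf.image_eq_image_iff hb' hc').1 this

/-- An isomorphism and its inverse. -/
theorem Isomorphic.exists_inverse {C : Finset (Finset α)} {D : Finset (Finset β)} [Nonempty α]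
    (h : Isomorphic C D) : ∃ (f : α → β) (g : β → α), Set.InjOn f (points C : Set α) ∧
      C.image (Finset.image f) = D ∧ (∀ x ∈ points C, g (f x) = x) ∧
      (∀ y ∈ points D, f (g y) = y ∧ g y ∈ points C) ∧
      Set.InjOn g (points D : Set β) ∧ D.image (Finset.image g) = C := by
  obtain ⟨f, hf, rfl⟩ := h
  have h1 : ∀ x ∈ points C, Function.invFunOn f (points C : Set α) (f x) = x := fun x hx =>
    hf.leftInvOn_invFunOn hx
  have h2 : ∀ y ∈ points (C.image (Finset.image f)),
      f (Function.invFunOn f (points C : Set α) y) = y ∧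
        Function.invFunOn f (points C : Set α) y ∈ points C := by
    intro y hy
    rw [points_image] at hy
    obtain ⟨x, hx, rfl⟩ := Finset.mem_image.1 hy
    rw [h1 x hx]
    exact ⟨rfl, hx⟩
  refine ⟨f, Function.invFunOn f (points C : Set α), hf, rfl, h1, h2, ?_, ?_⟩
  · intro y hy z hz hyz
    rw [← (h2 y hy).1, ← (h2 z hz).1, hyz]
  · rw [Finset.image_image]
    conv_rhs => rw [← Finset.image_id (s := C)]
    refine image_eq_of_eqOn fun b hb => ?_
    rw [Function.comp_apply, Finset.image_image]
    conv_rhs => rw [id, ← Finset.image_id (s := b)]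
    exact image_eq_of_eqOn fun x hx => h1 x (subset_points hb hx)

/-- The number of lines through `x`. -/
def degree (C : Finset (Finset α)) (x : α) : ℕ := (C.filter (x ∈ ·)).card

/-- An isomorphism invariant that separates the full configurations with six lines and those with
seven lines. -/
def degreeInvariant (C : Finset (Finset α)) : ℕ :=
  ∑ D ∈ C.powerset, ∏ x ∈ points D, degree C x

theorem degree_image {C : Finset (Finset α)} {f : α → β} (hf : Set.InjOn f (points C : Set α))
    {x : α} (hx : x ∈ points C) : degree (C.image (Finset.image f)) (f x) = degree C x := by
  rw [degree, degree, Finset.filter_image, Finset.card_image_of_injOn]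
  · congr 1
    refine Finset.filter_congr fun b hb => ?_
    rw [Finset.mem_image]
    constructor
    · rintro ⟨y, hy, hyx⟩
      rw [← hf (subset_points hb hy) hx hyx]
      exact hy
    · exact fun h => ⟨x, h, rfl⟩
  · exact (image_injOn_lines hf).mono (by exact_mod_cast Finset.filter_subset _ _)

theorem points_mono {C D : Finset (Finset α)} (h : D ⊆ C) : points D ⊆ points C :=
  Finset.biUnion_subset_biUnion_of_subset_left _ h

theorem Isomorphic.degreeInvariant_eq {C : Finset (Finset α)} {D : Finset (Finset β)}
    (h : Isomorphic C D) : degreeInvariant C = degreeInvariant D := by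
  obtain ⟨f, hf, rfl⟩ := h
  rw [degreeInvariant, degreeInvariant, Finset.powerset_image, Finset.sum_image]
  · refine Finset.sum_congr rfl fun D hD => ?_
    rw [Finset.mem_powerset] at hD
    rw [points_image, Finset.prod_image]
    · exact Finset.prod_congr rfl fun x hx => (degree_image hf (points_mono hD hx)).symm
    · exact hf.mono (by exact_mod_cast points_mono hD)
  · intro D hD E hE hDE
    rw [Finset.mem_coe, Finset.mem_powerset] at hD hE
    have := congrArg (fun s : Finset (Finset β) => (s : Set (Finset β))) hDE
    simp only [Finset.coe_image] at this
    exact_mod_cast ((image_injOn_lines hf).image_eq_image_iff (by exact_mod_cast hD)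
      (by exact_mod_cast hE)).1 this

end Isomorphic

/-- Two lines through two common points have the same image block, and the isomorphism is injective
on lines. -/
theorem IsConfiguration.isPartialTripleSystem {C : Finset (Finset ℕ)} (h : IsConfiguration C) :
    IsPartialTripleSystem C := by
  obtain ⟨v, B, D, hB, hDB, f, hf, hfC⟩ := h
  have hmem : ∀ b ∈ C, b.image f ∈ B := fun b hb =>
    hDB (hfC ▸ Finset.mem_image_of_mem _ hb)
  constructor
  · intro b hb
    rw [← hB.2.1 _ (hmem b hb), Finset.card_image_of_injOn]
    exact hf.mono (by exact_mod_cast subset_points hb)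
  · intro b hb b' hb' x y hxy hx hy hx' hy'
    refine image_injOn_lines hf hb hb' ?_
    refine (hB.2.2 (f x) (f y) fun e =>
      hxy (hf (subset_points hb hx) (subset_points hb hy) e)).unique ⟨hmem b hb, ?_, ?_⟩
        ⟨hmem b' hb', ?_, ?_⟩
    all_goals exact Finset.mem_image_of_mem f ‹_›

/-! ### The representatives are configurations -/

/-- The blocks of a Steiner triple system of order 15. -/
def blocks15 : List (Fin 15 × Fin 15 × Fin 15) :=
  [(0, 1, 2), (0, 3, 4), (0, 5, 6), (1, 3, 5), (1, 4, 6), (2, 3, 6), (2, 4, 5), (0, 7, 11),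
   (0, 8, 9), (0, 10, 13), (0, 12, 14), (1, 7, 10), (1, 8, 13), (1, 9, 12), (1, 11, 14), (2,
   7, 9), (2, 8, 12), (2, 10, 11), (2, 13, 14), (3, 7, 12), (3, 8, 10), (3, 9, 14), (3, 11,
   13), (4, 7, 14), (4, 8, 11), (4, 9, 13), (4, 10, 12), (5, 7, 8), (5, 9, 11), (5, 10, 14),
   (5, 12, 13), (6, 7, 13), (6, 8, 14), (6, 9, 10), (6, 11, 12)]

/-- A Steiner triple system of order 15. -/
def system15 : Finset (Finset (Fin 15)) :=
  (blocks15.map fun t => {t.1, t.2.1, t.2.2}).toFinset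

theorem mem_system15 {b : Finset (Fin 15)} :
    b ∈ system15 ↔ ∃ t ∈ blocks15, {t.1, t.2.1, t.2.2} = b := by
  rw [system15, List.mem_toFinset, List.mem_map]

theorem blocks15_ne : ∀ t ∈ blocks15, t.1 ≠ t.2.1 ∧ t.1 ≠ t.2.2 ∧ t.2.1 ≠ t.2.2 := by
  have h : (blocks15.all fun t => decide (t.1 ≠ t.2.1 ∧ t.1 ≠ t.2.2 ∧ t.2.1 ≠ t.2.2)) = true := by
    decide +kernel
  simpa only [List.all_eq_true, decide_eq_true_eq] using h

/-- The point `x` is on the block `t`. -/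
def isOn15 (t : Fin 15 × Fin 15 × Fin 15) (x : Fin 15) : Bool :=
  Nat.beq t.1.val x.val || (Nat.beq t.2.1.val x.val || Nat.beq t.2.2.val x.val)

theorem isOn15_iff {t : Fin 15 × Fin 15 × Fin 15} {x : Fin 15} :
    isOn15 t x = true ↔ x ∈ ({t.1, t.2.1, t.2.2} : Finset (Fin 15)) := by
  simp only [isOn15, Bool.or_eq_true, Nat.beq_eq, Finset.mem_insert, Finset.mem_singleton,
    Fin.ext_iff]
  omega

theorem isSTS_system15 : IsSTS system15 := by
  refine ⟨⟨0⟩, fun b hb => ?_, fun x y hxy => ?_⟩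
  · obtain ⟨t, ht, rfl⟩ := mem_system15.1 hb
    exact Finset.card_eq_three.2 ⟨_, _, _, (blocks15_ne t ht).1, (blocks15_ne t ht).2.1,
      (blocks15_ne t ht).2.2, rfl⟩
  -- Counting the listed blocks through each pair gives existence and uniqueness together; the test
  -- is phrased in `Nat.beq` so that the kernel can evaluate it.
  have key : ∀ x y : Fin 15, Nat.beq x.val y.val = false →
      Nat.beq (blocks15.filter fun t => isOn15 t x && isOn15 t y).length 1 = true := by
    decide +kernel
  obtain ⟨t, ht⟩ := List.length_eq_one_iff.1 (Nat.eq_of_beq_eq_true (key x y (by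
    rw [← Bool.not_eq_true, Nat.beq_eq, ← Fin.ext_iff]
    exact hxy)))
  have hmem : ∀ s, s ∈ blocks15 ∧ x ∈ ({s.1, s.2.1, s.2.2} : Finset (Fin 15)) ∧
      y ∈ ({s.1, s.2.1, s.2.2} : Finset (Fin 15)) ↔ s = t := by
    intro s
    rw [← List.mem_singleton, ← ht, List.mem_filter, Bool.and_eq_true, isOn15_iff, isOn15_iff]
  have h0 := (hmem t).2 rfl
  refine ⟨{t.1, t.2.1, t.2.2}, ⟨mem_system15.2 ⟨t, h0.1, rfl⟩, h0.2⟩, ?_⟩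
  rintro c ⟨hc, hxc, hyc⟩
  obtain ⟨s, hs, rfl⟩ := mem_system15.1 hc
  rw [(hmem s).1 ⟨hs, hxc, hyc⟩]

/-! ### Realisation and separation of the representatives -/

/-- The map given by an entry of `fullTable`. -/
def tableMap (t : List ℕ × List ℕ) (x : ℕ) : Fin 15 :=
  Fin.ofNat 15 (((t.1.zip t.2).lookup x).getD 0)

theorem fullTable_spec {n : ℕ} (hn : n = 6 ∨ n = 7) : ∀ t ∈ fullTable n,
    (∀ x ∈ t.1, ∀ y ∈ t.1, tableMap t x = tableMap t y → x = y) ∧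
    (∀ i < n, blocks15.any (fun s =>
      (t.1.filter (·.testBit i)).all fun x => isOn15 s (tableMap t x)) = true) := by
  rcases hn with rfl | rfl <;> decide +kernel

/-- The second condition makes the `n` decoded lines distinct, the third makes them a full family.
-/
theorem fullReps_spec {n : ℕ} (hn : n = 6 ∨ n = 7) : ∀ R ∈ fullReps n, R.Nodup ∧
    (∀ i < n, ∀ j < n, (∀ m ∈ R, m.testBit i = m.testBit j) → i = j) ∧
    (∀ m ∈ R, 2 ≤ (List.range n).countP (m.testBit ·)) := by
  rcases hn with rfl | rfl <;> decide +kernel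

section Decode

variable {n : ℕ} {R : List ℕ}

theorem lineOf_injOn (hR : ∀ i < n, ∀ j < n, (∀ m ∈ R, m.testBit i = m.testBit j) → i = j) :
    Set.InjOn (fun i => R.toFinset.filter (·.testBit i)) (Finset.range n : Set ℕ) := by
  intro i hi j hj hij
  simp only [Finset.coe_range, Set.mem_Iio] at hi hj
  refine hR i hi j hj fun m hm => ?_
  have := Finset.ext_iff.1 hij m
  simp only [Finset.mem_filter, List.mem_toFinset, hm, true_and] at this
  exact Bool.eq_iff_iff.2 this

theorem degree_decodeLines
    (hR : ∀ i < n, ∀ j < n, (∀ m ∈ R, m.testBit i = m.testBit j) → i = j) {m : ℕ}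
    (hm : m ∈ R) : degree (decodeLines n R) m = (List.range n).countP (m.testBit ·) := by
  rw [degree, decodeLines, Finset.filter_image, Finset.card_image_of_injOn
    ((lineOf_injOn hR).mono (by exact_mod_cast Finset.filter_subset _ _)),
    List.countP_eq_length_filter, ← List.toFinset_card_of_nodup (List.nodup_range.filter _)]
  congr 1
  ext i
  simp [hm]

/-- The sum over the subsets `D` of `0, …, k - 1` of the product of `d m` over the members `m` of
`M` having a digit in `D`. -/
noncomputable def LineSearch.subsetSum (d : ℕ → ℕ) (k : ℕ) : List ℕ → ℕ :=
  Nat.rec (fun _ => 1) (fun k ih M => Nat.add (ih M) (Nat.mul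
    (List.rec 1 (fun m _ t => Bool.rec t (Nat.mul (d m) t) (m.testBit k)) M)
    (ih (LineSearch.keep (fun m => !m.testBit k) M)))) k

/-- Split the subsets according to whether they contain the line `k`. If so, the points on this line
contribute their factors at once and can be dropped from the list. -/
theorem LineSearch.subsetSum_eq (d : ℕ → ℕ) (k : ℕ) : ∀ M : List ℕ,
    LineSearch.subsetSum d k M = ∑ D ∈ (Finset.range k).powerset,
      (M.map fun m => if ∃ i ∈ D, m.testBit i then d m else 1).prod := by
  induction k with
  | zero =>
    intro M
    simp only [Finset.range_zero, Finset.powerset_empty, Finset.sum_singleton,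
      Finset.notMem_empty, false_and, exists_false, if_false, List.map_const',
      List.prod_replicate, one_pow]
    rfl
  | succ k ih =>
    intro M
    change LineSearch.subsetSum d k M + _ * LineSearch.subsetSum d k _ = _
    rw [Finset.range_add_one, Finset.sum_powerset_insert Finset.notMem_range_self, ih, ih,
      Finset.mul_sum, LineSearch.keep_eq]
    congr 1
    refine Finset.sum_congr rfl fun D _ => ?_
    induction M with
    | nil => simp
    | cons m M ihM =>
      rw [List.filter_cons, List.map_cons, List.prod_cons, ← ihM]
      cases hm : m.testBit k
      · simp only [Bool.not_false, if_true, List.map_cons, List.prod_cons,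
          Finset.exists_mem_insert, hm, Bool.false_eq_true, false_or]
        ring
      · simp only [Bool.not_true, Bool.false_eq_true, if_false, Finset.exists_mem_insert, hm,
          true_or, if_true]
        change d m * _ * _ = _
        ring

/-- Makes the invariant computable by the kernel, without finite sets of finite sets. -/
theorem degreeInvariant_decodeLines (hnd : R.Nodup)
    (hR : ∀ i < n, ∀ j < n, (∀ m ∈ R, m.testBit i = m.testBit j) → i = j) :
    degreeInvariant (decodeLines n R) =
      LineSearch.subsetSum (fun m => (List.range n).countP (m.testBit ·)) n R := by
  have hinj := lineOf_injOn hR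
  rw [LineSearch.subsetSum_eq, degreeInvariant]
  have hpow : (decodeLines n R).powerset = (Finset.range n).powerset.image
      (Finset.image fun i => R.toFinset.filter (·.testBit i)) := Finset.powerset_image
  rw [hpow, Finset.sum_image]
  · refine Finset.sum_congr rfl fun D _ => ?_
    have hpts : points (D.image fun i => R.toFinset.filter (·.testBit i)) =
        R.toFinset.filter (fun m => ∃ i ∈ D, m.testBit i) := by
      ext m
      simp only [mem_points, Finset.mem_image, Finset.mem_filter, List.mem_toFinset]
      constructor
      · rintro ⟨_, ⟨i, hi, rfl⟩, hm⟩
        rw [Finset.mem_filter, List.mem_toFinset] at hm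
        exact ⟨hm.1, i, hi, hm.2⟩
      · rintro ⟨hm, i, hi, hb⟩
        exact ⟨_, ⟨i, hi, rfl⟩, Finset.mem_filter.2 ⟨List.mem_toFinset.2 hm, hb⟩⟩
    rw [hpts, Finset.prod_filter, ← List.prod_toFinset _ hnd]
    refine Finset.prod_congr rfl fun m hm => ?_
    rw [degree_decodeLines hR (List.mem_toFinset.1 hm)]
  · intro D hD E hE hDE
    rw [Finset.mem_coe, Finset.mem_powerset] at hD hE
    have := congrArg (fun s : Finset (Finset ℕ) => (s : Set (Finset ℕ))) hDE
    simp only [Finset.coe_image] at this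
    exact_mod_cast (hinj.image_eq_image_iff (by exact_mod_cast hD)
      (by exact_mod_cast hE)).1 this

end Decode

theorem degreeInvariant_nodup {n : ℕ} (hn : n = 6 ∨ n = 7) :
    ((fullReps n).map fun R => degreeInvariant (decodeLines n R)).Nodup := by
  have h : ((fullReps n).map fun R => LineSearch.subsetSum
      (fun m => (List.range n).countP (m.testBit ·)) n R).Nodup := by
    rcases hn with rfl | rfl <;> decide +kernel
  rwa [List.map_congr_left fun R hR => degreeInvariant_decodeLines (fullReps_spec hn R hR).1
    (fullReps_spec hn R hR).2.1]

theorem isFullConfiguration_of_mem_fullReps {n : ℕ} (hn : n = 6 ∨ n = 7) :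
    ∀ R ∈ fullReps n, IsFullConfiguration n (decodeLines n R) := by
  intro R hR
  obtain ⟨_, hinj, hdeg⟩ := fullReps_spec hn R hR
  obtain ⟨t, ht, rfl⟩ := List.mem_map.1 hR
  obtain ⟨h1, h2⟩ := fullTable_spec hn t ht
  have hpts : ∀ x ∈ points (decodeLines n t.1), x ∈ t.1 := by
    intro x hx
    obtain ⟨b, hb, hxb⟩ := mem_points.1 hx
    obtain ⟨i, _, rfl⟩ := Finset.mem_image.1 hb
    exact List.mem_toFinset.1 (Finset.mem_filter.1 hxb).1
  refine ⟨⟨15, system15, _, isSTS_system15, ?_, tableMap t, ?_, rfl⟩, ?_, ?_⟩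
  · intro c hc
    obtain ⟨b, hb, rfl⟩ := Finset.mem_image.1 hc
    obtain ⟨i, hi, rfl⟩ := Finset.mem_image.1 hb
    obtain ⟨s, hs, hsi⟩ := List.any_eq_true.1 (h2 i (Finset.mem_range.1 hi))
    rw [List.all_eq_true] at hsi
    -- The image of a line has three points and lies in a block with at most three, so it is the
    -- block.
    refine mem_system15.2 ⟨s, hs, Eq.symm (Finset.eq_of_subset_of_card_le ?_ ?_)⟩
    · intro y hy
      obtain ⟨x, hx, rfl⟩ := Finset.mem_image.1 hy
      rw [Finset.mem_filter, List.mem_toFinset] at hx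
      exact isOn15_iff.1 (hsi x (List.mem_filter.2 hx))
    · rw [Finset.card_image_of_injOn, card_line_of_mem_fullReps (by omega) t.1 hR i
        (Finset.mem_range.1 hi)]
      · exact Finset.card_le_three
      · intro x hx y hy hxy
        simp only [Finset.coe_filter, List.mem_toFinset, Set.mem_ofPred_eq] at hx hy
        exact h1 x hx.1 y hy.1 hxy
  · intro x hx y hy hxy
    exact h1 x (hpts x hx) y (hpts y hy) hxy
  · intro x hx
    have := hdeg x (hpts x hx)
    rwa [← degree_decodeLines hinj (hpts x hx)] at this
  · rw [decodeLines, Finset.card_image_of_injOn (lineOf_injOn hinj), Finset.card_range]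

theorem hasExactlyUpToIso_isFullConfiguration {n : ℕ} (hn : n = 6 ∨ n = 7) :
    HasExactlyUpToIso (fullReps n).length (IsFullConfiguration n) := by
  have hnd := degreeInvariant_nodup hn
  have hinj := List.inj_on_of_nodup_map hnd
  refine ⟨((fullReps n).map (decodeLines n)).toFinset, ?_, ?_, ?_, ?_⟩
  · rw [List.toFinset_card_of_nodup, List.length_map]
    refine List.Nodup.of_map degreeInvariant ?_
    rwa [List.map_map]
  · intro C hC
    obtain ⟨R, hR, rfl⟩ := List.mem_map.1 (List.mem_toFinset.1 hC)
    exact isFullConfiguration_of_mem_fullReps hn R hR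
  · intro C hC D hD hCD
    obtain ⟨R, hR, rfl⟩ := List.mem_map.1 (List.mem_toFinset.1 hC)
    obtain ⟨R', hR', rfl⟩ := List.mem_map.1 (List.mem_toFinset.1 hD)
    rw [hinj hR hR' hCD.degreeInvariant_eq]
  · rintro C ⟨hC, hF, rfl⟩
    obtain ⟨R, hR, hiso⟩ := exists_isomorphic_fullReps hC.isPartialTripleSystem hF (by omega)
    exact ⟨_, List.mem_toFinset.2 (List.mem_map_of_mem hR), hiso⟩

/-! ### Generating sets -/

/-- The points generated by `S`. -/
inductive IsGenerated (C : Finset (Finset ℕ)) (S : Finset ℕ) : ℕ → Prop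
  | base {x : ℕ} : x ∈ S → IsGenerated C S x
  | third {x y z : ℕ} : IsGenerated C S x → IsGenerated C S y → ({x, y, z} : Finset ℕ) ∈ C →
      IsGenerated C S z

theorem subset_extendOnce (C : Finset (Finset ℕ)) (S : Finset ℕ) : S ⊆ extendOnce C S :=
  Finset.subset_union_left

/-- The iterates increase and there are finitely many points, so the largest of the stages at which
they appear serves for all. -/
theorem generates_of_isGenerated {C : Finset (Finset ℕ)} {S : Finset ℕ} (hS : S ⊆ points C)
    (h : ∀ z ∈ points C, IsGenerated C S z) : Generates C S := by
  have hmono : Monotone fun j => (extendOnce C)^[j] S := by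
    refine monotone_nat_of_le_succ fun j => ?_
    rw [Function.iterate_succ_apply']
    exact subset_extendOnce C _
  have hsub : ∀ j, (extendOnce C)^[j] S ⊆ points C := by
    intro j
    induction j with
    | zero => exact hS
    | succ j ih =>
      rw [Function.iterate_succ_apply']
      exact Finset.union_subset ih (Finset.filter_subset _ _)
  have hex : ∀ z, IsGenerated C S z → ∃ j, z ∈ (extendOnce C)^[j] S := by
    intro z hz
    induction hz with
    | base hx => exact ⟨0, hx⟩
    | @third x y z _ _ hl ihx ihy =>
      obtain ⟨i, hi⟩ := ihx
      obtain ⟨j, hj⟩ := ihy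
      refine ⟨max i j + 1, ?_⟩
      rw [Function.iterate_succ_apply']
      refine Finset.mem_union_right _ (Finset.mem_filter.2 ⟨subset_points hl (by simp), x,
        hmono (le_max_left i j) hi, y, hmono (le_max_right i j) hj, hl⟩)
  choose! J hJ using fun z hz => hex z (h z hz)
  refine ⟨hS, (points C).sup J, (hsub _).antisymm fun z hz => ?_⟩
  exact hmono (Finset.le_sup hz) (hJ z hz)

theorem IsGenerated.image {C D : Finset (Finset ℕ)} {S : Finset ℕ} {g : ℕ → ℕ}
    (hg : C.image (Finset.image g) = D) {z : ℕ} (hz : IsGenerated C S z) :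
    IsGenerated D (S.image g) (g z) := by
  induction hz with
  | base hx => exact .base (Finset.mem_image_of_mem g hx)
  | third _ _ hl ihx ihy =>
    refine .third ihx ihy ?_
    rw [← hg]
    simpa [Finset.image_insert] using Finset.mem_image_of_mem (Finset.image g) hl

/-- Every member of the second list is the third point on a line through two earlier points. -/
def isGeneratedSeq : List ℕ → List ℕ → Bool
  | _, [] => true
  | S, z :: l => (S.any fun x => S.any fun y => !Nat.beq x y && !Nat.beq x z && !Nat.beq y z &&
      !Nat.beq (x &&& y &&& z) 0) && isGeneratedSeq (z :: S) l

/-- The representatives are listed with generators in front and every later point derivable from its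
predecessors. -/
theorem fullReps_isGeneratedSeq {n : ℕ} (hn : n ≤ 7) : ∀ R ∈ fullReps n,
    isGeneratedSeq (R.take 4) (R.drop 4) = true := by
  interval_cases n <;> decide +kernel

theorem bounds_of_mem_fullReps {n : ℕ} (hn : n ≤ 7) :
    ∀ R ∈ fullReps n, ∀ m ∈ R, 0 < m ∧ m < 2 ^ n := by
  interval_cases n <;> decide +kernel

/-- A common digit of three distinct encodings is a line through all three points; as lines have
three points, these are the whole line. -/
theorem isGenerated_of_isGeneratedSeq {n : ℕ} {R : List ℕ}
    (h3 : ∀ i < n, (R.toFinset.filter (·.testBit i)).card = 3) (hlt : ∀ m ∈ R, m < 2 ^ n)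
    {T : Finset ℕ} : ∀ (l S : List ℕ), isGeneratedSeq S l = true → (∀ x ∈ S, x ∈ R) →
      (∀ x ∈ l, x ∈ R) → (∀ x ∈ S, IsGenerated (decodeLines n R) T x) →
      ∀ x ∈ l, IsGenerated (decodeLines n R) T x := by
  intro l
  induction l with
  | nil => simp
  | cons z l ih =>
    intro S h hS hl hgen
    rw [isGeneratedSeq, Bool.and_eq_true] at h
    have hz : IsGenerated (decodeLines n R) T z := by
      obtain ⟨x, hx, h⟩ := List.any_eq_true.1 h.1
      obtain ⟨y, hy, h⟩ := List.any_eq_true.1 h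
      simp only [Bool.and_eq_true, Bool.not_eq_true', ← Bool.not_eq_true, Nat.beq_eq] at h
      obtain ⟨⟨⟨hxy, hxz⟩, hyz⟩, hne⟩ := h
      obtain ⟨i, hi⟩ := Nat.exists_testBit_of_ne_zero hne
      simp only [Nat.testBit_and, Bool.and_eq_true] at hi
      have hin : i < n := by
        by_contra hle
        have : x < 2 ^ i :=
          (hlt x (hS x hx)).trans_le (Nat.pow_le_pow_right (by norm_num) (by omega))
        rw [Nat.testBit_lt_two_pow this] at hi
        exact Bool.false_ne_true hi.1.1
      refine .third (hgen x hx) (hgen y hy) (Finset.mem_image.2 ⟨i, Finset.mem_range.2 hin, ?_⟩)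
      symm
      refine Finset.eq_of_subset_of_card_le ?_ ?_
      · intro w hw
        simp only [Finset.mem_insert, Finset.mem_singleton] at hw
        rw [Finset.mem_filter, List.mem_toFinset]
        rcases hw with rfl | rfl | rfl
        · exact ⟨hS _ hx, hi.1.1⟩
        · exact ⟨hS _ hy, hi.1.2⟩
        · exact ⟨hl _ (by simp), hi.2⟩
      · rw [h3 i hin, Finset.card_eq_three.2 ⟨x, y, z, hxy, hxz, hyz, rfl⟩]
    intro x hx
    rcases List.mem_cons.1 hx with rfl | hx
    · exact hz
    · refine ih (z :: S) h.2 ?_ (fun x hx => hl x (List.mem_cons_of_mem _ hx)) ?_ x hx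
      · intro w hw
        rcases List.mem_cons.1 hw with rfl | hw
        · exact hl _ (by simp)
        · exact hS w hw
      · intro w hw
        rcases List.mem_cons.1 hw with rfl | hw
        · exact hz
        · exact hgen w hw

/-- A full partial triple system with at most seven lines is generated by at most four points. -/
theorem exists_generators {C : Finset (Finset ℕ)} (hC : IsPartialTripleSystem C)
    (hF : IsFull C) (hcard : C.card ≤ 7) :
    ∃ S ⊆ points C, S.card ≤ 4 ∧ ∀ z ∈ points C, IsGenerated C S z := by
  obtain ⟨R, hR, hiso⟩ := exists_isomorphic_fullReps hC hF hcard
  obtain ⟨f, g, _, hfC, hgf, hfg, _, hgD⟩ := hiso.exists_inverse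
  set D := decodeLines C.card R with hD
  have hDR : ∀ x ∈ points D, x ∈ R := by
    intro x hx
    obtain ⟨b, hb, hxb⟩ := mem_points.1 hx
    obtain ⟨i, _, rfl⟩ := Finset.mem_image.1 hb
    exact List.mem_toFinset.1 (Finset.mem_filter.1 hxb).1
  have hRD : ∀ m ∈ R, m ∈ points D := by
    intro m hm
    obtain ⟨h0, hlt⟩ := bounds_of_mem_fullReps hcard R hR m hm
    obtain ⟨i, hi⟩ := Nat.exists_testBit_of_ne_zero h0.ne'
    refine mem_points.2 ⟨_, Finset.mem_image.2 ⟨i, Finset.mem_range.2 ?_, rfl⟩,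
      Finset.mem_filter.2 ⟨List.mem_toFinset.2 hm, hi⟩⟩
    by_contra hle
    rw [Nat.testBit_lt_two_pow
      (hlt.trans_le (Nat.pow_le_pow_right (by norm_num) (by omega)))] at hi
    exact Bool.false_ne_true hi
  have hgen : ∀ z ∈ R, IsGenerated D (R.take 4).toFinset z := by
    intro z hz
    rw [← List.take_append_drop 4 R, List.mem_append] at hz
    rcases hz with hz | hz
    · exact .base (List.mem_toFinset.2 hz)
    · exact isGenerated_of_isGeneratedSeq (card_line_of_mem_fullReps hcard R hR)
        (fun m hm => (bounds_of_mem_fullReps hcard R hR m hm).2) _ _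
        (fullReps_isGeneratedSeq hcard R hR) (fun x hx => List.mem_of_mem_take hx)
        (fun x hx => List.mem_of_mem_drop hx)
        (fun x hx => .base (List.mem_toFinset.2 hx)) z hz
  have hmaps : ∀ z ∈ points C, f z ∈ R := fun z hz => hDR _ (by
    rw [← hfC, points_image]
    exact Finset.mem_image_of_mem f hz)
  -- The generators of the representative, carried back by the inverse isomorphism.
  refine ⟨(R.take 4).toFinset.image g, ?_, ?_, ?_⟩
  · intro x hx
    obtain ⟨y, hy, rfl⟩ := Finset.mem_image.1 hx
    exact (hfg y (hRD y (List.mem_of_mem_take (List.mem_toFinset.1 hy)))).2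
  · exact Finset.card_image_le.trans ((List.toFinset_card_le _).trans (List.length_take_le 4 R))
  · intro z hz
    rw [← hgf z hz]
    exact (hgen _ (hmaps z hz)).image hgD

/-! ### Counting embeddings -/

section Embeddings

variable {v : ℕ}

/-- The maps that are injective on `P`, are zero elsewhere, and map the lines of `C` to blocks. -/
def IsEmbedding (P : Finset ℕ) (C : Finset (Finset ℕ)) (B : Finset (Finset (Fin v)))
    (f : ℕ → Fin v) : Prop :=
  (∀ x, x ∉ P → (f x : ℕ) = 0) ∧ Set.InjOn f (P : Set ℕ) ∧ ∀ b ∈ C, b.image f ∈ B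

noncomputable instance (P : Finset ℕ) (C : Finset (Finset ℕ)) (B : Finset (Finset (Fin v)))
    (f : ℕ → Fin v) : Decidable (IsEmbedding P C B f) := Classical.propDecidable _

/-- The normalisation to zero outside `P` makes an embedding determined by its restriction to `P`.
-/
theorem finite_isEmbedding (P : Finset ℕ) (C : Finset (Finset ℕ)) (B : Finset (Finset (Fin v))) :
    {f | IsEmbedding P C B f}.Finite := by
  refine Set.Finite.of_injOn (f := fun (f : ℕ → Fin v) (x : P) => f x) (t := Set.univ)
    (fun _ _ => Set.mem_univ _) ?_ Set.finite_univ
  intro f hf g hg hfg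
  funext x
  by_cases hx : x ∈ P
  · exact congrFun hfg ⟨x, hx⟩
  · exact Fin.ext ((hf.1 x hx).trans (hg.1 x hx).symm)

/-- The finite set of embeddings of the lines `C` with points `P` into the blocks `B`. -/
noncomputable def embeddings (P : Finset ℕ) (C : Finset (Finset ℕ))
    (B : Finset (Finset (Fin v))) : Finset (ℕ → Fin v) :=
  (finite_isEmbedding P C B).toFinset

theorem mem_embeddings {P : Finset ℕ} {C : Finset (Finset ℕ)} {B : Finset (Finset (Fin v))}
    {f : ℕ → Fin v} : f ∈ embeddings P C B ↔ IsEmbedding P C B f := by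
  simp [embeddings]

variable {P : Finset ℕ} {C : Finset (Finset ℕ)} {B : Finset (Finset (Fin v))}

/-- Embeddings are counted by the images of a point `p`. -/
theorem card_embeddings_eq_sum {C' : Finset (Finset ℕ)} {p : ℕ} (z₀ : Fin v)
    (hz₀ : (z₀ : ℕ) = 0) (h : ∀ f ∈ embeddings P C B,
      Function.update f p z₀ ∈ embeddings (P.erase p) C' B) :
    (embeddings P C B).card = ∑ g ∈ embeddings (P.erase p) C' B,
      (Finset.univ.filter fun z => IsEmbedding P C B (Function.update g p z)).card := by
  classical
  -- Fibres of the map that forgets the image of `p` by resetting it to zero.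
  rw [Finset.card_eq_sum_card_fiberwise h]
  refine Finset.sum_congr rfl fun g hg => ?_
  have hgp : g p = z₀ := Fin.ext (((mem_embeddings.1 hg).1 p (Finset.notMem_erase p P)).trans
    hz₀.symm)
  refine Finset.card_nbij' (fun f => f p) (fun z => Function.update g p z) ?_ ?_ ?_ ?_
  · intro f hf
    simp only [Finset.coe_filter, Set.mem_ofPred_eq, Finset.mem_univ, true_and] at hf ⊢
    rw [← hf.2]
    simpa [mem_embeddings] using hf.1
  · intro z hz
    simp only [Finset.coe_filter, Set.mem_ofPred_eq, Finset.mem_univ, true_and] at hz ⊢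
    refine ⟨mem_embeddings.2 hz, ?_⟩
    rw [Function.update_idem, ← hgp, Function.update_eq_self]
  · intro f hf
    simp only [Finset.coe_filter, Set.mem_ofPred_eq] at hf
    dsimp only
    rw [← hf.2, Function.update_idem, Function.update_eq_self]
  · intro z _
    simp

/-- As `p` is on no line of `C'`, only injectivity restricts its image. -/
theorem isEmbedding_update_iff {C' : Finset (Finset ℕ)} {p : ℕ} (hp : p ∈ P)
    (hpC : p ∉ points C') {g : ℕ → Fin v} (hg : IsEmbedding (P.erase p) C' B g) (z : Fin v) :
    IsEmbedding P C' B (Function.update g p z) ↔ z ∉ (P.erase p).image g := by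
  have hupd : ∀ x ∈ P.erase p, Function.update g p z x = g x := fun x hx =>
    Function.update_of_ne (Finset.ne_of_mem_erase hx) _ _
  constructor
  · intro h hz
    obtain ⟨x, hx, hxz⟩ := Finset.mem_image.1 hz
    refine Finset.ne_of_mem_erase hx (h.2.1 (Finset.mem_of_mem_erase hx) hp ?_)
    rw [hupd x hx, Function.update_self, hxz]
  · intro hz
    refine ⟨?_, ?_, ?_⟩
    · intro x hx
      have hxp : x ≠ p := fun e => hx (e ▸ hp)
      rw [Function.update_of_ne hxp]
      exact hg.1 x fun h => hx (Finset.mem_of_mem_erase h)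
    · intro x hx y hy hxy
      have hmem : ∀ x ∈ (P : Set ℕ), x ≠ p → x ∈ P.erase p := fun x hx hxp =>
        Finset.mem_erase.2 ⟨hxp, hx⟩
      by_cases hxp : x = p <;> by_cases hyp : y = p
      · rw [hxp, hyp]
      · subst hxp
        rw [Function.update_self, hupd y (hmem y hy hyp)] at hxy
        exact absurd (hxy ▸ Finset.mem_image_of_mem g (hmem y hy hyp)) hz
      · subst hyp
        rw [Function.update_self, hupd x (hmem x hx hxp)] at hxy
        exact absurd (hxy ▸ Finset.mem_image_of_mem g (hmem x hx hxp)) hz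
      · rw [hupd x (hmem x hx hxp), hupd y (hmem y hy hyp)] at hxy
        exact hg.2.1 (hmem x hx hxp) (hmem y hy hyp) hxy
    · intro b hb
      rw [image_eq_of_eqOn (g := g)]
      · exact hg.2.2 b hb
      · intro x hx
        refine Function.update_of_ne ?_ _ _
        rintro rfl
        exact hpC (subset_points hb hx)

theorem isEmbedding_update_zero {C' : Finset (Finset ℕ)} {p : ℕ} (hC' : C' ⊆ C)
    (hpC : p ∉ points C') {f : ℕ → Fin v} (hf : IsEmbedding P C B f) {z₀ : Fin v}
    (hz₀ : (z₀ : ℕ) = 0) : IsEmbedding (P.erase p) C' B (Function.update f p z₀) := by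
  refine ⟨?_, ?_, ?_⟩
  · intro x hx
    by_cases hxp : x = p
    · rw [hxp, Function.update_self, hz₀]
    · rw [Function.update_of_ne hxp]
      exact hf.1 x fun h => hx (Finset.mem_erase.2 ⟨hxp, h⟩)
  · intro x hx y hy hxy
    rw [Finset.mem_coe, Finset.mem_erase] at hx hy
    rw [Function.update_of_ne hx.1, Function.update_of_ne hy.1] at hxy
    exact hf.2.1 hx.2 hy.2 hxy
  · intro b hb
    rw [image_eq_of_eqOn (g := f)]
    · exact hf.2.2 b (hC' hb)
    · intro x hx
      refine Function.update_of_ne ?_ _ _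
      rintro rfl
      exact hpC (subset_points hb hx)

/-- Removing a point on no line. -/
theorem card_embeddings_of_notMem_points (hB : IsSTS B) {p : ℕ} (hp : p ∈ P)
    (hpC : p ∉ points C) : ((embeddings P C B).card : ℤ) =
      ((v : ℤ) - (P.card - 1 : ℕ)) * (embeddings (P.erase p) C B).card := by
  obtain ⟨⟨w⟩, -⟩ := hB
  have hv : 0 < v := w.pos
  rw [card_embeddings_eq_sum (C' := C) ⟨0, hv⟩ rfl fun f hf => mem_embeddings.2
    (isEmbedding_update_zero subset_rfl hpC (mem_embeddings.1 hf) rfl)]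
  push_cast
  rw [Finset.sum_congr rfl (g := fun _ => (v : ℤ) - (P.card - 1 : ℕ)), Finset.sum_const,
    nsmul_eq_mul, mul_comm]
  intro g hg
  have hg' := mem_embeddings.1 hg
  have hc : (Finset.univ.filter fun z => IsEmbedding P C B (Function.update g p z)) =
      ((P.erase p).image g)ᶜ := by
    ext z
    simp only [Finset.mem_filter, Finset.mem_univ, true_and, Finset.mem_compl]
    exact isEmbedding_update_iff hp hpC hg' z
  have hcard : ((P.erase p).image g).card = P.card - 1 := by
    rw [Finset.card_image_of_injOn hg'.2.1, Finset.card_erase_of_mem hp]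
  -- The injective map `g` itself forces `P.card - 1 ≤ v`, so the natural subtraction is exact. For
  -- smaller `v` there is no `g` and both sides of the identity vanish.
  rw [hc, Finset.card_compl, Fintype.card_fin, hcard, Nat.cast_sub]
  rw [← hcard]
  simpa using Finset.card_le_univ ((P.erase p).image g)

/-- Removing a point on a single line. -/
theorem card_embeddings_of_mem_line (hB : IsSTS B) {p q s : ℕ} (hp : p ∈ P) (hq : q ∈ P)
    (hs : s ∈ P) (hpq : p ≠ q) (hps : p ≠ s) (hqs : q ≠ s) (hl : ({p, q, s} : Finset ℕ) ∈ C)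
    (hpC : p ∉ points (C.erase {p, q, s})) :
    (embeddings P C B).card + ∑ t ∈ ((P.erase p).erase q).erase s,
        (embeddings (P.erase p) (insert {q, s, t} (C.erase {p, q, s})) B).card =
      (embeddings (P.erase p) (C.erase {p, q, s}) B).card := by
  obtain ⟨w⟩ := hB.1
  have hv : 0 < v := w.pos
  set C' := C.erase {p, q, s} with hC'
  have hCC : C = insert {p, q, s} C' := (Finset.insert_erase hl).symm
  have hqQ : q ∈ P.erase p := Finset.mem_erase.2 ⟨hpq.symm, hq⟩
  have hsQ : s ∈ P.erase p := Finset.mem_erase.2 ⟨hps.symm, hs⟩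
  rw [card_embeddings_eq_sum (C' := C') ⟨0, hv⟩ rfl fun f hf => mem_embeddings.2
    (isEmbedding_update_zero (Finset.erase_subset _ _) hpC (mem_embeddings.1 hf) rfl)]
  have hins : ∀ t, embeddings (P.erase p) (insert {q, s, t} C') B =
      (embeddings (P.erase p) C' B).filter fun g => {g q, g s, g t} ∈ B := by
    intro t
    ext g
    simp only [Finset.mem_filter, mem_embeddings, IsEmbedding, Finset.forall_mem_insert,
      Finset.image_insert, Finset.image_singleton]
    tauto
  simp only [hins, Finset.card_filter]
  -- Exchange the sums and compare for each `g`. The third point of the block through `g q` and `g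
  -- s` is either unused, giving one extension to `p` and no `t`, or it is `g t` for exactly one `t`
  -- and there is no extension.
  rw [Finset.sum_comm (s := ((P.erase p).erase q).erase s),
    ← Finset.sum_add_distrib, Finset.card_eq_sum_ones]
  refine Finset.sum_congr rfl fun g hg => ?_
  rw [mem_embeddings] at hg
  rw [← Finset.card_filter, ← Finset.card_filter]
  have hset : (Finset.univ.filter fun z => IsEmbedding P C B (Function.update g p z)) =
      Finset.univ.filter fun z => z ∉ (P.erase p).image g ∧ {z, g q, g s} ∈ B := by
    refine Finset.filter_congr fun z _ => ?_
    rw [← isEmbedding_update_iff hp hpC hg z]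
    conv_lhs => rw [hCC]
    simp only [IsEmbedding, Finset.forall_mem_insert, Finset.image_insert,
      Finset.image_singleton, Function.update_self, Function.update_of_ne hpq.symm,
      Function.update_of_ne hps.symm]
    tauto
  rw [hset]
  have hgqs : g q ≠ g s := fun e => hqs (hg.2.1 hqQ hsQ e)
  obtain ⟨b, ⟨hb, hqb, hsb⟩, huniq⟩ := hB.2.2 (g q) (g s) hgqs
  obtain ⟨z, hz, hzb⟩ : ∃ z, z ∉ ({g q, g s} : Finset (Fin v)) ∧ b = {z, g q, g s} := by
    have h3 := hB.2.1 b hb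
    have hsub : ({g q, g s} : Finset (Fin v)) ⊆ b := by
      intro x hx
      rcases Finset.mem_insert.1 hx with rfl | hx
      · exact hqb
      · rw [Finset.mem_singleton.1 hx]
        exact hsb
    have hc2 : ({g q, g s} : Finset (Fin v)).card = 2 := Finset.card_pair hgqs
    obtain ⟨z, hz⟩ := Finset.card_eq_one.1 (show (b \ {g q, g s}).card = 1 by
      rw [Finset.card_sdiff_of_subset hsub, h3, hc2])
    refine ⟨z, ?_, ?_⟩
    · have : z ∈ b \ {g q, g s} := by rw [hz]; exact Finset.mem_singleton_self z
      exact (Finset.mem_sdiff.1 this).2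
    · rw [← Finset.sdiff_union_of_subset hsub, hz]
      rfl
  have hthird : ∀ w, ({w, g q, g s} : Finset (Fin v)) ∈ B → w = z := by
    intro w hw
    have hwb := huniq _ ⟨hw, by simp, by simp⟩
    have hzw : z ∈ ({w, g q, g s} : Finset (Fin v)) := by rw [hwb, hzb]; simp
    rw [Finset.mem_insert] at hzw
    rcases hzw with h | h
    · exact h.symm
    · exact absurd h hz
  simp only [Finset.mem_insert, Finset.mem_singleton, not_or] at hz
  have hrot : ∀ w, ({g q, g s, w} : Finset (Fin v)) = {w, g q, g s} := by
    intro w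
    ext x
    simp only [Finset.mem_insert, Finset.mem_singleton]
    tauto
  by_cases hzQ : z ∈ (P.erase p).image g
  · obtain ⟨t, ht, rfl⟩ := Finset.mem_image.1 hzQ
    rw [Finset.card_eq_zero.2, Finset.card_eq_one.2 ⟨t, ?_⟩]
    · ext x
      simp only [Finset.mem_filter, Finset.mem_singleton, hrot]
      constructor
      · rintro ⟨hx, hxB⟩
        exact hg.2.1 (Finset.mem_of_mem_erase (Finset.mem_of_mem_erase hx)) ht (hthird _ hxB)
      · rintro rfl
        refine ⟨?_, hzb ▸ hb⟩
        refine Finset.mem_erase.2 ⟨fun e => hz.2 (by rw [e]), Finset.mem_erase.2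
          ⟨fun e => hz.1 (by rw [e]), ht⟩⟩
    · refine Finset.filter_eq_empty_iff.2 ?_
      rintro w - ⟨h1, h2⟩
      rw [hthird w h2] at h1
      exact h1 hzQ
  · rw [Finset.card_eq_one.2 ⟨z, ?_⟩, Finset.card_eq_zero.2]
    · refine Finset.filter_eq_empty_iff.2 ?_
      intro t ht htB
      rw [hrot] at htB
      refine hzQ (hthird _ htB ▸ Finset.mem_image_of_mem g ?_)
      exact Finset.mem_of_mem_erase (Finset.mem_of_mem_erase ht)
    · ext w
      simp only [Finset.mem_filter, Finset.mem_univ, true_and, Finset.mem_singleton]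
      constructor
      · exact fun h => hthird w h.2
      · rintro rfl
        exact ⟨hzQ, hzb ▸ hb⟩

/-- Lines of size three that embed injectively into a Steiner triple system inherit its uniqueness
of blocks. -/
theorem embeddings_eq_empty (hB : IsSTS B) (hP : points C ⊆ P) (h3 : ∀ b ∈ C, b.card = 3)
    (hC : ¬ IsPartialTripleSystem C) : embeddings P C B = ∅ := by
  refine Finset.eq_empty_of_forall_notMem fun f hf => hC ⟨h3, ?_⟩
  rw [mem_embeddings] at hf
  intro b hb b' hb' x y hxy hx hy hx' hy'
  have hinj : Set.InjOn f (points C : Set ℕ) := hf.2.1.mono (by exact_mod_cast hP)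
  refine image_injOn_lines hinj hb hb' ?_
  refine (hB.2.2 (f x) (f y) fun e =>
    hxy (hinj (subset_points hb hx) (subset_points hb hy) e)).unique
      ⟨hf.2.2 b hb, ?_, ?_⟩ ⟨hf.2.2 b' hb', ?_, ?_⟩
  all_goals exact Finset.mem_image_of_mem f ‹_›

end Embeddings

/-! ### Expressions -/

/-- Arithmetic expressions in three registers and the memory. -/
inductive Expr where
  | reg (k : Fin 3)
  | const (n : ℕ)
  | add (a b : Expr)
  | sub (a b : Expr)
  | mul (a b : Expr)
  | div (a b : Expr)
  | load (a : Expr)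

namespace Expr

/-- The value of an expression. -/
def eval (r : Fin 3 → ℕ) (m : ℕ → ℕ) : Expr → ℕ
  | reg k => r k
  | const n => n
  | add a b => a.eval r m + b.eval r m
  | sub a b => a.eval r m - b.eval r m
  | mul a b => a.eval r m * b.eval r m
  | div a b => a.eval r m / b.eval r m
  | load a => m (a.eval r m)

variable {r : Fin 3 → ℕ} {m : ℕ → ℕ}

/-- The indicator of equality. -/
def eqTest (a b : Expr) : Expr := sub (const 1) (add (sub a b) (sub b a))

/-- The indicator of inequality. -/
def neTest (a b : Expr) : Expr := sub (const 1) (eqTest a b)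

/-- The indicator of `a < b`. -/
def ltTest (a b : Expr) : Expr := sub (const 1) (sub (add a (const 1)) b)

/-- The product of a list of expressions. -/
def prod : List Expr → Expr
  | [] => const 1
  | a :: l => mul a (prod l)

theorem eval_eqTest (a b : Expr) :
    (eqTest a b).eval r m = if a.eval r m = b.eval r m then 1 else 0 := by
  simp only [eqTest, eval]
  split <;> omega

theorem eval_neTest (a b : Expr) :
    (neTest a b).eval r m = if a.eval r m ≠ b.eval r m then 1 else 0 := by
  rw [neTest, eval, eval_eqTest]
  by_cases h : a.eval r m = b.eval r m <;> simp [h, eval]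

theorem eval_ltTest (a b : Expr) :
    (ltTest a b).eval r m = if a.eval r m < b.eval r m then 1 else 0 := by
  simp only [ltTest, eval]
  split <;> omega

theorem eval_prod {l : List Expr} (h : ∀ e ∈ l, e.eval r m ≤ 1) :
    (prod l).eval r m = if ∀ e ∈ l, e.eval r m = 1 then 1 else 0 := by
  induction l with
  | nil => simp [prod, eval]
  | cons a l ih =>
    have ha := h a (by simp)
    rw [prod, eval, ih fun e he => h e (List.mem_cons_of_mem _ he)]
    simp only [List.forall_mem_cons]
    rcases Nat.le_one_iff_eq_zero_or_eq_one.1 ha with h | h <;> simp [h]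

/-- The third point of the block through the points `a` and `b`, looked up in the table. -/
def third (a b : Expr) : Expr := load (add (reg 2) (add (mul a (reg 0)) b))

/-- The digit number `k` of the index in base `v`. -/
def digit (k : ℕ) : Expr :=
  let d := div (reg 1) (prod (List.replicate k (reg 0)))
  sub d (mul (reg 0) (div d (reg 0)))

theorem eval_digit (k : ℕ) : (digit k).eval r m = r 1 / r 0 ^ k % r 0 := by
  have : ∀ k, (prod (List.replicate k (reg 0))).eval r m = r 0 ^ k := by
    intro k
    induction k with
    | zero => rfl
    | succ k ih => rw [List.replicate_succ, prod, eval, ih, eval, pow_succ']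
  simp only [digit, eval, this]
  exact (Nat.mod_eq_sub_mul_div).symm

end Expr

/-! ### Sums of expressions over the indices below the fourth power of the order -/

/-- The memory `m` holds the third points of the blocks, from the address `base` on. -/
def IsTable {v : ℕ} (B : Finset (Finset (Fin v))) (base : ℕ) (m : ℕ → ℕ) : Prop :=
  (∀ a, m a < v) ∧
    ∀ x y z : Fin v, x ≠ y → ({x, y, z} : Finset (Fin v)) ∈ B → m (base + (x * v + y)) = z

/-- A quantity is representable if it is a sum over the numbers below `v ^ 4` of the difference of
two expressions. -/
def Representable (φ : ∀ v, Finset (Finset (Fin v)) → ℤ) : Prop :=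
  ∃ p q : Expr, ∀ (v : ℕ) (B : Finset (Finset (Fin v))), IsSTS B → ∀ base m, IsTable B base m →
    φ v B = ∑ i ∈ Finset.range (v ^ 4),
      ((p.eval ![v, i, base] m : ℤ) - q.eval ![v, i, base] m)

namespace Representable

variable {φ ψ : ∀ v, Finset (Finset (Fin v)) → ℤ}

theorem congr (hφ : Representable φ) (h : ∀ v B, IsSTS B → ψ v B = φ v B) :
    Representable ψ := by
  obtain ⟨p, q, hpq⟩ := hφ
  exact ⟨p, q, fun v B hB base m hm => (h v B hB).trans (hpq v B hB base m hm)⟩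

theorem zero : Representable fun _ _ => 0 :=
  ⟨.const 0, .const 0, fun v B _ base m _ => by simp⟩

theorem add (hφ : Representable φ) (hψ : Representable ψ) :
    Representable fun v B => φ v B + ψ v B := by
  obtain ⟨p, q, hpq⟩ := hφ
  obtain ⟨p', q', hpq'⟩ := hψ
  refine ⟨.add p p', .add q q', fun v B hB base m hm => ?_⟩
  dsimp only
  rw [hpq v B hB base m hm, hpq' v B hB base m hm, ← Finset.sum_add_distrib]
  refine Finset.sum_congr rfl fun i _ => ?_
  simp only [Expr.eval]
  push_cast
  ring

theorem neg (hφ : Representable φ) : Representable fun v B => -φ v B := by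
  obtain ⟨p, q, hpq⟩ := hφ
  refine ⟨q, p, fun v B hB base m hm => ?_⟩
  dsimp only
  rw [hpq v B hB base m hm, ← Finset.sum_neg_distrib]
  exact Finset.sum_congr rfl fun i _ => by ring

theorem sum {ι : Type*} (s : Finset ι) {φ : ι → ∀ v, Finset (Finset (Fin v)) → ℤ}
    (h : ∀ i ∈ s, Representable (φ i)) : Representable fun v B => ∑ i ∈ s, φ i v B := by
  classical
  induction s using Finset.induction_on with
  | empty => simpa using zero
  | insert a s ha ih =>
    refine ((h a (by simp)).add (ih fun i hi => h i (by simp [hi]))).congr fun v B _ => ?_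
    rw [Finset.sum_insert ha]

/-- Expressions have natural values, so the signs are sorted as $(v-k)(p-q)=(vp+kq)-(vq+kp)$. -/
theorem order_sub_mul (k : ℕ) (hφ : Representable φ) :
    Representable fun v B => ((v : ℤ) - k) * φ v B := by
  obtain ⟨p, q, hpq⟩ := hφ
  refine ⟨.add (.mul (.reg 0) p) (.mul (.const k) q), .add (.mul (.reg 0) q) (.mul (.const k) p),
    fun v B hB base m hm => ?_⟩
  dsimp only
  rw [hpq v B hB base m hm, Finset.mul_sum]
  refine Finset.sum_congr rfl fun i _ => ?_
  simp only [Expr.eval, Matrix.cons_val_zero]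
  push_cast
  ring

end Representable

/-! ### Full systems: embeddings from the images of four generators -/

section Full

variable {C : Finset (Finset ℕ)}

/-- The positions of points generated by `a 0`, …, `a 3` are given by expressions. -/
theorem exists_expr_of_isGenerated (hC : IsPartialTripleSystem C) {S : Finset ℕ}
    (hS : S ⊆ points C) {a : Fin 4 → ℕ} (ha : ∀ x ∈ S, ∃ k, a k = x) {z : ℕ}
    (hz : IsGenerated C S z) : z ∈ points C ∧ ∃ e : Expr, ∀ (v : ℕ) (B : Finset (Finset (Fin v)))
      (base : ℕ) (m : ℕ → ℕ), IsTable B base m → ∀ f ∈ embeddings (points C) C B, ∀ i,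
      (∀ k : Fin 4, i / v ^ (k : ℕ) % v = f (a k)) → e.eval ![v, i, base] m = f z := by
  induction hz with
  | base hx =>
    obtain ⟨k, rfl⟩ := ha _ hx
    refine ⟨hS hx, .digit k, fun v B base m _ f _ i hi => ?_⟩
    rw [Expr.eval_digit]
    exact hi k
  | @third x y z _ _ hl ihx ihy =>
    obtain ⟨hx, ex, hex⟩ := ihx
    obtain ⟨hy, ey, hey⟩ := ihy
    refine ⟨subset_points hl (by simp), .third ex ey, fun v B base m hm f hf i hi => ?_⟩
    have hf' := mem_embeddings.1 hf
    have hxy : x ≠ y := by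
      rintro rfl
      have := hC.card_eq _ hl
      rw [Finset.insert_eq_of_mem (by simp)] at this
      have := Finset.card_le_two (a := x) (b := z)
      omega
    have himg := hf'.2.2 _ hl
    rw [Finset.image_insert, Finset.image_insert, Finset.image_singleton] at himg
    have := hm.2 (f x) (f y) (f z) (fun e => hxy (hf'.2.1 hx hy e)) himg
    simp only [Expr.third, Expr.eval, hex v B base m hm f hf i hi, hey v B base m hm f hf i hi]
    exact this

/-- The number of embeddings of a full partial triple system with at most seven lines is
representable. -/
theorem representable_of_isFull (hC : IsPartialTripleSystem C) (hF : IsFull C)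
    (hcard : C.card ≤ 7) :
    Representable fun _ B => ((embeddings (points C) C B).card : ℤ) := by
  classical
  obtain ⟨S, hSC, hS4, hgen⟩ := exists_generators hC hF hcard
  obtain ⟨a, ha⟩ : ∃ a : Fin 4 → ℕ, ∀ x ∈ S, ∃ k, a k = x := by
    -- With fewer than four generators the spare digits are tied to the value at the point `0`, so
    -- that each embedding still has exactly one index.
    refine ⟨fun k => S.toList.getD k 0, fun x hx => ?_⟩
    obtain ⟨k, hk, hkx⟩ := List.mem_iff_getElem.1 (Finset.mem_toList.2 hx)
    have hk' := hk
    rw [Finset.length_toList] at hk'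
    refine ⟨⟨k, by omega⟩, ?_⟩
    rw [← hkx]
    exact List.getD_eq_getElem _ _ hk
  have hex : ∀ z, ∃ e : Expr, (z ∉ points C → e = .const 0) ∧
      ∀ (v : ℕ) (B : Finset (Finset (Fin v))) (base : ℕ) (m : ℕ → ℕ), IsTable B base m →
      ∀ f ∈ embeddings (points C) C B, ∀ i, (∀ k : Fin 4, i / v ^ (k : ℕ) % v = f (a k)) →
      e.eval ![v, i, base] m = f z := by
    intro z
    by_cases hz : z ∈ points C
    · obtain ⟨_, e, he⟩ := exists_expr_of_isGenerated hC hSC ha (hgen z hz)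
      exact ⟨e, fun h => absurd hz h, he⟩
    -- Embeddings vanish off the points of `C`, so the constant `0` is the correct value there.
    · refine ⟨.const 0, fun _ => rfl, fun v B base m _ f hf i _ => ?_⟩
      exact ((mem_embeddings.1 hf).1 z hz).symm
  choose e he0 he using hex
  have hline : ∀ b : Finset ℕ, ∃ x y z, b ∈ C → x ≠ y ∧ b = {x, y, z} := by
    intro b
    by_cases hb : b ∈ C
    · obtain ⟨x, y, z, hxy, _, _, rfl⟩ := Finset.card_eq_three.1 (hC.card_eq b hb)
      exact ⟨x, y, z, fun _ => ⟨hxy, rfl⟩⟩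
    · exact ⟨0, 0, 0, fun h => absurd h hb⟩
  choose X Y Z hXYZ using hline
  have hXm : ∀ b ∈ C, X b ∈ points C := fun b hb =>
    subset_points hb ((Finset.ext_iff.1 (hXYZ b hb).2 _).2 (by simp))
  have hYm : ∀ b ∈ C, Y b ∈ points C := fun b hb =>
    subset_points hb ((Finset.ext_iff.1 (hXYZ b hb).2 _).2 (by simp))
  -- In this order: the digits agree with the positions computed for the generators, the positions
  -- are points, they are distinct, and every line passes the table lookup.
  let conds : List Expr :=
    ((Finset.univ : Finset (Fin 4)).toList.map fun k => .eqTest (.digit k) (e (a k))) ++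
    (((points C).toList.map fun z => .ltTest (e z) (.reg 0)) ++
    (((points C).offDiag.toList.map fun t => .neTest (e t.1) (e t.2)) ++
    (C.toList.map fun b => .eqTest (.third (e (X b)) (e (Y b))) (e (Z b)))))
  refine ⟨.prod conds, .const 0, fun v B hB base m hm => ?_⟩
  obtain ⟨⟨w⟩, hB3, hB2⟩ := hB
  have hv : 0 < v := w.pos
  have hle : ∀ i, ∀ c ∈ conds, c.eval ![v, i, base] m ≤ 1 := by
    intro i c hc
    simp only [conds, List.mem_append, List.mem_map] at hc
    rcases hc with ⟨_, _, rfl⟩ | ⟨_, _, rfl⟩ | ⟨_, _, rfl⟩ | ⟨_, _, rfl⟩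
    · rw [Expr.eval_eqTest]; split <;> simp
    · rw [Expr.eval_ltTest]; split <;> simp
    · rw [Expr.eval_neTest]; split <;> simp
    · rw [Expr.eval_eqTest]; split <;> simp
  have hall : ∀ i, (∀ c ∈ conds, c.eval ![v, i, base] m = 1) ↔
      (∀ k : Fin 4, i / v ^ (k : ℕ) % v = (e (a k)).eval ![v, i, base] m) ∧
      (∀ z ∈ points C, (e z).eval ![v, i, base] m < v) ∧
      (∀ x ∈ points C, ∀ y ∈ points C, x ≠ y →
        (e x).eval ![v, i, base] m ≠ (e y).eval ![v, i, base] m) ∧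
      (∀ b ∈ C, m (base + ((e (X b)).eval ![v, i, base] m * v + (e (Y b)).eval ![v, i, base] m)) =
        (e (Z b)).eval ![v, i, base] m) := by
    intro i
    have hdig : ∀ k, (Expr.digit k).eval ![v, i, base] m = i / v ^ k % v := fun k =>
      Expr.eval_digit k
    simp only [conds, List.forall_mem_append, List.forall_mem_map, Finset.mem_toList,
      Finset.mem_univ, true_imp_iff, Expr.eval_eqTest, Expr.eval_ltTest, Expr.eval_neTest,
      ite_eq_left_iff, zero_ne_one, imp_false, not_not, hdig, Finset.mem_offDiag, Prod.forall]
    refine and_congr Iff.rfl (and_congr Iff.rfl (and_congr ?_ Iff.rfl))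
    exact ⟨fun h x hx y hy hxy => h x y ⟨hx, hy, hxy⟩, fun h x y hxy => h x hxy.1 y hxy.2.1 hxy.2.2⟩
  have hsum : ∑ i ∈ Finset.range (v ^ 4), (((Expr.prod conds).eval ![v, i, base] m : ℤ) -
      (Expr.const 0).eval ![v, i, base] m) = (((Finset.range (v ^ 4)).filter fun i =>
        ∀ c ∈ conds, c.eval ![v, i, base] m = 1).card : ℤ) := by
    rw [Finset.card_filter]
    push_cast
    refine Finset.sum_congr rfl fun i _ => ?_
    rw [Expr.eval_prod (hle i)]
    simp [Expr.eval]
  rw [hsum]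
  refine congrArg (Nat.cast : ℕ → ℤ) ?_
  have hdigit : ∀ (x : Fin 4 → Fin v) (k : Fin 4),
      ((finFunctionFinEquiv x : Fin (v ^ 4)) : ℕ) / v ^ (k : ℕ) % v = x k := by
    intro x k
    conv_rhs => rw [← finFunctionFinEquiv.symm_apply_apply x]
    rfl
  -- An embedding corresponds to the index whose digits are the images of `a 0`, …, `a 3`;
  -- conversely an index passing all tests defines an embedding by the values of `e`.
  refine Finset.card_bij (fun (f : ℕ → Fin v) _ => ((finFunctionFinEquiv fun k => f (a k) : Fin (v ^ 4)) : ℕ))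
    ?_ ?_ ?_
  · intro f hf
    have hf' := mem_embeddings.1 hf
    have hval : ∀ z, (e z).eval ![v, ((finFunctionFinEquiv fun k => f (a k) : Fin (v ^ 4)) : ℕ),
        base] m = f z := fun z => he z v B base m hm f hf _ fun k => hdigit _ k
    rw [Finset.mem_filter, Finset.mem_range, hall]
    refine ⟨Fin.is_lt _, fun k => ?_, fun z _ => ?_, fun x hx y hy hxy h => ?_, fun b hb => ?_⟩
    · rw [hval, hdigit]
    · rw [hval]; exact Fin.is_lt _
    · rw [hval, hval] at h
      exact hxy (hf'.2.1 hx hy (Fin.ext h))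
    · rw [hval, hval, hval]
      obtain ⟨hxy, hbe⟩ := hXYZ b hb
      have himg := hf'.2.2 b hb
      rw [hbe, Finset.image_insert, Finset.image_insert, Finset.image_singleton] at himg
      exact hm.2 _ _ _ (fun h => hxy (hf'.2.1 (hXm b hb) (hYm b hb) h)) himg
  · intro f hf g hg hfg
    have hval : ∀ f ∈ embeddings (points C) C B, ∀ z,
        (e z).eval ![v, ((finFunctionFinEquiv fun k => f (a k) : Fin (v ^ 4)) : ℕ), base] m = f z :=
      fun f hf z => he z v B base m hm f hf _ fun k => hdigit _ k
    funext z
    refine Fin.ext ?_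
    rw [← hval f hf, ← hval g hg, hfg]
  · intro i hi
    rw [Finset.mem_filter, Finset.mem_range, hall] at hi
    obtain ⟨hi4, h1, h2, h3, h4⟩ := hi
    have hlt : ∀ z, (e z).eval ![v, i, base] m < v := by
      intro z
      by_cases hz : z ∈ points C
      · exact h2 z hz
      · rw [he0 z hz]; exact hv
    refine ⟨fun z => ⟨(e z).eval ![v, i, base] m, hlt z⟩, ?_, ?_⟩
    · rw [mem_embeddings]
      refine ⟨fun z hz => ?_, fun x hx y hy hxy => ?_, fun b hb => ?_⟩
      · show (e z).eval _ _ = 0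
        rw [he0 z hz]; rfl
      · by_contra hne
        exact h3 x hx y hy hne (congrArg Fin.val hxy)
      · obtain ⟨hxy, hbe⟩ := hXYZ b hb
        have hne := h3 _ (hXm b hb) _ (hYm b hb) hxy
        set g : ℕ → Fin v := fun z => ⟨(e z).eval ![v, i, base] m, hlt z⟩ with hg
        have hgne : g (X b) ≠ g (Y b) := fun h => hne (congrArg Fin.val h)
        obtain ⟨c, ⟨hc, hxc, hyc⟩, _⟩ := hB2 _ _ hgne
        obtain ⟨z, hz⟩ : ∃ z, c = {g (X b), g (Y b), z} := by
          have hsub : ({g (X b), g (Y b)} : Finset (Fin v)) ⊆ c := by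
            intro x hx
            rcases Finset.mem_insert.1 hx with rfl | hx
            · exact hxc
            · rw [Finset.mem_singleton.1 hx]; exact hyc
          obtain ⟨z, hz⟩ := Finset.card_eq_one.1 (show (c \ {g (X b), g (Y b)}).card = 1 by
            rw [Finset.card_sdiff_of_subset hsub, hB3 c hc, Finset.card_pair hgne])
          refine ⟨z, ?_⟩
          rw [← Finset.sdiff_union_of_subset hsub, hz]
          ext x
          simp only [Finset.mem_union, Finset.mem_insert, Finset.mem_singleton]
          tauto
        -- The table is only known to be correct on blocks, so the block through the first two
        -- images is taken first; its third point is then compared with the lookup.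
        have hzb : z = g (Z b) := by
          refine Fin.ext ?_
          rw [← hm.2 _ _ z hgne (hz ▸ hc)]
          exact h4 b hb
        have himg : b.image g = c := by
          rw [hz, hzb]
          conv_lhs => rw [hbe]
          rw [Finset.image_insert, Finset.image_insert, Finset.image_singleton]
        rw [himg]
        exact hc
    · have : (fun k => (⟨(e (a k)).eval ![v, i, base] m, hlt (a k)⟩ : Fin v)) =
          finFunctionFinEquiv.symm ⟨i, hi4⟩ := by
        funext k
        exact Fin.ext (h1 k).symm
      rw [this, Equiv.apply_symm_apply]

end Full

/-- The number of embeddings of at most seven lines is representable. -/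
theorem representable_card_embeddings : ∀ (N : ℕ) (P : Finset ℕ) (C : Finset (Finset ℕ)),
    P.card = N → points C ⊆ P → (∀ b ∈ C, b.card = 3) → C.card ≤ 7 →
    Representable fun _ B => ((embeddings P C B).card : ℤ) := by
  intro N
  induction N with
  | zero =>
    intro P C hP hCP h3 h7
    rw [Finset.card_eq_zero] at hP
    have hpts : points C = ∅ := Finset.subset_empty.1 (hP ▸ hCP)
    rw [hP, ← hpts]
    have hC : C = ∅ := by
      refine Finset.eq_empty_of_forall_notMem fun b hb => ?_
      have h := subset_points hb
      rw [hpts, Finset.subset_empty] at h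
      simpa [h] using h3 b hb
    subst hC
    exact representable_of_isFull ⟨by simp, by simp⟩ (by simp [IsFull, points]) (by simp)
  | succ N ih =>
    intro P C hP hCP h3 h7
    by_cases hC : IsPartialTripleSystem C
    swap
    -- Replacing a line can create two lines with two common points; such a family contributes
    -- nothing.
    · refine Representable.zero.congr fun v B hB => ?_
      rw [embeddings_eq_empty hB hCP h3 hC]
      simp
    by_cases hiso : ∃ p ∈ P, p ∉ points C
    · obtain ⟨p, hp, hpC⟩ := hiso
      refine ((ih (P.erase p) C (by rw [Finset.card_erase_of_mem hp, hP]; rfl) (fun x hx =>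
        Finset.mem_erase.2 ⟨fun e => hpC (e ▸ hx), hCP hx⟩) h3 h7).order_sub_mul
          (P.card - 1)).congr fun v B hB => card_embeddings_of_notMem_points hB hp hpC
    push Not at hiso
    have hPC : P = points C := Finset.Subset.antisymm hiso hCP
    by_cases hF : IsFull C
    · rw [hPC]
      exact representable_of_isFull hC hF h7
    · simp only [IsFull, not_forall, not_le] at hF
      obtain ⟨p, hp, hdeg⟩ := hF
      obtain ⟨b, hb, hpb⟩ := mem_points.1 hp
      -- A failure of fullness yields a point `p` on exactly one line.
      have honly : ∀ c ∈ C, p ∈ c → c = b := by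
        intro c hc hpc
        exact Finset.card_le_one.1 (Nat.lt_succ_iff.1 hdeg) c (Finset.mem_filter.2 ⟨hc, hpc⟩) b
          (Finset.mem_filter.2 ⟨hb, hpb⟩)
      obtain ⟨q, s, hpq, hps, hqs, rfl⟩ : ∃ q s, p ≠ q ∧ p ≠ s ∧ q ≠ s ∧ b = {p, q, s} := by
        obtain ⟨q, s, hqs, hb'⟩ := Finset.card_eq_two.1 (show (b.erase p).card = 2 by
          rw [Finset.card_erase_of_mem hpb, hC.card_eq b hb])
        refine ⟨q, s, ?_, ?_, hqs, by rw [← hb', Finset.insert_erase hpb]⟩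
        · rintro rfl
          exact Finset.notMem_erase p b (by rw [hb']; simp)
        · rintro rfl
          exact Finset.notMem_erase p b (by rw [hb']; simp)
      have hq : q ∈ P := hCP (subset_points hb (by simp))
      have hs : s ∈ P := hCP (subset_points hb (by simp))
      have hpC' : p ∉ points (C.erase {p, q, s}) := by
        intro h
        obtain ⟨c, hc, hpc⟩ := mem_points.1 h
        exact Finset.ne_of_mem_erase hc (honly c (Finset.mem_of_mem_erase hc) hpc)
      have hcard : (P.erase p).card = N := by
        rw [Finset.card_erase_of_mem (hCP hp), hP]; rfl
      have hsub : points (C.erase {p, q, s}) ⊆ P.erase p := fun x hx =>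
        Finset.mem_erase.2 ⟨fun e => hpC' (e ▸ hx), hCP (points_mono (Finset.erase_subset _ _) hx)⟩
      have herase : (C.erase {p, q, s}).card + 1 = C.card := Finset.card_erase_add_one hb
      have hmain := ih (P.erase p) (C.erase {p, q, s}) hcard hsub
        (fun c hc => h3 c (Finset.mem_of_mem_erase hc)) (by omega)
      have hrest := Representable.sum (((P.erase p).erase q).erase s)
        (φ := fun t _ B => ((embeddings (P.erase p)
          (insert {q, s, t} (C.erase {p, q, s})) B).card : ℤ)) (by
        intro t ht
        simp only [Finset.mem_erase] at ht
        -- One line was erased and at most one is inserted, so the bound of seven lines persists.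
        refine ih _ _ hcard ?_ ?_ ((Finset.card_insert_le _ _).trans (by omega))
        · intro x hx
          obtain ⟨c, hc, hxc⟩ := mem_points.1 hx
          rcases Finset.mem_insert.1 hc with rfl | hc
          · simp only [Finset.mem_insert, Finset.mem_singleton] at hxc
            rcases hxc with rfl | rfl | rfl
            · exact Finset.mem_erase.2 ⟨hpq.symm, hq⟩
            · exact Finset.mem_erase.2 ⟨hps.symm, hs⟩
            · exact Finset.mem_erase.2 ht.2.2
          · exact hsub (subset_points hc hxc)
        · intro c hc
          rcases Finset.mem_insert.1 hc with rfl | hc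
          · exact Finset.card_eq_three.2 ⟨q, s, t, hqs, ht.2.1.symm, ht.1.symm, rfl⟩
          · exact h3 c (Finset.mem_of_mem_erase hc))
      refine (hmain.add hrest.neg).congr fun v B hB => ?_
      have := card_embeddings_of_mem_line hB (hCP hp) hq hs hpq hps hqs hb hpC'
      rw [← this]
      push_cast
      ring

/-! ### Occurrences and embeddings -/

/-- The number of automorphisms of `C`. -/
noncomputable def autCount (C : Finset (Finset ℕ)) : ℕ :=
  {g : ℕ → ℕ | (∀ x, x ∉ points C → g x = 0) ∧ Set.InjOn g (points C : Set ℕ) ∧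
    C.image (Finset.image g) = C}.ncard

theorem occurrences_eq_div (C : Finset (Finset ℕ)) {v : ℕ} {B : Finset (Finset (Fin v))}
    (hB : IsSTS B) : occurrences C B = (embeddings (points C) C B).card / autCount C := by
  classical
  obtain ⟨⟨w⟩, -⟩ := hB
  have hv : 0 < v := w.pos
  set F := embeddings (points C) C B with hF
  set Φ : (ℕ → Fin v) → Finset (Finset (Fin v)) := fun f => C.image (Finset.image f) with hΦ
  have himage : {D : Finset (Finset (Fin v)) | D ⊆ B ∧ Isomorphic C D} = (F.image Φ : Finset _) := by
    ext D
    simp only [Set.mem_ofPred_eq, Finset.coe_image, Set.mem_image, Finset.mem_coe]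
    constructor
    · rintro ⟨hD, f, hf, rfl⟩
      have heq : ∀ x ∈ points C, (if x ∈ points C then f x else ⟨0, hv⟩) = f x := fun x hx =>
        if_pos hx
      have hΦf : Φ (fun x => if x ∈ points C then f x else ⟨0, hv⟩) =
          C.image (Finset.image f) := image_image_eq_of_eqOn heq
      refine ⟨_, mem_embeddings.2 ⟨fun x hx => ?_, fun x hx y hy hxy => ?_, fun b hb => ?_⟩, hΦf⟩
      · rw [if_neg hx]
      · rw [heq x hx, heq y hy] at hxy
        exact hf hx hy hxy
      · exact hD (hΦf ▸ Finset.mem_image_of_mem _ hb)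
    · rintro ⟨f, hf, rfl⟩
      rw [hF, mem_embeddings] at hf
      refine ⟨fun c hc => ?_, f, hf.2.1, rfl⟩
      obtain ⟨b, hb, rfl⟩ := Finset.mem_image.1 hc
      exact hf.2.2 b hb
  have hocc : occurrences C B = (F.image Φ).card := by
    rw [occurrences, himage, Set.ncard_coe_finset]
  -- Fix an isomorphism `f` from `C` to `D` with inverse `g`: the embeddings with image `D`
  -- correspond to the automorphisms by composition with `g` and `f`.
  have hfiber : ∀ D ∈ F.image Φ, (F.filter fun f => Φ f = D).card = autCount C := by
    intro D hD
    have hDmem : D ∈ {D : Finset (Finset (Fin v)) | D ⊆ B ∧ Isomorphic C D} := by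
      rw [himage]; exact_mod_cast hD
    obtain ⟨hDB, hiso⟩ := hDmem
    obtain ⟨f, g, hf, hfC, hgf, hfg, hg, hgD⟩ := hiso.exists_inverse
    rw [← Set.ncard_coe_finset, autCount]
    refine Set.ncard_congr (fun h _ x => if x ∈ points C then g (h x) else 0) ?_ ?_ ?_
    · intro h hh
      rw [Finset.coe_filter, Set.mem_ofPred_eq, hF, mem_embeddings] at hh
      obtain ⟨⟨_, h2, _⟩, h4⟩ := hh
      have hmem : ∀ x ∈ points C, h x ∈ points D := fun x hx => by
        rw [← h4, points_image]
        exact Finset.mem_image_of_mem h hx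
      have heq : ∀ x ∈ points C, (if x ∈ points C then g (h x) else 0) = (g ∘ h) x := fun x hx =>
        if_pos hx
      refine ⟨fun x hx => if_neg hx, fun x hx y hy hxy => ?_, ?_⟩
      · dsimp only at hxy
        rw [heq x hx, heq y hy] at hxy
        exact h2 hx hy (hg (hmem x hx) (hmem y hy) hxy)
      · rw [image_image_eq_of_eqOn heq]
        conv_rhs => rw [← hgD, ← h4, Finset.image_image]
        refine image_eq_of_eqOn fun b _ => ?_
        rw [Function.comp_apply, Finset.image_image]
    · intro h h' hh hh' heq
      rw [Finset.coe_filter, Set.mem_ofPred_eq, hF, mem_embeddings] at hh hh'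
      funext x
      by_cases hx : x ∈ points C
      · have hmem : ∀ h, Φ h = D → h x ∈ points D := fun h h4 => by
          rw [← h4, points_image]
          exact Finset.mem_image_of_mem h hx
        have := congrFun heq x
        simp only [hx, if_true] at this
        exact hg (hmem h hh.2) (hmem h' hh'.2) this
      · exact Fin.ext ((hh.1.1 x hx).trans (hh'.1.1 x hx).symm)
    · rintro h ⟨h1, h2, h3⟩
      have hmem : ∀ x ∈ points C, h x ∈ points C := fun x hx => by
        have := Finset.mem_image_of_mem h hx
        rwa [← points_image, h3] at this
      have heq : ∀ x ∈ points C, (if x ∈ points C then f (h x) else ⟨0, hv⟩) = (f ∘ h) x :=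
        fun x hx => if_pos hx
      have hΦD : Φ (fun x => if x ∈ points C then f (h x) else ⟨0, hv⟩) = D := by
        rw [← hfC]
        conv_rhs => rw [← h3, Finset.image_image]
        refine (image_image_eq_of_eqOn heq).trans (image_eq_of_eqOn fun b _ => ?_)
        rw [Function.comp_apply, Finset.image_image]
      refine ⟨fun x => if x ∈ points C then f (h x) else ⟨0, hv⟩, ?_, ?_⟩
      · rw [Finset.coe_filter, Set.mem_ofPred_eq, hF, mem_embeddings]
        refine ⟨⟨fun x hx => ?_, fun x hx y hy hxy => ?_, fun b hb => ?_⟩, hΦD⟩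
        · dsimp only
          rw [if_neg hx]
        · dsimp only at hxy
          rw [heq x hx, heq y hy] at hxy
          exact h2 hx hy (hf (hmem x hx) (hmem y hy) hxy)
        · exact hDB (hΦD ▸ Finset.mem_image_of_mem _ hb)
      · funext x
        by_cases hx : x ∈ points C
        · simp only [hx, if_true]
          exact hgf _ (hmem x hx)
        · simp only [hx, if_false]
          exact (h1 x hx).symm
  have htotal : F.card = (F.image Φ).card * autCount C := by
    rw [Finset.card_eq_sum_card_image Φ F, Finset.sum_congr rfl hfiber, Finset.sum_const,
      smul_eq_mul]
  rw [hocc]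
  -- If `autCount C` were zero, the fibre over an existing image would be empty; so then there is no
  -- image and both sides are zero.
  rcases Nat.eq_zero_or_pos (autCount C) with h0 | h0
  · rw [h0, Nat.div_zero, Finset.card_eq_zero]
    refine Finset.eq_empty_of_forall_notMem fun D hD => ?_
    obtain ⟨f, hf, rfl⟩ := Finset.mem_image.1 hD
    have := hfiber _ hD
    rw [h0, Finset.card_eq_zero, Finset.filter_eq_empty_iff] at this
    exact this hf rfl
  · rw [htotal, Nat.mul_div_cancel _ h0]

/-! ### Programs for the random access machine -/

namespace RAM

/-- The instructions `L` stand at position `o` of the program. -/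
def CodeAt (P : Program) (o : ℕ) (L : List Instr) : Prop :=
  ∀ (k : ℕ) (I : Instr), L[k]? = some I → P[o + k]? = some I

theorem CodeAt.left {P : Program} {o : ℕ} {L L' : List Instr} (h : CodeAt P o (L ++ L')) :
    CodeAt P o L := fun k I hk => h k I (by
  rw [List.getElem?_append_left (List.getElem?_eq_some_iff.1 hk).1, hk])

theorem CodeAt.right {P : Program} {o : ℕ} {L L' : List Instr} (h : CodeAt P o (L ++ L')) :
    CodeAt P (o + L.length) L' := fun k I hk => by
  rw [add_assoc]
  refine h _ I ?_
  rw [List.getElem?_append_right (Nat.le_add_right _ _), Nat.add_sub_cancel_left, hk]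

/-- The machine gets from `s` to `s'` in at most `T` steps with words of at most `W` bits. -/
def Reach (P : Program) (W : ℕ) (s s' : State) (T : ℕ) : Prop :=
  ∃ t ≤ T, (step P)^[t] s = s' ∧ ∀ u ≤ t, ((step P)^[u] s).Fits W

theorem Reach.trans {P : Program} {W : ℕ} {s s' s'' : State} {T T' : ℕ}
    (h : Reach P W s s' T) (h' : Reach P W s' s'' T') : Reach P W s s'' (T + T') := by
  obtain ⟨t, ht, rfl, hfit⟩ := h
  obtain ⟨t', ht', rfl, hfit'⟩ := h'
  refine ⟨t' + t, by omega, by rw [Function.iterate_add_apply], fun u hu => ?_⟩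
  rcases Nat.le_total u t with h | h
  · exact hfit u h
  · obtain ⟨w, rfl⟩ := Nat.exists_eq_add_of_le' h
    rw [Function.iterate_add_apply]
    exact hfit' w (by omega)

theorem Reach.single {P : Program} {W : ℕ} {s s' : State} (h : step P s = s') (hs : s.Fits W)
    (hs' : s'.Fits W) : Reach P W s s' 1 := by
  refine ⟨1, le_rfl, h, fun u hu => ?_⟩
  interval_cases u
  · exact hs
  · rw [Function.iterate_one, h]
    exact hs'

theorem Reach.mono {P : Program} {W : ℕ} {s s' : State} {T T' : ℕ} (h : Reach P W s s' T)
    (hT : T ≤ T') : Reach P W s s' T' := by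
  obtain ⟨t, ht, h⟩ := h
  exact ⟨t, ht.trans hT, h⟩

/-- All registers and memory cells hold words of at most `W` bits. -/
def Small (W : ℕ) (r m : ℕ → ℕ) : Prop := (∀ i, r i < 2 ^ W) ∧ ∀ a, m a < 2 ^ W

/-- A piece of code, depending on its position. -/
abbrev Code := ℕ → List Instr

/-- Run from its first instruction with registers `r` and memory `m`, the code `c` leads to its
end with registers `r'` and memory `m'`. -/
def Runs (W : ℕ) (c : Code) (r m r' m' : ℕ → ℕ) (T : ℕ) : Prop :=
  Small W r m ∧ Small W r' m' ∧ ∀ P o, CodeAt P o (c o) →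
    Reach P W ⟨o, r, m⟩ ⟨o + (c o).length, r', m'⟩ T

/-- The code `c` followed by the code `c'`. -/
def Code.seq (c c' : Code) : Code := fun o => c o ++ c' (o + (c o).length)

/-- Repeat the code `c` until register `i` is zero. -/
def Code.loop (i : ℕ) (c : Code) : Code := fun o =>
  [.jumpZero i (o + (c (o + 1)).length + 2)] ++ (c (o + 1) ++ [.jump o])

variable {W : ℕ} {r m r' m' r'' m'' : ℕ → ℕ}

theorem Runs.seq {c c' : Code} {T T' : ℕ} (h : Runs W c r m r' m' T)
    (h' : Runs W c' r' m' r'' m'' T') : Runs W (c.seq c') r m r'' m'' (T + T') := by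
  refine ⟨h.1, h'.2.1, fun P o hP => ?_⟩
  have := (h.2.2 P o hP.left).trans (h'.2.2 P _ hP.right)
  rwa [add_assoc, ← List.length_append] at this

theorem Runs.single {I : Instr} (hI : ∀ o, I.exec ⟨o, r, m⟩ = ⟨o + 1, r', m'⟩)
    (hs : Small W r m) (hs' : Small W r' m') : Runs W (fun _ => [I]) r m r' m' 1 := by
  refine ⟨hs, hs', fun P o hP => Reach.single ?_ hs hs'⟩
  have : P[o]? = some I := hP 0 I rfl
  rw [step, this]
  exact hI o

/-- The number of remaining passes is the value of register `i`. A pass costs the body and two jump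
instructions; the additional step is the last test. -/
theorem Runs.loop {i : ℕ} {c : Code} {T : ℕ} (Inv : ℕ → (ℕ → ℕ) → (ℕ → ℕ) → Prop)
    (hcount : ∀ k r m, Inv k r m → r i = k) (hsmall : ∀ k r m, Inv k r m → Small W r m)
    (hbody : ∀ k r m, Inv (k + 1) r m → ∃ r' m', Runs W c r m r' m' T ∧ Inv k r' m') :
    ∀ k r m, Inv k r m →
      ∃ r' m', Runs W (Code.loop i c) r m r' m' (k * (T + 2) + 1) ∧ Inv 0 r' m' := by
  have hlen : ∀ o, o + (Code.loop i c o).length = o + (c (o + 1)).length + 2 := by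
    intro o
    simp only [Code.loop, List.length_append, List.length_singleton]
    omega
  intro k
  induction k with
  | zero =>
    intro r m h
    have hs := hsmall 0 r m h
    refine ⟨r, m, ⟨hs, hs, fun P o hP => ?_⟩, h⟩
    rw [Nat.zero_mul, Nat.zero_add]
    refine Reach.single ?_ hs hs
    have h0 : P[o]? = some _ := hP.left 0 _ rfl
    rw [step, h0, hlen]
    simp only [Instr.exec, hcount 0 r m h, if_true]
  | succ k ih =>
    intro r m h
    obtain ⟨r₁, m₁, hrun, hinv⟩ := hbody k r m h
    obtain ⟨r₂, m₂, hrun₂, hinv₂⟩ := ih r₁ m₁ hinv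
    refine ⟨r₂, m₂, ⟨hrun.1, hrun₂.2.1, fun P o hP => ?_⟩, hinv₂⟩
    have h0 : P[o]? = some _ := hP.left 0 _ rfl
    have h1 : Reach P W ⟨o, r, m⟩ ⟨o + 1, r, m⟩ 1 := by
      refine Reach.single ?_ hrun.1 hrun.1
      rw [step, h0]
      simp [Instr.exec, hcount (k + 1) r m h]
    have h2 := hrun.2.2 P (o + 1) hP.right.left
    have hj : P[o + 1 + (c (o + 1)).length]? = some _ := hP.right.right 0 _ rfl
    have h3 : Reach P W ⟨o + 1 + (c (o + 1)).length, r₁, m₁⟩ ⟨o, r₁, m₁⟩ 1 := by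
      refine Reach.single ?_ hrun.2.1 hrun.2.1
      rw [step, hj]
      rfl
    exact (((h1.trans h2).trans h3).trans (hrun₂.2.2 P o hP)).mono (by
      rw [Nat.succ_mul]; omega)

theorem Small.update_reg (h : Small W r m) {i x : ℕ} (hx : x < 2 ^ W) :
    Small W (Function.update r i x) m := by
  refine ⟨fun j => ?_, h.2⟩
  rw [Function.update_apply]
  split
  · exact hx
  · exact h.1 j

theorem Small.update_mem (h : Small W r m) {i x : ℕ} (hx : x < 2 ^ W) :
    Small W r (Function.update m i x) := by
  refine ⟨h.1, fun j => ?_⟩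
  rw [Function.update_apply]
  split
  · exact hx
  · exact h.2 j

end RAM

/-! ### Compilation of expressions -/

namespace Expr

open RAM

/-- Code that computes an expression in register `t`, using registers from `t` on. -/
def compile (t : ℕ) : Expr → Code
  | reg k => fun _ => [.copy t k]
  | const n => fun _ => [.const t n]
  | add a b => ((a.compile t).seq (b.compile (t + 1))).seq fun _ => [.add t t (t + 1)]
  | sub a b => ((a.compile t).seq (b.compile (t + 1))).seq fun _ => [.sub t t (t + 1)]
  | mul a b => ((a.compile t).seq (b.compile (t + 1))).seq fun _ => [.mul t t (t + 1)]
  | div a b => ((a.compile t).seq (b.compile (t + 1))).seq fun _ => [.div t t (t + 1)]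
  | load a => (a.compile t).seq fun _ => [.load t t]

/-- The number of instructions in the code of an expression. -/
def cost : Expr → ℕ
  | reg _ => 1
  | const _ => 1
  | add a b => a.cost + b.cost + 1
  | sub a b => a.cost + b.cost + 1
  | mul a b => a.cost + b.cost + 1
  | div a b => a.cost + b.cost + 1
  | load a => a.cost + 1

/-- The values of an expression and of its parts have at most `W` bits. -/
def IsSmall (W : ℕ) (r : Fin 3 → ℕ) (m : ℕ → ℕ) : Expr → Prop
  | reg k => r k < 2 ^ W
  | const n => n < 2 ^ W
  | add a b => a.IsSmall W r m ∧ b.IsSmall W r m ∧ a.eval r m + b.eval r m < 2 ^ W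
  | sub a b => a.IsSmall W r m ∧ b.IsSmall W r m ∧ a.eval r m - b.eval r m < 2 ^ W
  | mul a b => a.IsSmall W r m ∧ b.IsSmall W r m ∧ a.eval r m * b.eval r m < 2 ^ W
  | div a b => a.IsSmall W r m ∧ b.IsSmall W r m ∧ a.eval r m / b.eval r m < 2 ^ W
  | load a => a.IsSmall W r m ∧ m (a.eval r m) < 2 ^ W

/-- A bound for the degree of the growth of an expression. -/
def deg : Expr → ℕ
  | reg _ => 1
  | const n => n + 1
  | add a b => a.deg + b.deg
  | sub a b => a.deg + b.deg
  | mul a b => a.deg + b.deg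
  | div a b => a.deg + b.deg
  | load a => a.deg

theorem one_le_deg (e : Expr) : 1 ≤ e.deg := by
  induction e <;> simp only [deg] <;> omega

/-- All degrees are positive and `X` is at least `2`, so both parts are bounded by powers of size at
least `2`, and a sum is bounded by the product of these powers. -/
theorem eval_le {r : Fin 3 → ℕ} {m : ℕ → ℕ} {X : ℕ} (hX : 2 ≤ X) (hr : ∀ k, r k ≤ X)
    (hm : ∀ a, m a ≤ X) (e : Expr) : e.eval r m ≤ X ^ e.deg := by
  have hpow : ∀ e : Expr, 2 ≤ X ^ e.deg := fun e =>
    hX.trans (Nat.le_self_pow (by have := e.one_le_deg; omega) X)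
  induction e with
  | reg k => simpa [eval, deg] using hr k
  | const n =>
    rw [eval, deg]
    calc n ≤ 2 ^ (n + 1) := Nat.lt_two_pow_self.le.trans (Nat.pow_le_pow_right (by norm_num) n.le_succ)
      _ ≤ X ^ (n + 1) := Nat.pow_le_pow_left hX _
  | add a b iha ihb =>
    rw [eval, deg, pow_add]
    have h1 := hpow a
    have h2 := hpow b
    nlinarith
  | sub a b iha ihb =>
    rw [eval, deg, pow_add]
    have h2 := hpow b
    exact (Nat.sub_le _ _).trans (iha.trans (Nat.le_mul_of_pos_right _ (by omega)))
  | mul a b iha ihb =>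
    rw [eval, deg, pow_add]
    exact Nat.mul_le_mul iha ihb
  | div a b iha ihb =>
    rw [eval, deg, pow_add]
    have h2 := hpow b
    exact (Nat.div_le_self _ _).trans (iha.trans (Nat.le_mul_of_pos_right _ (by omega)))
  | load a _ =>
    rw [eval, deg]
    exact (hm _).trans (Nat.le_self_pow (by have := a.one_le_deg; omega) X)

theorem isSmall_of_le {r : Fin 3 → ℕ} {m : ℕ → ℕ} {X W : ℕ} (hX : 2 ≤ X) (hr : ∀ k, r k ≤ X)
    (hm : ∀ a, m a ≤ X) (e : Expr) (he : X ^ e.deg < 2 ^ W) : e.IsSmall W r m := by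
  have heval := fun e => eval_le hX hr hm e
  have hleft : ∀ a b : Expr, X ^ (a.deg + b.deg) < 2 ^ W → X ^ a.deg < 2 ^ W := fun a b h =>
    (Nat.pow_le_pow_right (by omega) (Nat.le_add_right _ _)).trans_lt h
  have hright : ∀ a b : Expr, X ^ (a.deg + b.deg) < 2 ^ W → X ^ b.deg < 2 ^ W := fun a b h =>
    (Nat.pow_le_pow_right (by omega) (Nat.le_add_left _ _)).trans_lt h
  induction e with
  | reg k => exact (heval (reg k)).trans_lt he
  | const n => exact (heval (const n)).trans_lt he
  | add a b iha ihb =>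
    exact ⟨iha (hleft a b he), ihb (hright a b he), (heval (add a b)).trans_lt he⟩
  | sub a b iha ihb =>
    exact ⟨iha (hleft a b he), ihb (hright a b he), (heval (sub a b)).trans_lt he⟩
  | mul a b iha ihb =>
    exact ⟨iha (hleft a b he), ihb (hright a b he), (heval (mul a b)).trans_lt he⟩
  | div a b iha ihb =>
    exact ⟨iha (hleft a b he), ihb (hright a b he), (heval (div a b)).trans_lt he⟩
  | load a iha => exact ⟨iha he, (heval (load a)).trans_lt he⟩

/-- The registers that expressions can read. -/
def inputs (r : ℕ → ℕ) : Fin 3 → ℕ := fun k => r k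

theorem inputs_congr {r r' : ℕ → ℕ} {t : ℕ} (ht : 3 ≤ t) (h : ∀ j < t, r' j = r j) :
    inputs r' = inputs r := funext fun k => h k (by omega)

theorem runs_binary {W : ℕ} {op : ℕ → ℕ → ℕ → Instr} {f : ℕ → ℕ → ℕ}
    (hop : ∀ o r m i j k, (op i j k).exec ⟨o, r, m⟩ =
      ⟨o + 1, Function.update r i (f (r j) (r k)), m⟩) {c c' : Code} {T T' x y t : ℕ}
    {r m r₁ r₂ : ℕ → ℕ} (h₁ : Runs W c r m r₁ m T) (h₂ : Runs W c' r₁ m r₂ m T')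
    (hx : r₁ t = x) (hy : r₂ (t + 1) = y) (hr₁ : ∀ j < t, r₁ j = r j)
    (hr₂ : ∀ j < t + 1, r₂ j = r₁ j) (hxy : f x y < 2 ^ W) :
    ∃ r', Runs W ((c.seq c').seq fun _ => [op t t (t + 1)]) r m r' m (T + T' + 1) ∧
      r' t = f x y ∧ ∀ j < t, r' j = r j := by
  refine ⟨Function.update r₂ t (f x y), (h₁.seq h₂).seq (Runs.single (fun o => ?_) h₂.2.1
    (h₂.2.1.update_reg hxy)), Function.update_self _ _ _, fun j hj => ?_⟩
  · rw [hop, hr₂ t (by omega), hx, hy]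
  · rw [Function.update_of_ne (by omega), hr₂ j (by omega), hr₁ j hj]

/-- Stack discipline, with the target register general in the induction: the left operand waits in
register `t` while the right one uses registers from `t + 1` on. The three inputs lie below `t` and
survive. -/
theorem runs_compile {W : ℕ} {m : ℕ → ℕ} (e : Expr) : ∀ {t : ℕ} {r : ℕ → ℕ}, 3 ≤ t →
    Small W r m → e.IsSmall W (inputs r) m →
    ∃ r', Runs W (e.compile t) r m r' m e.cost ∧ r' t = e.eval (inputs r) m ∧
      ∀ j < t, r' j = r j := by
  have two : ∀ {a b : Expr} {t : ℕ} {r : ℕ → ℕ}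
      (_ : ∀ {t : ℕ} {r : ℕ → ℕ}, 3 ≤ t → Small W r m → a.IsSmall W (inputs r) m →
        ∃ r', Runs W (a.compile t) r m r' m a.cost ∧ r' t = a.eval (inputs r) m ∧
          ∀ j < t, r' j = r j)
      (_ : ∀ {t : ℕ} {r : ℕ → ℕ}, 3 ≤ t → Small W r m → b.IsSmall W (inputs r) m →
        ∃ r', Runs W (b.compile t) r m r' m b.cost ∧ r' t = b.eval (inputs r) m ∧
          ∀ j < t, r' j = r j) (_ : 3 ≤ t) (_ : Small W r m) (_ : a.IsSmall W (inputs r) m)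
      (_ : b.IsSmall W (inputs r) m), ∃ r₁ r₂, Runs W (a.compile t) r m r₁ m a.cost ∧
        Runs W (b.compile (t + 1)) r₁ m r₂ m b.cost ∧ r₁ t = a.eval (inputs r) m ∧
        r₂ (t + 1) = b.eval (inputs r) m ∧ (∀ j < t, r₁ j = r j) ∧ ∀ j < t + 1, r₂ j = r₁ j := by
    intro a b t r iha ihb ht hs ha hb
    obtain ⟨r₁, h₁, hx, hr₁⟩ := iha ht hs ha
    have hin := inputs_congr ht hr₁
    obtain ⟨r₂, h₂, hy, hr₂⟩ := ihb (t := t + 1) (by omega) h₁.2.1 (hin ▸ hb)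
    exact ⟨r₁, r₂, h₁, h₂, hx, hin ▸ hy, hr₁, hr₂⟩
  induction e with
  | reg k =>
    intro t r ht hs he
    exact ⟨_, Runs.single (fun o => rfl) hs (hs.update_reg he), Function.update_self _ _ _,
      fun j hj => Function.update_of_ne (by omega) _ _⟩
  | const n =>
    intro t r ht hs he
    exact ⟨_, Runs.single (fun o => rfl) hs (hs.update_reg he), Function.update_self _ _ _,
      fun j hj => Function.update_of_ne (by omega) _ _⟩
  | add a b iha ihb =>
    intro t r ht hs he
    obtain ⟨r₁, r₂, h₁, h₂, hx, hy, hr₁, hr₂⟩ := two iha ihb ht hs he.1 he.2.1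
    exact runs_binary (fun _ _ _ _ _ _ => rfl) h₁ h₂ hx hy hr₁ hr₂ he.2.2
  | sub a b iha ihb =>
    intro t r ht hs he
    obtain ⟨r₁, r₂, h₁, h₂, hx, hy, hr₁, hr₂⟩ := two iha ihb ht hs he.1 he.2.1
    exact runs_binary (fun _ _ _ _ _ _ => rfl) h₁ h₂ hx hy hr₁ hr₂ he.2.2
  | mul a b iha ihb =>
    intro t r ht hs he
    obtain ⟨r₁, r₂, h₁, h₂, hx, hy, hr₁, hr₂⟩ := two iha ihb ht hs he.1 he.2.1
    exact runs_binary (fun _ _ _ _ _ _ => rfl) h₁ h₂ hx hy hr₁ hr₂ he.2.2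
  | div a b iha ihb =>
    intro t r ht hs he
    obtain ⟨r₁, r₂, h₁, h₂, hx, hy, hr₁, hr₂⟩ := two iha ihb ht hs he.1 he.2.1
    exact runs_binary (fun _ _ _ _ _ _ => rfl) h₁ h₂ hx hy hr₁ hr₂ he.2.2
  | load a iha =>
    intro t r ht hs he
    obtain ⟨r₁, h₁, hx, hr₁⟩ := iha ht hs he.1
    refine ⟨Function.update r₁ t (m (a.eval (inputs r) m)),
      h₁.seq (Runs.single (fun o => ?_) h₁.2.1 (h₁.2.1.update_reg he.2)),
      Function.update_self _ _ _, fun j hj => ?_⟩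
    · rw [← hx]
      rfl
    · rw [Function.update_of_ne (by omega), hr₁ j hj]

end Expr

/-! ### Assignments and stores -/

namespace RAM

open Expr

/-- Code for the assignment of the value of `e` to register `i`. Registers from `5` on are
auxiliary. -/
def assign (i : ℕ) (e : Expr) : Code := (e.compile 5).seq fun _ => [.copy i 5]

/-- Code for the addition of the value of `e` to register `i`. -/
def increase (i : ℕ) (e : Expr) : Code := (e.compile 5).seq fun _ => [.add i i 5]

/-- Code that stores the value of `b` at the address `a`. -/
def storeAt (a b : Expr) : Code :=
  ((a.compile 5).seq (b.compile 6)).seq fun _ => [.store 5 6]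

variable {W : ℕ} {r m : ℕ → ℕ}

theorem runs_assign {i : ℕ} {e : Expr} (hs : Small W r m) (he : e.IsSmall W (inputs r) m) :
    ∃ r', Runs W (assign i e) r m r' m (e.cost + 1) ∧ r' i = e.eval (inputs r) m ∧
      ∀ j < 5, j ≠ i → r' j = r j := by
  obtain ⟨r₁, h₁, hx, hr₁⟩ := runs_compile e (t := 5) (by norm_num) hs he
  refine ⟨Function.update r₁ i (r₁ 5), h₁.seq (Runs.single (fun o => rfl) h₁.2.1
    (h₁.2.1.update_reg (h₁.2.1.1 5))), ?_, fun j hj hji => ?_⟩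
  · rw [Function.update_self, hx]
  · rw [Function.update_of_ne hji, hr₁ j hj]

theorem runs_increase {i : ℕ} {e : Expr} (hi : i < 5) (hs : Small W r m)
    (he : e.IsSmall W (inputs r) m) (hsum : r i + e.eval (inputs r) m < 2 ^ W) :
    ∃ r', Runs W (increase i e) r m r' m (e.cost + 1) ∧ r' i = r i + e.eval (inputs r) m ∧
      ∀ j < 5, j ≠ i → r' j = r j := by
  obtain ⟨r₁, h₁, hx, hr₁⟩ := runs_compile e (t := 5) (by norm_num) hs he
  refine ⟨Function.update r₁ i (r i + e.eval (inputs r) m), h₁.seq (Runs.single (fun o => ?_)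
    h₁.2.1 (h₁.2.1.update_reg hsum)), Function.update_self _ _ _, fun j hj hji => ?_⟩
  · rw [← hx, ← hr₁ i hi]
    rfl
  · rw [Function.update_of_ne hji, hr₁ j hj]

theorem runs_storeAt {a b : Expr} (hs : Small W r m) (ha : a.IsSmall W (inputs r) m)
    (hb : b.IsSmall W (inputs r) m) :
    ∃ r', Runs W (storeAt a b) r m r'
      (Function.update m (a.eval (inputs r) m) (b.eval (inputs r) m)) (a.cost + b.cost + 1) ∧
      ∀ j < 5, r' j = r j := by
  obtain ⟨r₁, h₁, hx, hr₁⟩ := runs_compile a (t := 5) (by norm_num) hs ha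
  have hin := inputs_congr (by norm_num) hr₁
  obtain ⟨r₂, h₂, hy, hr₂⟩ := runs_compile b (t := 6) (by norm_num) h₁.2.1 (hin ▸ hb)
  rw [hin] at hy
  refine ⟨r₂, (h₁.seq h₂).seq (Runs.single (fun o => ?_) h₂.2.1 (h₂.2.1.update_mem ?_)),
    fun j hj => ?_⟩
  · rw [← hx, ← hy, ← hr₂ 5 (by norm_num)]
    rfl
  · rw [← hy]
    exact h₂.2.1.1 6
  · rw [hr₂ j (by omega), hr₁ j hj]

end RAM

/-! ### The third point of a block -/

/-- Uniqueness of the block through `x` and `y`; size three excludes that `z` coincides with either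
of them. -/
theorem IsSTS.third_unique {v : ℕ} {B : Finset (Finset (Fin v))} (hB : IsSTS B)
    {x y z z' : Fin v} (hxy : x ≠ y) (hz : {x, y, z} ∈ B) (hz' : {x, y, z'} ∈ B) : z = z' := by
  have heq : ({x, y, z} : Finset (Fin v)) = {x, y, z'} :=
    (hB.2.2 x y hxy).unique ⟨hz, by simp, by simp⟩ ⟨hz', by simp, by simp⟩
  have hmem : z ∈ ({x, y, z'} : Finset (Fin v)) := heq ▸ by simp
  have h3 := hB.2.1 _ hz
  simp only [Finset.mem_insert, Finset.mem_singleton] at hmem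
  rcases hmem with rfl | rfl | h
  · have := Finset.card_le_two (a := z) (b := y)
    rw [show ({z, y, z} : Finset (Fin v)) = {z, y} by ext; simp; tauto] at h3
    omega
  · have := Finset.card_le_two (a := x) (b := z)
    rw [show ({x, z, z} : Finset (Fin v)) = {x, z} by ext; simp] at h3
    omega
  · exact h

/-! ### The input -/

/-- The numbers that make up a list of triples. -/
def entries {v : ℕ} (l : List (Fin v × Fin v × Fin v)) : List ℕ :=
  l.flatMap fun t => [(t.1 : ℕ), (t.2.1 : ℕ), (t.2.2 : ℕ)]

theorem entries_getD {v : ℕ} (l : List (Fin v × Fin v × Fin v)) {j : ℕ} (hj : j < l.length)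
    (i : Fin 3) : (entries l).getD (3 * j + i) 0 = ![l[j].1, l[j].2.1, l[j].2.2] i := by
  induction l generalizing j with
  | nil => exact absurd hj (Nat.not_lt_zero _)
  | cons t l ih =>
    have hcons : entries (t :: l) = [(t.1 : ℕ), (t.2.1 : ℕ), (t.2.2 : ℕ)] ++ entries l := rfl
    rw [hcons]
    cases j with
    | zero => fin_cases i <;> rfl
    | succ j =>
      rw [List.getD_append_right _ _ _ _ (by simp only [List.length_cons, List.length_nil]; omega)]
      have := ih (j := j) (by simpa using hj)
      simpa [Nat.mul_succ, Nat.add_right_comm] using this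

theorem entries_getD_lt {v : ℕ} (hv : 0 < v) (l : List (Fin v × Fin v × Fin v)) (a : ℕ) :
    (entries l).getD a 0 < v := by
  rcases Nat.lt_or_ge a (entries l).length with ha | ha
  · rw [List.getD_eq_getElem _ _ ha]
    have := List.getElem_mem ha
    obtain ⟨t, -, ht⟩ := List.mem_flatMap.1 this
    simp only [List.mem_cons, List.not_mem_nil, or_false] at ht
    rcases ht with h | h | h <;> rw [h] <;> exact Fin.is_lt _
  · rw [List.getD_eq_default _ _ ha]
    exact hv

theorem IsListing.length_le {v : ℕ} {l : List (Fin v × Fin v × Fin v)}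
    {B : Finset (Finset (Fin v))} (hl : IsListing l B) : l.length ≤ v ^ 3 := by
  have := (List.Nodup.of_map _ hl.1).length_le_card
  simp only [Fintype.card_prod, Fintype.card_fin] at this
  calc l.length ≤ v * (v * v) := this
    _ = v ^ 3 := by ring

/-! ### Construction of the table -/

/-- In memory `m`, the table from address `base` on is correct for the pairs in `D`, all entries
are points, and below `base` the memory agrees with `m₀`. -/
def IsPartialTable {v : ℕ} (B : Finset (Finset (Fin v))) (base : ℕ) (m₀ : ℕ → ℕ)
    (D : Fin v → Fin v → Prop) (m : ℕ → ℕ) : Prop :=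
  (∀ a, m a < v) ∧ (∀ a < base, m a = m₀ a) ∧
    ∀ x y z : Fin v, x ≠ y → {x, y, z} ∈ B → D x y → m (base + (x * v + y)) = z

theorem IsPartialTable.update {v : ℕ} {B : Finset (Finset (Fin v))} (hB : IsSTS B) {base : ℕ}
    {m₀ m : ℕ → ℕ} {D : Fin v → Fin v → Prop} (h : IsPartialTable B base m₀ D m) {x y z : Fin v}
    (hxy : x ≠ y) (hz : {x, y, z} ∈ B) :
    IsPartialTable B base m₀ (fun x' y' => D x' y' ∨ x' = x ∧ y' = y)
      (Function.update m (base + (x * v + y)) z) := by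
  refine ⟨fun a => ?_, fun a ha => ?_, fun x' y' z' hxy' hz' hD => ?_⟩
  · rw [Function.update_apply]
    split
    · exact z.is_lt
    · exact h.1 a
  · rw [Function.update_of_ne (by omega), h.2.1 a ha]
  · by_cases heq : x' = x ∧ y' = y
    · obtain ⟨rfl, rfl⟩ := heq
      rw [Function.update_self, hB.third_unique hxy hz hz']
    · rw [Function.update_of_ne, h.2.2 x' y' z' hxy' hz' (hD.resolve_right heq)]
      -- The address offset `x * v + y` determines the pair, by division with remainder by `v`.
      intro hadd
      have hadd : (x' : ℕ) * v + y' = x * v + y := Nat.add_left_cancel hadd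
      have hv : 0 < v := x.pos
      have hdiv := congrArg (· / v) hadd
      have hmod := congrArg (· % v) hadd
      simp only [Nat.mul_add_mod', Nat.mod_eq_of_lt (Fin.is_lt _)] at hmod
      simp only [Nat.add_comm (_ * v), Nat.add_mul_div_right _ _ hv,
        Nat.div_eq_of_lt (Fin.is_lt _), Nat.zero_add] at hdiv
      exact heq ⟨Fin.ext hdiv, Fin.ext hmod⟩

namespace RAM

open Expr

theorem inputs_eq {r : ℕ → ℕ} {a b c : ℕ} (h0 : r 0 = a) (h1 : r 1 = b) (h2 : r 2 = c) :
    inputs r = ![a, b, c] := by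
  funext k
  fin_cases k <;> assumption

/-- A point of the block whose number is in register `1`. -/
def pointExpr (i : Fin 3) : Expr := load (add (mul (const 3) (reg 1)) (const i))

/-- The address of a pair of points of the block whose number is in register `1`. -/
def pairExpr (i j : Fin 3) : Expr :=
  add (reg 2) (add (mul (pointExpr i) (reg 0)) (pointExpr j))

/-- Code that enters the third points of pairs of points of a block into the table. -/
def storePairs : List (Fin 3 × Fin 3 × Fin 3) → Code
  | [] => fun _ => []
  | s :: S => (storeAt (pairExpr s.1 s.2.1) (pointExpr s.2.2)).seq (storePairs S)

/-- The number of steps of `storePairs`. -/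
def storePairsCost : List (Fin 3 × Fin 3 × Fin 3) → ℕ
  | [] => 0
  | s :: S => (pairExpr s.1 s.2.1).cost + (pointExpr s.2.2).cost + 1 + storePairsCost S

section

variable {W X d v j base : ℕ} {B : Finset (Finset (Fin v))} {m₀ : ℕ → ℕ}

/-- The table starts behind the input, so the block being read is never overwritten. The bound `18`
covers the address of a pair: `1 + (8 + 1 + 8)`, with at most `8` for each point. -/
theorem runs_storePairs (hB : IsSTS B) (hX : 2 ≤ X) (hd : 18 ≤ d) (hXW : X ^ d < 2 ^ W)
    (hvX : v ≤ X) (hjX : j ≤ X) (hbX : base ≤ X) (hj : 3 * j + 3 ≤ base) {p : Fin 3 → Fin v}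
    (hp : ∀ i : Fin 3, m₀ (3 * j + i) = p i) (S : List (Fin 3 × Fin 3 × Fin 3)) :
    ∀ (r m : ℕ → ℕ) (D : Fin v → Fin v → Prop),
    (∀ s ∈ S, p s.1 ≠ p s.2.1 ∧ {p s.1, p s.2.1, p s.2.2} ∈ B) →
    Small W r m → r 0 = v → r 1 = j → r 2 = base → IsPartialTable B base m₀ D m →
    ∃ r' m', Runs W (storePairs S) r m r' m' (storePairsCost S) ∧ (∀ i < 5, r' i = r i) ∧
      IsPartialTable B base m₀ (fun x y => D x y ∨ ∃ s ∈ S, x = p s.1 ∧ y = p s.2.1) m' := by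
  induction S with
  | nil =>
    intro r m D _ hs _ _ _ hm
    exact ⟨r, m, ⟨hs, hs, fun P o _ => ⟨0, le_rfl, rfl, fun u hu => by
      rw [Nat.le_zero.1 hu]; exact hs⟩⟩, fun _ _ => rfl, by simpa using hm⟩
  | cons s S ih =>
    intro r m D hS hs h0 h1 h2 hm
    have hin := inputs_eq h0 h1 h2
    have hsmall : ∀ e : Expr, e.deg ≤ 18 → e.IsSmall W (inputs r) m := by
      intro e he
      refine isSmall_of_le hX ?_ (fun a => (hm.1 a).le.trans hvX) e
        ((Nat.pow_le_pow_right (by omega) (he.trans hd)).trans_lt hXW)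
      rw [hin]
      intro k
      fin_cases k <;> assumption
    have hpt : ∀ i : Fin 3, (pointExpr i).eval (inputs r) m = p i := by
      intro i
      rw [hin, ← hp i, ← hm.2.1 _ (by omega)]
      rfl
    have hpair : ∀ i i' : Fin 3, (pairExpr i i').eval (inputs r) m = base + (p i * v + p i') := by
      intro i i'
      rw [← hpt i, ← hpt i', hin]
      rfl
    have hdeg : ∀ i : Fin 3, (pointExpr i).deg ≤ 8 := by
      intro i
      simp only [pointExpr, deg]
      omega
    obtain ⟨r₁, hrun, hr₁⟩ := runs_storeAt hs
      (hsmall (pairExpr s.1 s.2.1) (by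
        have := hdeg s.1
        have := hdeg s.2.1
        simp only [pairExpr, deg]
        omega))
      (hsmall (pointExpr s.2.2) ((hdeg _).trans (by norm_num)))
    rw [hpt, hpair] at hrun
    obtain ⟨hne, hmem⟩ := hS s List.mem_cons_self
    obtain ⟨r₂, m₂, hrun₂, hr₂, hm₂⟩ := ih r₁ _ _ (fun s hs => hS s (List.mem_cons_of_mem _ hs))
      hrun.2.1 ((hr₁ 0 (by norm_num)).trans h0) ((hr₁ 1 (by norm_num)).trans h1)
      ((hr₁ 2 (by norm_num)).trans h2) (hm.update hB hne hmem)
    refine ⟨r₂, m₂, hrun.seq hrun₂, fun i hi => (hr₂ i hi).trans (hr₁ i hi),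
      hm₂.1, hm₂.2.1, fun x y z hxy hz hD => hm₂.2.2 x y z hxy hz ?_⟩
    simp only [List.mem_cons, exists_eq_or_imp] at hD
    tauto

/-- All ordered pairs of positions in a block, each with the remaining position. -/
def positionPairs : List (Fin 3 × Fin 3 × Fin 3) :=
  [(0, 1, 2), (1, 0, 2), (0, 2, 1), (2, 0, 1), (1, 2, 0), (2, 1, 0)]

/-- Code that subtracts `1` from the counter in register `1`. -/
def countDown : Code := assign 1 (sub (reg 1) (const 1))

theorem runs_countDown {r m : ℕ → ℕ} {k : ℕ} (hW : 1 < 2 ^ W) (hs : Small W r m)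
    (h : r 1 = k + 1) :
    ∃ r', Runs W countDown r m r' m 4 ∧ r' 1 = k ∧ ∀ j < 5, j ≠ 1 → r' j = r j := by
  obtain ⟨r', hrun, h1, hr'⟩ := runs_assign (i := 1) (e := sub (reg 1) (const 1)) hs
    ⟨hs.1 1, hW, (Nat.sub_le _ _).trans_lt (hs.1 1)⟩
  exact ⟨r', hrun, h1.trans (by simp [eval, inputs, h]), hr'⟩

/-- Code that builds the table of third points. -/
def buildTable : Code := Code.loop 1 (countDown.seq (storePairs positionPairs))

theorem runs_buildTable (hB : IsSTS B) {l : List (Fin v × Fin v × Fin v)} (hl : IsListing l B)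
    (hX : 2 ≤ X) (hd : 18 ≤ d) (hXW : X ^ d < 2 ^ W) (hvX : v ≤ X)
    (hbX : 3 * l.length ≤ X) {r m : ℕ → ℕ} (hs : Small W r m) (h0 : r 0 = v)
    (h1 : r 1 = l.length) (h2 : r 2 = 3 * l.length) (hr : ∀ i < 5, 3 ≤ i → r i = 0)
    (hm : m = fun a => (entries l).getD a 0) :
    ∃ r' m', Runs W buildTable r m r' m' (l.length * (4 + storePairsCost positionPairs + 2) + 1) ∧
      r' 0 = v ∧ r' 1 = 0 ∧ r' 2 = 3 * l.length ∧ (∀ i < 5, 3 ≤ i → r' i = 0) ∧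
      IsTable B (3 * l.length) m' := by
  have hv : 0 < v := Fin.pos_iff_nonempty.2 hB.1
  -- The counter runs downwards, so with counter `k` the blocks numbered `k` and above have been
  -- entered.
  set D : ℕ → Fin v → Fin v → Prop := fun k x y =>
    ∃ (i : ℕ) (hi : i < l.length), k ≤ i ∧ ∃ s ∈ positionPairs,
      x = ![l[i].1, l[i].2.1, l[i].2.2] s.1 ∧ y = ![l[i].1, l[i].2.1, l[i].2.2] s.2.1 with hD
  have hW : 1 < 2 ^ W := (Nat.one_le_pow _ _ (by omega)).trans_lt hXW
  have hblock : ∀ (i : ℕ) (hi : i < l.length), {l[i].1, l[i].2.1, l[i].2.2} ∈ B := by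
    intro i hi
    rw [← hl.2, List.mem_toFinset]
    exact List.mem_map.2 ⟨l[i], List.getElem_mem hi, rfl⟩
  obtain ⟨r', m', hrun, hk, -, -, h0', -, h2', hr', hm'⟩ :=
    Runs.loop (W := W) (i := 1) (c := countDown.seq (storePairs positionPairs))
    (T := 4 + storePairsCost positionPairs)
    (fun k r m => r 1 = k ∧ k ≤ l.length ∧ Small W r m ∧ r 0 = v ∧ r 1 = k ∧ r 2 = 3 * l.length ∧
      (∀ i < 5, 3 ≤ i → r i = 0) ∧
      IsPartialTable B (3 * l.length) (fun a => (entries l).getD a 0) (D k) m)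
    (fun k r m h => h.1) (fun k r m h => h.2.2.1) (by
      rintro k r m ⟨-, hk, hs, h0, h1, h2, hr, hm⟩
      obtain ⟨r₁, hrun, h1', hr₁⟩ := runs_countDown hW hs h1
      have hblk := hblock k hk
      have hcard := hB.2.1 _ hblk
      obtain ⟨r₂, m₂, hrun₂, hr₂, hm₂⟩ := runs_storePairs hB hX hd hXW hvX (j := k) (by omega) hbX
        (by omega) (p := ![l[k].1, l[k].2.1, l[k].2.2]) (entries_getD l hk)
        positionPairs r₁ m (D (k + 1)) (by
          have h01 : l[k].1 ≠ l[k].2.1 := by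
            intro h
            rw [h, Finset.insert_eq_of_mem (by simp)] at hcard
            exact absurd (hcard ▸ Finset.card_le_two) (by norm_num)
          have h02 : l[k].1 ≠ l[k].2.2 := by
            intro h
            rw [h, Finset.insert_eq_of_mem (by simp)] at hcard
            exact absurd (hcard ▸ Finset.card_le_two) (by norm_num)
          have h12 : l[k].2.1 ≠ l[k].2.2 := by
            intro h
            rw [h, Finset.insert_eq_of_mem (a := l[k].2.2) (by simp)] at hcard
            exact absurd (hcard ▸ Finset.card_le_two) (by norm_num)
          have hperm : ∀ {x y z : Fin v}, {x, y, z} = ({l[k].1, l[k].2.1, l[k].2.2} : Finset _) →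
            {x, y, z} ∈ B := fun h => h ▸ hblk
          intro s hs
          simp only [positionPairs, List.mem_cons, List.not_mem_nil, or_false] at hs
          rcases hs with rfl | rfl | rfl | rfl | rfl | rfl
          · exact ⟨h01, hblk⟩
          · exact ⟨h01.symm, hperm (by ext; simp; tauto)⟩
          · exact ⟨h02, hperm (by ext; simp; tauto)⟩
          · exact ⟨h02.symm, hperm (by ext; simp; tauto)⟩
          · exact ⟨h12, hperm (by ext; simp; tauto)⟩
          · exact ⟨h12.symm, hperm (by ext; simp; tauto)⟩)
        hrun.2.1 ((hr₁ 0 (by norm_num) (by norm_num)).trans h0) h1'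
        ((hr₁ 2 (by norm_num) (by norm_num)).trans h2) hm
      have hr₂₁ : ∀ i < 5, i ≠ 1 → r₂ i = r i := fun i hi hi1 => (hr₂ i hi).trans (hr₁ i hi hi1)
      have h1'' := (hr₂ 1 (by norm_num)).trans h1'
      refine ⟨r₂, m₂, hrun.seq hrun₂, h1'', by omega, hrun₂.2.1,
        (hr₂₁ 0 (by norm_num) (by norm_num)).trans h0, h1'',
        (hr₂₁ 2 (by norm_num) (by norm_num)).trans h2,
        fun i hi hi3 => (hr₂₁ i hi (by omega)).trans (hr i hi hi3), hm₂.1, hm₂.2.1,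
        fun x y z hxy hz hxyD => hm₂.2.2 x y z hxy hz ?_⟩
      obtain ⟨i, hi, hki, hsi⟩ := hxyD
      rcases hki.eq_or_lt with rfl | hki
      · exact Or.inr hsi
      · exact Or.inl ⟨i, hi, hki, hsi⟩)
    l.length r m ⟨h1, le_rfl, hs, h0, h1, h2, hr, by
      refine ⟨fun a => hm ▸ entries_getD_lt hv l a, fun a _ => by rw [hm], ?_⟩
      rintro x y z - - ⟨i, hi, hli, -⟩
      omega⟩
  refine ⟨r', m', hrun, h0', hk, h2', hr', hm'.1, fun x y z hxy hz => hm'.2.2 x y z hxy hz ?_⟩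
  -- Every pair of distinct points of a block is among its six ordered pairs of positions, so all
  -- pairs are covered once all blocks are entered.
  have hz' := hz
  rw [← hl.2, List.mem_toFinset] at hz'
  obtain ⟨t, ht, heq⟩ := List.mem_map.1 hz'
  obtain ⟨i, hi, rfl⟩ := List.getElem_of_mem ht
  refine ⟨i, hi, Nat.zero_le _, ?_⟩
  have hx : x ∈ ({l[i].1, l[i].2.1, l[i].2.2} : Finset (Fin v)) := heq ▸ by simp
  have hy : y ∈ ({l[i].1, l[i].2.1, l[i].2.2} : Finset (Fin v)) := heq ▸ by simp
  simp only [Finset.mem_insert, Finset.mem_singleton] at hx hy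
  simp only [positionPairs, List.mem_cons, List.not_mem_nil, or_false, exists_eq_or_imp,
    exists_eq_left]
  rcases hx with rfl | rfl | rfl <;> rcases hy with rfl | rfl | rfl <;> simp at hxy ⊢

/-- Code that adds up the values of `p` and of `q` in registers `3` and `4`, for all smaller values
of register `1`. -/
def sumUp (p q : Expr) : Code := Code.loop 1 ((countDown.seq (increase 3 p)).seq (increase 4 q))

/-- Invariant: accumulator plus the terms still to come equals the full sum. This also keeps the
accumulators within the word size. -/
theorem runs_sumUp {p q : Expr} {n : ℕ} {r m : ℕ → ℕ} (hs : Small W r m) (hW : 1 < 2 ^ W)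
    (h0 : r 0 = v) (h1 : r 1 = n) (h2 : r 2 = base) (h3 : r 3 = 0) (h4 : r 4 = 0)
    (hp : ∀ i < n, p.IsSmall W ![v, i, base] m) (hq : ∀ i < n, q.IsSmall W ![v, i, base] m)
    (hpsum : ∑ i ∈ Finset.range n, p.eval ![v, i, base] m < 2 ^ W)
    (hqsum : ∑ i ∈ Finset.range n, q.eval ![v, i, base] m < 2 ^ W) :
    ∃ r', Runs W (sumUp p q) r m r' m (n * (4 + (p.cost + 1) + (q.cost + 1) + 2) + 1) ∧
      r' 3 = ∑ i ∈ Finset.range n, p.eval ![v, i, base] m ∧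
      r' 4 = ∑ i ∈ Finset.range n, q.eval ![v, i, base] m := by
  obtain ⟨r', m', hrun, -, rfl, -, -, -, -, h3', h4'⟩ :=
    Runs.loop (W := W) (i := 1) (c := (countDown.seq (increase 3 p)).seq (increase 4 q))
    (T := 4 + (p.cost + 1) + (q.cost + 1))
    (fun k r m' => r 1 = k ∧ m' = m ∧ k ≤ n ∧ Small W r m' ∧ r 0 = v ∧ r 2 = base ∧
      r 3 + ∑ i ∈ Finset.range k, p.eval ![v, i, base] m =
        ∑ i ∈ Finset.range n, p.eval ![v, i, base] m ∧
      r 4 + ∑ i ∈ Finset.range k, q.eval ![v, i, base] m =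
        ∑ i ∈ Finset.range n, q.eval ![v, i, base] m)
    (fun k r m h => h.1) (fun k r m h => h.2.2.2.1) (by
      rintro k r m' ⟨h1, rfl, hk, hs, h0, h2, h3, h4⟩
      obtain ⟨r₁, hrun₁, h11, hr₁⟩ := runs_countDown hW hs h1
      have hin₁ := inputs_eq ((hr₁ 0 (by norm_num) (by norm_num)).trans h0) h11
        ((hr₁ 2 (by norm_num) (by norm_num)).trans h2)
      rw [Finset.sum_range_succ, ← hr₁ 3 (by norm_num) (by norm_num)] at h3
      rw [Finset.sum_range_succ, ← hr₁ 4 (by norm_num) (by norm_num)] at h4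
      obtain ⟨r₂, hrun₂, h23, hr₂⟩ := runs_increase (i := 3) (e := p) (by norm_num) hrun₁.2.1
        (by rw [hin₁]; exact hp k hk) (by rw [hin₁]; omega)
      have h02 : ∀ i < 3, r₂ i = r₁ i := fun i hi => hr₂ i (by omega) (by omega)
      have hin₂ := (inputs_congr le_rfl h02).trans hin₁
      rw [← hr₂ 4 (by norm_num) (by norm_num)] at h4
      obtain ⟨r₃, hrun₃, h34, hr₃⟩ := runs_increase (i := 4) (e := q) (by norm_num) hrun₂.2.1
        (by rw [hin₂]; exact hq k hk) (by rw [hin₂]; omega)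
      have h33 := hr₃ 3 (by norm_num) (by norm_num)
      rw [hin₁] at h23
      rw [hin₂] at h34
      refine ⟨r₃, m', (hrun₁.seq hrun₂).seq hrun₃,
        (hr₃ 1 (by norm_num) (by norm_num)).trans ((h02 1 (by norm_num)).trans h11), rfl, by omega,
        hrun₃.2.1, (hr₃ 0 (by norm_num) (by norm_num)).trans ((h02 0 (by norm_num)).trans
          ((hr₁ 0 (by norm_num) (by norm_num)).trans h0)),
        (hr₃ 2 (by norm_num) (by norm_num)).trans ((h02 2 (by norm_num)).trans
          ((hr₁ 2 (by norm_num) (by norm_num)).trans h2)), by omega, by omega⟩)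
    n r m ⟨h1, rfl, le_rfl, hs, h0, h2, by omega, by omega⟩
  exact ⟨r', hrun, by simpa using h3', by simpa using h4'⟩

end

/-! ### The counting program, its running time and its word size -/

/-- Code for `(∑ p - ∑ q) / n`, both sums over the numbers less than the fourth power of the
order, where `p` and `q` may use the table of third points. -/
def evaluate (p q : Expr) (n : ℕ) : Code :=
  ((((((assign 2 (mul (const 3) (reg 1))).seq buildTable).seq
    (assign 1 (mul (reg 0) (mul (reg 0) (mul (reg 0) (reg 0)))))).seq (sumUp p q)).seq
      fun _ => [.sub 3 3 4]).seq fun _ => [.const 4 n]).seq fun _ => [.div 0 3 4]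

end RAM

open RAM Expr in
theorem Representable.countableInTime {C : Finset (Finset ℕ)} {n : ℕ}
    {φ : ∀ v, Finset (Finset (Fin v)) → ℕ} (hφ : Representable fun v B => (φ v B : ℤ))
    (hC : ∀ v B, IsSTS B → occurrences C B = φ v B / n) : CountableInTime 4 C := by
  obtain ⟨p, q, hpq⟩ := hφ
  -- Bounds the degrees of all expressions evaluated: `18` suffices for the table construction and
  -- the two assignments.
  set d := 18 + p.deg + q.deg with hd
  refine ⟨evaluate p q n 0, 4 + (4 + storePairsCost positionPairs + 2 + 1) + 8 +
    (4 + (p.cost + 1) + (q.cost + 1) + 2 + 1) + 1 + 1 + 1, 4 + 5 * d + 1 + n,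
    fun v B hB l hl => ?_⟩
  have hv : 0 < v := Fin.pos_iff_nonempty.2 hB.1
  set b := Nat.log 2 v + 1 with hb
  set u := 2 ^ b with hu
  -- Here $2^W=u^{4+5d+1+n}$ with $u>v$. The part $4+5d$ covers $v^4$ summands of size at most
  -- $(u^5)^d$, the `1` makes this strict, and `n` provides for the constant divisor.
  set W := (4 + 5 * d + 1 + n) * b with hW
  have hWu : 2 ^ W = u ^ (4 + 5 * d + 1 + n) := by rw [hW, hu, mul_comm, pow_mul]
  have hvu : v < u := Nat.lt_pow_succ_log_self (by norm_num) v
  have hu2 : 2 ≤ u := Nat.le_self_pow (by omega) 2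
  have hpow : ∀ k ≤ 4 + 5 * d, u ^ k < 2 ^ W := fun k hk => by
    rw [hWu]
    exact Nat.pow_lt_pow_right hu2 (by omega)
  have hvu5 : ∀ k ≤ 5, u ^ k ≤ u ^ 5 := fun k hk => Nat.pow_le_pow_right (by omega) hk
  -- The value `u ^ 5` bounds every input of an expression: the order, an index up to `v ^ 4`, and
  -- the table address `3 * l.length`, which is at most `4 * v ^ 3`.
  have hX : 2 ≤ u ^ 5 := hu2.trans (by simpa using hvu5 1 (by norm_num))
  have hXW : (u ^ 5) ^ d < 2 ^ W := by
    rw [← pow_mul]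
    exact hpow _ (by omega)
  have hvX : v ≤ u ^ 5 := hvu.le.trans (by simpa using hvu5 1 (by norm_num))
  have hlen := hl.length_le
  have hlen4 : l.length ≤ v ^ 4 := hlen.trans (Nat.pow_le_pow_right hv (by norm_num))
  have hbase : 3 * l.length ≤ u ^ 5 := by
    calc 3 * l.length ≤ 2 ^ 2 * v ^ 3 := Nat.mul_le_mul (by norm_num) hlen
      _ ≤ u ^ 2 * u ^ 3 := Nat.mul_le_mul (Nat.pow_le_pow_left hu2 2)
          (Nat.pow_le_pow_left hvu.le 3)
      _ = u ^ 5 := by ring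
  have hsmallX : ∀ x ≤ u ^ 5, x < 2 ^ W := fun x hx => hx.trans_lt (hpow 5 (by omega))
  have hv4 : v ^ 4 ≤ u ^ 5 := (Nat.pow_le_pow_left hvu.le 4).trans (hvu5 4 (by norm_num))
  have hin0 : (inputState l).mem = fun a => (entries l).getD a 0 := rfl
  have hs0 : Small W (inputState l).reg (inputState l).mem := by
    refine ⟨fun i => ?_, fun a => ?_⟩
    · rcases i with _ | _ | i
      · exact hsmallX v hvX
      · exact hsmallX l.length (by omega)
      · exact hsmallX 0 (Nat.zero_le _)
    · exact hsmallX _ ((entries_getD_lt hv l a).le.trans hvX)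
  have hdeg : ∀ (e : Expr) (r : Fin 3 → ℕ) (m : ℕ → ℕ), e.deg ≤ d → (∀ k, r k ≤ u ^ 5) →
      (∀ a, m a < v) → e.IsSmall W r m := fun e r m he hr hm =>
    isSmall_of_le hX hr (fun a => (hm a).le.trans hvX) e
      ((Nat.pow_le_pow_right (by omega) he).trans_lt hXW)
  have hregs : ∀ {a b c : ℕ}, a ≤ u ^ 5 → b ≤ u ^ 5 → c ≤ u ^ 5 →
      ∀ k, (![a, b, c] : Fin 3 → ℕ) k ≤ u ^ 5 := by
    intro a b c ha hb hc k
    fin_cases k <;> assumption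
  obtain ⟨r₁, hrun₁, h12, hr₁⟩ := runs_assign (i := 2) (e := mul (const 3) (reg 1)) hs0 (by
    rw [inputs_eq (r := (inputState l).reg) (a := v) (b := l.length) (c := 0) rfl rfl rfl]
    exact hdeg _ _ _ (by simp only [deg]; omega) (hregs hvX (by omega) (Nat.zero_le _))
      (entries_getD_lt hv l))
  obtain ⟨r₂, m, hrun₂, h20, h21, h22, hr₂, hm⟩ := runs_buildTable hB hl hX (by omega) hXW hvX hbase
    hrun₁.2.1 ((hr₁ 0 (by norm_num) (by norm_num)).trans rfl)
    ((hr₁ 1 (by norm_num) (by norm_num)).trans rfl) (h12.trans rfl)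
    (fun i hi hi3 => (hr₁ i hi (by omega)).trans (by interval_cases i <;> rfl)) hin0
  obtain ⟨r₃, hrun₃, h31, hr₃⟩ := runs_assign (i := 1)
    (e := mul (reg 0) (mul (reg 0) (mul (reg 0) (reg 0)))) hrun₂.2.1 (by
      rw [inputs_eq h20 h21 h22]
      exact hdeg _ _ _ (by simp only [deg]; omega) (hregs hvX (Nat.zero_le _) hbase) hm.1)
  rw [inputs_eq h20 h21 h22] at h31
  have h31 : r₃ 1 = v ^ 4 := h31.trans (by simp only [eval, Matrix.cons_val_zero]; ring)
  have hle : ∀ e : Expr, e.deg ≤ d → ∑ i ∈ Finset.range (v ^ 4),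
      e.eval ![v, i, 3 * l.length] m < 2 ^ W := by
    intro e he
    refine (Finset.sum_le_card_nsmul _ _ ((u ^ 5) ^ d) fun i hi => ?_).trans_lt ?_
    · have hi := Finset.mem_range.1 hi
      exact (eval_le hX (hregs hvX (by omega) hbase) (fun a => (hm.1 a).le.trans hvX) e).trans
        (Nat.pow_le_pow_right (by omega) he)
    · rw [Finset.card_range, smul_eq_mul, ← pow_mul]
      calc v ^ 4 * u ^ (5 * d) ≤ u ^ 4 * u ^ (5 * d) :=
            Nat.mul_le_mul_right _ (Nat.pow_le_pow_left hvu.le 4)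
        _ = u ^ (4 + 5 * d) := (pow_add _ _ _).symm
        _ < 2 ^ W := hpow _ le_rfl
  have hexpr : ∀ e : Expr, e.deg ≤ d → ∀ i < v ^ 4, e.IsSmall W ![v, i, 3 * l.length] m :=
    fun e he i hi => hdeg _ _ _ he (hregs hvX (by omega) hbase) hm.1
  obtain ⟨r₄, hrun₄, h43, h44⟩ := runs_sumUp (p := p) (q := q) hrun₃.2.1 (hsmallX 1 (by omega))
    ((hr₃ 0 (by norm_num) (by norm_num)).trans h20) h31
    ((hr₃ 2 (by norm_num) (by norm_num)).trans h22)
    ((hr₃ 3 (by norm_num) (by norm_num)).trans (hr₂ 3 (by norm_num) (by norm_num)))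
    ((hr₃ 4 (by norm_num) (by norm_num)).trans (hr₂ 4 (by norm_num) (by norm_num)))
    (hexpr p (by omega)) (hexpr q (by omega)) (hle p (by omega)) (hle q (by omega))
  have hφ := hpq v B hB _ m hm
  simp only [Finset.sum_sub_distrib, ← Nat.cast_sum, ← h43, ← h44] at hφ
  -- The difference is a cardinality-like natural number, so the machine's truncated subtraction
  -- does not cut anything off.
  have hsub : r₄ 3 - r₄ 4 = φ v B := by omega
  have hn : n < 2 ^ W := by
    rw [hWu]
    calc n < 2 ^ n := Nat.lt_two_pow_self
      _ ≤ u ^ n := Nat.pow_le_pow_left hu2 n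
      _ ≤ _ := Nat.pow_le_pow_right (by omega) (by omega)
  have hs₄ := hrun₄.2.1
  have hrun₅ : Runs W (fun _ => [.sub 3 3 4]) r₄ m _ m 1 := Runs.single (fun o => rfl) hs₄
    (hs₄.update_reg ((Nat.sub_le _ _).trans_lt (hs₄.1 3)))
  have hrun₆ : Runs W (fun _ => [.const 4 n]) _ m _ m 1 := Runs.single (fun o => rfl) hrun₅.2.1
    (hrun₅.2.1.update_reg hn)
  have hrun₇ : Runs W (fun _ => [.div 0 3 4]) _ m _ m 1 := Runs.single (fun o => rfl) hrun₆.2.1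
    (hrun₆.2.1.update_reg ((Nat.div_le_self _ _).trans_lt (hrun₆.2.1.1 3)))
  have hrun := (((((hrun₁.seq hrun₂).seq hrun₃).seq hrun₄).seq hrun₅).seq hrun₆).seq hrun₇
  obtain ⟨t, ht, hend, hfit⟩ := hrun.2.2 (evaluate p q n 0) 0 (fun k I hk => by
    rw [Nat.zero_add]
    exact hk)
  have hstart : (⟨0, (inputState l).reg, (inputState l).mem⟩ : State) = inputState l := rfl
  rw [hstart] at hend hfit
  refine ⟨t, ht.trans ?_, ?_, ?_, hfit⟩
  -- The two loops take at most `v ^ 4` passes each, and the fixed costs are absorbed since `v ^ 4`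
  -- is positive.
  · have h1 : 1 ≤ v ^ 4 := Nat.one_le_pow _ _ hv
    have h2 := Nat.mul_le_mul_right (4 + storePairsCost positionPairs + 2) hlen4
    simp only [cost]
    linarith
  · rw [hend]
    exact (Nat.zero_add _).ge
  · rw [hend, hC v B hB, ← hsub]
    simp [Function.update]

theorem IsConfiguration.countableInTime {C : Finset (Finset ℕ)} (hC : IsConfiguration C)
    (hcard : C.card ≤ 7) : CountableInTime 4 C :=
  (representable_card_embeddings _ (points C) C rfl subset_rfl hC.isPartialTripleSystem.1
    hcard).countableInTime fun _ _ hB => occurrences_eq_div C hB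

theorem theorem6 :
    (∀ C : Finset (Finset ℕ), IsConfiguration C → IsVariable C → (C.card = 6 ∨ C.card = 7) →
      CountableInTime 4 C) ∧
    HasExactlyUpToIso 5 (IsFullConfiguration 6) ∧
    HasExactlyUpToIso 19 (IsFullConfiguration 7) ∧
    (∀ (n : ℕ) (C : Finset (Finset ℕ)), (n = 6 ∨ n = 7) → IsFullConfiguration n C →
      ∃ S : Finset ℕ, S.card ≤ 4 ∧ Generates C S) := by
  refine ⟨fun C hC _ hcard => hC.countableInTime (by omega),
    hasExactlyUpToIso_isFullConfiguration (Or.inl rfl),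
    hasExactlyUpToIso_isFullConfiguration (Or.inr rfl), ?_⟩
  rintro n C hn ⟨hC, hF, hcard⟩
  obtain ⟨S, hS, hS4, hgen⟩ := exists_generators hC.isPartialTripleSystem hF (by omega)
  exact ⟨S, hS4, generates_of_isGenerated hS hgen⟩
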